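/- **Setting.** Let $M>0$, $0<a\ll M$ (that is, $0<a<a_0$ for some $a_0=a_0(M)>0$), and let $p_K=g_K^{\alpha\beta}\xi_\alpha\xi_\beta$ be the principal symbol of the d'Alembertian of the Kerr metric in Boyer–Lindquist coordinates $(t,r,\phi,\theta)$, with dual variables $\tau,\xi_r,\Phi,\Theta$; put $\Delta=r^2-2Mr+a^2$, $\rho^2=r^2+a^2\cos^2\theta$. Let $x\in\mathbb R^3$ be the rectangular coordinates with spherical coordinates $(r,\phi,\theta)$, let $\xi$ be dual to $x$, and let $U=\{x:\ |r-3M|<M/3\}$. Write $p_K=g_K^{tt}(\tau-\tilde\tau_1)(\tau-\tilde\tau_2)$ with $\tilde\tau_1>\tilde\tau_2$. Let $$R_a(r,\tau,\Phi)=(r^2+a^2)(r^3-3Mr^2+a^2r+a^2M)\tau^2-2aM(r^2-a^2)\tau\Phi-a^2(r-M)\Phi^2,$$ let $r_a(\omega)$, $|\omega|<6M$, be the root of $R_a(\cdot,1,\omega)$ near $3M$, and $\tilde\varrho_i=r-r_a(\Phi/\tilde\tau_i)$, $i=1,2$. Let $b>0$ be a smooth function of $r>2M$, let $\nu$ be a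 smooth function of $r>2M$ with $0<\nu<1$ for $|r-3M|<M/3$, let $\delta_1,C\in\mathbb R$, and $$q_S=-\delta_1\frac{(r-3M)^2}{r^4}-\frac{M(r-3M)}{r^2(r-2M)}\,b .$$ **Symbol classes.** $S^m$ is the class of smooth real functions $s(x,\xi)$ on $U\times\mathbb R^3$ with $|\partial_x^\alpha\partial_\xi^\beta s|\le C_{\alpha\beta}\langle\xi\rangle^{m-|\beta|}$; $S^{-\infty}=\bigcap_m S^m$; $S^m_{hom}$ is the class of smooth functions on $U\times(\mathbb R^3\setminus 0)$ that are positively homogeneous of degree $m$ in $\xi$. **Multiplier symbols.** Consider $\tilde s_1\in S^1_{hom}$, $\tilde s_0\in S^0_{hom}$ such that, for $x\in U$, $\xi\neq0$, $|\Phi|<6M|\tau|$, $$r^{-1}b(r)\bigl(r-r_a(\Phi/\tau)\bigr)\xi_r=\tilde\sigma_K+h\,p_K,\qquad \tilde\sigma_K:=b(r)\Bigl(1-\frac{3M}r\Bigr)\xi_r+\tilde s_1+\tilde s_0\tau ,$$ with some $h(x,\tau,\xi)$, smooth there and positively homogeneous of degree $-1$ in $(\tau,\xi)$; put $\tilde s_K=i\tilde\sigma_K$.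 Consider further $\tilde e_0\in S^0_{hom}$, $\tilde e_{-1}\in S^{-1}_{hom}$ such that $\tilde e_K:=q_S+\tilde e_0+\tilde e_{-1}\tau$ satisfies, for $x\in U$, $\xi\ne0$, $\tau\in\mathbb R$, $$\rho^2\Bigl(\frac1{2i}\{p_K,\tilde s_K\}+p_K\,\tilde e_K\Bigr)=\sum_{j=1}^8\mu_j^2 .$$ Here $\{p,s\}=\partial_{\xi_\alpha}p\,\partial_{x^\alpha}s-\partial_{x^\alpha}p\,\partial_{\xi_\alpha}s$ and, with $\lambda_{1,2,3}$ the three symbols $x_i\xi_j-x_j\xi_i$, $\lambda^2=\sum\lambda_j^2$, $$\mu_1^2=\tfrac{1-\nu}4\bigl(\alpha_1(\tau-\tilde\tau_2)+\alpha_2(\tau-\tilde\tau_1)\bigr)^2,\qquad \mu_2^2=\tfrac12(\beta_1^2+\beta_2^2-Ca)\xi_r^2,$$ $$\mu_{3,4,5}^2=\frac{\lambda_{1,2,3}^2}{\lambda^2+(r^2-2rM)\xi_r^2}\,\frac\nu4\bigl(\alpha_1(\tau-\tilde\tau_2)-\alpha_2(\tau-\tilde\tau_1)\bigr)^2,\qquad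 \mu_6^2=\frac{(r^2-2rM)\xi_r^2}{\lambda^2+(r^2-2rM)\xi_r^2}\,\frac\nu4\bigl(\alpha_1(\tau-\tilde\tau_2)-\alpha_2(\tau-\tilde\tau_1)\bigr)^2,$$ $$\mu_7^2=\frac{(Ca-\beta_2^2+\beta_1^2)(\tau-\tilde\tau_2)^2}{2(\tilde\tau_1-\tilde\tau_2)^2}\xi_r^2,\qquad \mu_8^2=\frac{(Ca-\beta_1^2+\beta_2^2)(\tau-\tilde\tau_1)^2}{2(\tilde\tau_1-\tilde\tau_2)^2}\xi_r^2,$$ where $\alpha_i=\frac{2|\tilde\tau_i|}{\tilde\tau_1-\tilde\tau_2}\,\alpha(r,\tilde\tau_i,\Phi)\,\tilde\varrho_i$, $\beta_i^2=\beta^2(r,\tilde\tau_i,\Phi)$, and, writing $r_a=r_a(\Phi/\tau)$, the function $\alpha>0$ is smooth with $\alpha^2(r,\tau,\Phi)\,(r-r_a)^2\tau^2=r^{-1}b\,\Delta^{-2}R_a(r,\tau,\Phi)(r-r_a)$, and $\beta^2(r,\tau,\Phi)=\Delta\,\partial_r\bigl(r^{-1}b\,(r-r_a)\bigr)-(r-M)\,r^{-1}b\,(r-r_a)$.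 **Truncation.** Let $\chi,\chi'$ be smooth functions on $\mathbb R$ that equal $1$ on $[1,\infty)$ and $0$ on some $(-\infty,c]$, $c>0$ ($c$ may depend on the function), and put $\tau_i=\chi(|\xi|)\tilde\tau_i$, $\varrho_i=\chi'(|\xi|)\tilde\varrho_i$, $$s_K=b(r)\Bigl(1-\frac{3M}r\Bigr)\xi_r+\chi(|\xi|)^2(\tilde s_1+\tilde s_0\tau),\qquad e_K=q_S+\chi(|\xi|)^2(\tilde e_0+\tilde e_{-1}\tau).$$ **Lemma 2.5.** There is $a_0=a_0(M)>0$ such that for all $0<a<a_0$ and all $b,\nu,\delta_1,C$ as above the following holds. Symbols $\tilde s_1,\tilde s_0,\tilde e_0,\tilde e_{-1}$ as above exist. For any such symbols and any cutoffs $\chi,\chi'$ there are, for $k=1,2,3$, symbols $s_i^\ell,s_{ik}^\ell,e_i^\ell\in S^\ell$ and remainders $r_1,r_{2k},r_{3k},r_4\in S^{-\infty}+\tau S^{-\infty}$ such that, for all $x\in U$, $\tau\in\mathbb R$, $\xi\in\mathbb R^3$, $$s_K=s_1^0\varrho_1(\tau-\tau_2)+s_2^0\varrho_2(\tau-\tau_1)+s_3^0\xi_r+r_1,$$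 $$\partial_{x^k}s_K=s_{1k}^0\varrho_1(\tau-\tau_2)+s_{2k}^0\varrho_2(\tau-\tau_1)+(s_{3k}^0+s_{4k}^{-1}\tau)\xi_r+r_{2k},$$ $$\partial_{\xi_k}s_K=s_{1k}^{-1}\varrho_1(\tau-\tau_2)+s_{2k}^{-1}\varrho_2(\tau-\tau_1)+(s_{3k}^{-1}+s_{4k}^{-2}\tau)\xi_r+r_{3k},$$ $$e_K=e_1^{-1}\varrho_1(\tau-\tau_2)+e_2^{-1}\varrho_2(\tau-\tau_1)+(e_3^{-1}+e_4^{-2}\tau)\xi_r+r_4 .$$ -/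

import Mathlib

open scoped ContDiff

namespace KerrTrap

/-- The space `ℝ³` with its Euclidean norm; it carries both the rectangular space variables `x`
and the dual variables `ξ`. -/
abbrev E3 : Type := EuclideanSpace ℝ (Fin 3)

/-! ### Phase space and the spherical momenta in rectangular coordinates

The rectangular coordinates are `x = (r cos φ sin θ, r sin φ sin θ, r cos θ)`, so that
`r = ‖x‖`.  -/

/-- The spatial region `|r - 3M| < M/3`, an open neighbourhood of the closed shell
`|r - 3M| ≤ M/4` around the photon sphere. -/
def shell (M : ℝ) : Set E3 := {x | |‖x‖ - 3 * M| < M / 3}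

/-- `ξ_r = (∂xᵏ/∂r) ξ_k`. -/
noncomputable def xiR (x ξ : E3) : ℝ := inner ℝ x ξ / ‖x‖

/-- The three symbols `λ_j` of the rotation fields, `x_i ξ_k - x_k ξ_i`. -/
def lam (j : Fin 3) (x ξ : E3) : ℝ := x (j + 1) * ξ (j + 2) - x (j + 2) * ξ (j + 1)

/-- `Φ = (∂xᵏ/∂φ) ξ_k = x₁ ξ₂ - x₂ ξ₁`. -/
def angPhi (x ξ : E3) : ℝ := x 0 * ξ 1 - x 1 * ξ 0

/-- `λ² = λ₁² + λ₂² + λ₃²`, which equals `Φ² / sin² θ + Θ²`. -/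
noncomputable def lamSq (x ξ : E3) : ℝ := ∑ j, lam j x ξ ^ 2

/-! ### The Kerr symbol -/

/-- `Δ = r² - 2Mr + a²`. -/
def kDelta (M a r : ℝ) : ℝ := r ^ 2 - 2 * M * r + a ^ 2

/-- `sin² θ`. -/
noncomputable def sinSq (x : E3) : ℝ := (x 0 ^ 2 + x 1 ^ 2) / ‖x‖ ^ 2

/-- `ρ² = r² + a² cos² θ`. -/
noncomputable def rhoSq (a : ℝ) (x : E3) : ℝ := ‖x‖ ^ 2 + a ^ 2 * (x 2 ^ 2 / ‖x‖ ^ 2)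

/-- `g_K^{tt}`. -/
noncomputable def gtt (M a : ℝ) (x : E3) : ℝ :=
  -((‖x‖ ^ 2 + a ^ 2) ^ 2 - a ^ 2 * kDelta M a ‖x‖ * sinSq x) / (rhoSq a x * kDelta M a ‖x‖)

/-- `g_K^{tφ}`. -/
noncomputable def gtphi (M a : ℝ) (x : E3) : ℝ :=
  -(a * (2 * M * ‖x‖)) / (rhoSq a x * kDelta M a ‖x‖)

/-- The part of the Kerr symbol without `τ`,
`g_K^{rr} ξ_r² + g_K^{θθ} Θ² + g_K^{φφ} Φ²`, written so that it is regular on the axis. -/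
noncomputable def pSpace (M a : ℝ) (x ξ : E3) : ℝ :=
  (kDelta M a ‖x‖ * xiR x ξ ^ 2 + lamSq x ξ - a ^ 2 / kDelta M a ‖x‖ * angPhi x ξ ^ 2) / rhoSq a x

/-- The principal symbol `p_K = g_K^{αβ} ξ_α ξ_β` of the Kerr d'Alembertian. -/
noncomputable def pK (M a : ℝ) (x : E3) (τ : ℝ) (ξ : E3) : ℝ :=
  gtt M a x * τ ^ 2 + 2 * gtphi M a x * τ * angPhi x ξ + pSpace M a x ξ

/-- In Boyer–Lindquist variables `pK` is the usual
`g^{tt} τ² + 2 g^{tφ} τ Φ + g^{φφ} Φ² + g^{rr} ξ_r² + g^{θθ} Θ²`. -/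
theorem pK_spherical (M a r θ φ τ : ℝ) (ξ : E3) (hr : 0 < r) (hθ : Real.sin θ ≠ 0)
    (hΔ : kDelta M a r ≠ 0) :
    let Δ := kDelta M a r
    let ρ2 := r ^ 2 + a ^ 2 * Real.cos θ ^ 2
    let Xr := Real.sin θ * Real.cos φ * ξ 0 + Real.sin θ * Real.sin φ * ξ 1 + Real.cos θ * ξ 2
    let Φ := -(r * Real.sin θ * Real.sin φ) * ξ 0 + r * Real.sin θ * Real.cos φ * ξ 1
    let Θ := r * Real.cos θ * Real.cos φ * ξ 0 + r * Real.cos θ * Real.sin φ * ξ 1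
      - r * Real.sin θ * ξ 2
    pK M a !₂[r * Real.sin θ * Real.cos φ, r * Real.sin θ * Real.sin φ, r * Real.cos θ] τ ξ
      = -((r ^ 2 + a ^ 2) ^ 2 - a ^ 2 * Δ * Real.sin θ ^ 2) / (ρ2 * Δ) * τ ^ 2
        + 2 * (-(a * (2 * M * r)) / (ρ2 * Δ)) * τ * Φ
        + (Δ - a ^ 2 * Real.sin θ ^ 2) / (ρ2 * Δ * Real.sin θ ^ 2) * Φ ^ 2
        + Δ / ρ2 * Xr ^ 2 + 1 / ρ2 * Θ ^ 2 := by
  intro Δ ρ2 Xr Φ Θ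
  set x : E3 := !₂[r * Real.sin θ * Real.cos φ, r * Real.sin θ * Real.sin φ, r * Real.cos θ]
    with hx
  have h0 : x 0 = r * Real.sin θ * Real.cos φ := by simp [hx]
  have h1 : x 1 = r * Real.sin θ * Real.sin φ := by simp [hx]
  have h2 : x 2 = r * Real.cos θ := by simp [hx]
  have sθ := Real.sin_sq_add_cos_sq θ
  have sφ := Real.sin_sq_add_cos_sq φ
  have hn : ‖x‖ = r := by
    have h : ‖x‖ ^ 2 = r ^ 2 := by
      rw [EuclideanSpace.norm_sq_eq, Fin.sum_univ_three, h0, h1, h2]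
      simp only [Real.norm_eq_abs, sq_abs]
      linear_combination (r ^ 2 * Real.sin θ ^ 2) * sφ + r ^ 2 * sθ
    exact (sq_eq_sq₀ (norm_nonneg _) hr.le).1 h
  have hr0 : r ≠ 0 := hr.ne'
  have hs : sinSq x = Real.sin θ ^ 2 := by
    rw [sinSq, hn, h0, h1]
    field_simp
    linear_combination sφ
  have hρ : rhoSq a x = ρ2 := by
    rw [rhoSq, hn, h2]
    simp only [ρ2]
    field_simp
  have hXr : xiR x ξ = Xr := by
    rw [xiR, hn, PiLp.inner_apply, Fin.sum_univ_three, h0, h1, h2]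
    simp only [Xr, RCLike.inner_apply, conj_trivial]
    field_simp
  have hΦ : angPhi x ξ = Φ := by
    rw [angPhi, h0, h1]
    simp only [Φ]
    ring
  have hL : lamSq x ξ = Φ ^ 2 / Real.sin θ ^ 2 + Θ ^ 2 := by
    have hΦ' : Φ ^ 2 / Real.sin θ ^ 2 = (r * (Real.cos φ * ξ 1 - Real.sin φ * ξ 0)) ^ 2 := by
      simp only [Φ]
      field_simp
      ring
    have e1 : (0 : Fin 3) + 1 = 1 := rfl
    have e2 : (0 : Fin 3) + 2 = 2 := rfl
    have e3 : (1 : Fin 3) + 1 = 2 := rfl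
    have e4 : (1 : Fin 3) + 2 = 0 := rfl
    have e5 : (2 : Fin 3) + 1 = 0 := rfl
    have e6 : (2 : Fin 3) + 2 = 1 := rfl
    rw [hΦ', lamSq, Fin.sum_univ_three]
    simp only [lam, e1, e2, e3, e4, e5, e6, h0, h1, h2, Θ]
    have c1 : Real.cos θ ^ 2 = 1 - Real.sin θ ^ 2 := by linarith
    have c2 : Real.cos φ ^ 2 = 1 - Real.sin φ ^ 2 := by linarith
    ring_nf
    simp only [c1, c2]
    ring_nf
  have hρ0 : ρ2 ≠ 0 := by
    have : 0 < ρ2 := by simp only [ρ2]; positivity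
    exact this.ne'
  rw [pK, gtt, gtphi, pSpace, hs, hρ, hXr, hL, hΦ, hn]
  change _ / (ρ2 * Δ) * _ + _ + (Δ * _ + _ - a ^ 2 / Δ * _) / ρ2 = _
  have hΔ' : Δ ≠ 0 := hΔ
  field_simp
  ring

/-- The discriminant (divided by four) of `p_K` as a quadratic polynomial in `τ`. -/
noncomputable def disc (M a : ℝ) (x ξ : E3) : ℝ :=
  (gtphi M a x * angPhi x ξ) ^ 2 - gtt M a x * pSpace M a x ξ

/-- The larger root `τ̃₁` of `p_K = 0` in `τ` (recall that `g_K^{tt} < 0`). -/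
noncomputable def tau1 (M a : ℝ) (x ξ : E3) : ℝ :=
  (-(gtphi M a x * angPhi x ξ) - √(disc M a x ξ)) / gtt M a x

/-- The smaller root `τ̃₂` of `p_K = 0` in `τ`. -/
noncomputable def tau2 (M a : ℝ) (x ξ : E3) : ℝ :=
  (-(gtphi M a x * angPhi x ξ) + √(disc M a x ξ)) / gtt M a x

/-- The factorization `p_K = g_K^{tt} (τ - τ̃₁) (τ - τ̃₂)`. -/
theorem pK_factor (M a : ℝ) (x : E3) (τ : ℝ) (ξ : E3) (hg : gtt M a x ≠ 0)
    (hd : 0 ≤ disc M a x ξ) :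
    pK M a x τ ξ = gtt M a x * (τ - tau1 M a x ξ) * (τ - tau2 M a x ξ) := by
  have h := Real.sq_sqrt hd
  rw [pK, tau1, tau2]
  field_simp
  simp only [disc] at h ⊢
  linear_combination h

/-! ### The trapped radius -/

/-- The polynomial `R_a(r, τ, Φ)`. -/
def Ra (M a r τ Φ : ℝ) : ℝ :=
  (r ^ 2 + a ^ 2) * (r ^ 3 - 3 * M * r ^ 2 + a ^ 2 * r + a ^ 2 * M) * τ ^ 2
    - 2 * a * M * (r ^ 2 - a ^ 2) * τ * Φ - a ^ 2 * (r - M) * Φ ^ 2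

/-- `r_a(w)`: the root of `r ↦ R_a(r, 1, w)` close to `3M`.  It is only used for `|w| < 6M`; there,
for small `a`, exactly one root lies in `|r - 3M| ≤ M/2`. -/
noncomputable def rTrap (M a w : ℝ) : ℝ :=
  Classical.epsilon fun r : ℝ => |r - 3 * M| ≤ M / 2 ∧ Ra M a r 1 w = 0

/-- `R̂_a(r, w)`, defined by `R_a(r, 1, w) = R̂_a(r, w) (r - r_a(w))`, with the value of the
derivative at `r = r_a(w)`. -/
noncomputable def RHat (M a r w : ℝ) : ℝ :=
  dslope (fun r' => Ra M a r' 1 w) (rTrap M a w) r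

/-- `ϱ̃₁ = r - r_a(Φ/τ̃₁)`. -/
noncomputable def rho1 (M a : ℝ) (x ξ : E3) : ℝ :=
  ‖x‖ - rTrap M a (angPhi x ξ / tau1 M a x ξ)

/-- `ϱ̃₂ = r - r_a(Φ/τ̃₂)`. -/
noncomputable def rho2 (M a : ℝ) (x ξ : E3) : ℝ :=
  ‖x‖ - rTrap M a (angPhi x ξ / tau2 M a x ξ)

/-! ### Symbol classes and the Poisson bracket -/

/-- The (time independent) space symbols of class `S^m` over the shell: smooth, with
`|∂_x^α ∂_ξ^β s(x, ξ)| ≤ C_{αβ} ⟨ξ⟩^{m - |β|}`.  The norm of the mixed iterated derivative of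
orders `j` in `x` and `k` in `ξ` controls, and is controlled by, all the partial derivatives with
`|α| = j`, `|β| = k`. -/
def IsSymbol (M : ℝ) (m : ℤ) (s : E3 → E3 → ℝ) : Prop :=
  ContDiffOn ℝ ∞ (fun z : E3 × E3 => s z.1 z.2) (shell M ×ˢ Set.univ) ∧
  ∀ j k : ℕ, ∃ C : ℝ, ∀ x ∈ shell M, ∀ ξ : E3,
    ‖iteratedFDeriv ℝ j (fun y => iteratedFDeriv ℝ k (s y) ξ) x‖
      ≤ C * √(1 + ‖ξ‖ ^ 2) ^ (m - (k : ℤ))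

/-- Smoothing symbols of class `S^{-∞} = ⋂ₘ S^m`. -/
def IsSmoothing (M : ℝ) (s : E3 → E3 → ℝ) : Prop := ∀ m : ℤ, IsSymbol M m s

/-- Smoothing space-time symbols of class `S^{-∞} + τ S^{-∞}`. -/
def IsSmoothingTau (M : ℝ) (r : E3 → ℝ → E3 → ℝ) : Prop :=
  ∃ u v : E3 → E3 → ℝ, IsSmoothing M u ∧ IsSmoothing M v ∧
    ∀ x τ ξ, r x τ ξ = u x ξ + τ * v x ξ

/-- Homogeneous space symbols of class `S^m_hom` over the shell: smooth for `ξ ≠ 0` and positively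
homogeneous of degree `m` in `ξ`. -/
def IsHomSymbol (M : ℝ) (m : ℤ) (s : E3 → E3 → ℝ) : Prop :=
  ContDiffOn ℝ ∞ (fun z : E3 × E3 => s z.1 z.2) (shell M ×ˢ {0}ᶜ) ∧
  ∀ x ∈ shell M, ∀ ξ : E3, ξ ≠ 0 → ∀ c : ℝ, 0 < c → s x (c • ξ) = c ^ m * s x ξ

/-- The conic space-time region `|Φ| < 6M |τ|`, `ξ ≠ 0` over the shell.  It is a neighbourhood of
the characteristic set `p_K = 0` (for small `a`), and `r_a(Φ/τ)` is smooth on it. -/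
def cone (M : ℝ) : Set (E3 × ℝ × E3) :=
  {z | z.1 ∈ shell M ∧ z.2.2 ≠ 0 ∧ |angPhi z.1 z.2.2| < 6 * M * |z.2.1|}

/-- Homogeneous space-time symbols of degree `m` on `cone M`: smooth and positively homogeneous of
degree `m` in `(τ, ξ)`. -/
def IsHomSpacetime (M : ℝ) (m : ℤ) (h : E3 → ℝ → E3 → ℝ) : Prop :=
  ContDiffOn ℝ ∞ (fun z : E3 × ℝ × E3 => h z.1 z.2.1 z.2.2) (cone M) ∧
  ∀ x τ ξ, (x, τ, ξ) ∈ cone M → ∀ c : ℝ, 0 < c → h x (c * τ) (c • ξ) = c ^ m * h x τ ξ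

/-- `∂_{xᵏ} f` for a function of `(x, τ, ξ)`. -/
noncomputable def dX (k : Fin 3) (f : E3 → ℝ → E3 → ℝ) (x : E3) (τ : ℝ) (ξ : E3) : ℝ :=
  fderiv ℝ (fun y => f y τ ξ) x (EuclideanSpace.single k 1)

/-- `∂_{ξ_k} f` for a function of `(x, τ, ξ)`. -/
noncomputable def dXi (k : Fin 3) (f : E3 → ℝ → E3 → ℝ) (x : E3) (τ : ℝ) (ξ : E3) : ℝ :=
  fderiv ℝ (fun η => f x τ η) ξ (EuclideanSpace.single k 1)

/-- The Poisson bracket `{p, s} = ∂_{ξ_α} p ∂_{x^α} s - ∂_{x^α} p ∂_{ξ_α} s`.  The functions do not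
depend on `t`, so the term with `α = 0` vanishes. -/
noncomputable def poisson (p s : E3 → ℝ → E3 → ℝ) (x : E3) (τ : ℝ) (ξ : E3) : ℝ :=
  ∑ k : Fin 3, (dXi k p x τ ξ * dX k s x τ ξ - dX k p x τ ξ * dXi k s x τ ξ)

/-- Frequency cutoffs `χ_{>1}`: smooth, equal to `1` on `[1, ∞)` and to `0` for small arguments. -/
def IsFreqCutoff (χ : ℝ → ℝ) : Prop :=
  ContDiff ℝ ∞ χ ∧ (∀ y, 1 ≤ y → χ y = 1) ∧ ∃ c : ℝ, 0 < c ∧ ∀ y, y ≤ c → χ y = 0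

/-! ### The multiplier symbol -/

/-- The expression `b(r) (1 - 3M/r) ξ_r + s₁ + s₀ τ`.  For the homogeneous `s₁`, `s₀` below it is
`i⁻¹ s̃_K`; for their truncations it is `s_K`. -/
noncomputable def multSymbol (M : ℝ) (b : ℝ → ℝ) (s₁ s₀ : E3 → E3 → ℝ)
    (x : E3) (τ : ℝ) (ξ : E3) : ℝ :=
  b ‖x‖ * (1 - 3 * M / ‖x‖) * xiR x ξ + s₁ x ξ + s₀ x ξ * τ

/-- The implicit definition of `s̃₁ ∈ S¹_hom` and `s̃₀ ∈ S⁰_hom`: near the characteristic set,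
`r⁻¹ b(r) (r - r_a(Φ/τ)) ξ_r = b(r) (1 - 3M/r) ξ_r + s̃₁ + s̃₀ τ + h p_K`
for some homogeneous space-time symbol `h`. -/
def IsKerrMultiplier (M a : ℝ) (b : ℝ → ℝ) (s₁ s₀ : E3 → E3 → ℝ) : Prop :=
  IsHomSymbol M 1 s₁ ∧ IsHomSymbol M 0 s₀ ∧
  ∃ h : E3 → ℝ → E3 → ℝ, IsHomSpacetime M (-1) h ∧
    ∀ x τ ξ, (x, τ, ξ) ∈ cone M →
      b ‖x‖ / ‖x‖ * (‖x‖ - rTrap M a (angPhi x ξ / τ)) * xiR x ξ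
        = multSymbol M b s₁ s₀ x τ ξ + h x τ ξ * pK M a x τ ξ

/-! ### The sum of squares and the correction symbol -/

/-- The positive symbol `α(r, τ, Φ)`, with
`α² (r - r_a(Φ/τ))² τ² = r⁻¹ b(r) R_a(r, τ, Φ) Δ⁻² (r - r_a(Φ/τ))`. -/
noncomputable def alphaK (M a : ℝ) (b : ℝ → ℝ) (r τ Φ : ℝ) : ℝ :=
  √(b r / r * RHat M a r (Φ / τ) / kDelta M a r ^ 2)

/-- `β²(r, τ, Φ) = Δ ∂_r (r⁻¹ b(r) (r - r_a(Φ/τ))) - (r - M) r⁻¹ b(r) (r - r_a(Φ/τ))`. -/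
noncomputable def betaSq (M a : ℝ) (b : ℝ → ℝ) (r τ Φ : ℝ) : ℝ :=
  kDelta M a r * deriv (fun r' => b r' / r' * (r' - rTrap M a (Φ / τ))) r
    - (r - M) * (b r / r) * (r - rTrap M a (Φ / τ))

/-- `α₁ = 2|τ̃₁| / (τ̃₁ - τ̃₂) · α(r, τ̃₁, Φ) ϱ̃₁`. -/
noncomputable def alpha1 (M a : ℝ) (b : ℝ → ℝ) (x ξ : E3) : ℝ :=
  2 * |tau1 M a x ξ| / (tau1 M a x ξ - tau2 M a x ξ)
    * alphaK M a b ‖x‖ (tau1 M a x ξ) (angPhi x ξ) * rho1 M a x ξ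

/-- `α₂ = 2|τ̃₂| / (τ̃₁ - τ̃₂) · α(r, τ̃₂, Φ) ϱ̃₂`. -/
noncomputable def alpha2 (M a : ℝ) (b : ℝ → ℝ) (x ξ : E3) : ℝ :=
  2 * |tau2 M a x ξ| / (tau1 M a x ξ - tau2 M a x ξ)
    * alphaK M a b ‖x‖ (tau2 M a x ξ) (angPhi x ξ) * rho2 M a x ξ

/-- The eight squares `μ₁², …, μ₈²`; the local names `β₁`, `β₂` stand for `β₁²`, `β₂²`. -/
noncomputable def muSq (M a C : ℝ) (b ν : ℝ → ℝ) (x : E3) (τ : ℝ) (ξ : E3) : Fin 8 → ℝ :=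
  let r := ‖x‖
  let t₁ := tau1 M a x ξ
  let t₂ := tau2 M a x ξ
  let plus := alpha1 M a b x ξ * (τ - t₂) + alpha2 M a b x ξ * (τ - t₁)
  let minus := alpha1 M a b x ξ * (τ - t₂) - alpha2 M a b x ξ * (τ - t₁)
  let β₁ := betaSq M a b r t₁ (angPhi x ξ)
  let β₂ := betaSq M a b r t₂ (angPhi x ξ)
  let radial := (r ^ 2 - 2 * r * M) * xiR x ξ ^ 2
  let den := lamSq x ξ + radial
  ![(1 - ν r) / 4 * plus ^ 2,
    1 / 2 * (β₁ + β₂ - C * a) * xiR x ξ ^ 2,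
    lam 0 x ξ ^ 2 / den * (ν r / 4) * minus ^ 2,
    lam 1 x ξ ^ 2 / den * (ν r / 4) * minus ^ 2,
    lam 2 x ξ ^ 2 / den * (ν r / 4) * minus ^ 2,
    radial / den * (ν r / 4) * minus ^ 2,
    (C * a - β₂ + β₁) * (τ - t₂) ^ 2 / (2 * (t₁ - t₂) ^ 2) * xiR x ξ ^ 2,
    (C * a - β₁ + β₂) * (τ - t₁) ^ 2 / (2 * (t₁ - t₂) ^ 2) * xiR x ξ ^ 2]

/-- The Schwarzschild function
`q_S = -δ₁ (r - 3M)² / r⁴ - M (r - 3M) b(r) / (r² (r - 2M))`. -/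
noncomputable def qS (M δ₁ : ℝ) (b : ℝ → ℝ) (r : ℝ) : ℝ :=
  -(δ₁ * (r - 3 * M) ^ 2 / r ^ 4) - M * (r - 3 * M) / (r ^ 2 * (r - 2 * M)) * b r

/-- The expression `q_S + e₀ + e_{-1} τ`.  For the homogeneous `e₀`, `e_{-1}` below it is `ẽ_K`; for
their truncations it is `e_K`. -/
noncomputable def corrSymbol (M δ₁ : ℝ) (b : ℝ → ℝ) (e₀ e₁ : E3 → E3 → ℝ)
    (x : E3) (τ : ℝ) (ξ : E3) : ℝ :=
  qS M δ₁ b ‖x‖ + e₀ x ξ + e₁ x ξ * τ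

/-- The implicit definition of `ẽ₀ ∈ S⁰_hom` and `ẽ_{-1} ∈ S^{-1}_hom` (called `e₁` here): with
`ẽ_K = q_S + ẽ₀ + ẽ_{-1} τ`,
`ρ² ((2i)⁻¹ {p_K, s̃_K} + p_K ẽ_K) = μ₁² + ⋯ + μ₈²`. -/
def IsKerrCorrection (M a C δ₁ : ℝ) (b ν : ℝ → ℝ) (s₁ s₀ e₀ e₁ : E3 → E3 → ℝ) : Prop :=
  IsHomSymbol M 0 e₀ ∧ IsHomSymbol M (-1) e₁ ∧
  ∀ x ∈ shell M, ∀ (τ : ℝ) (ξ : E3), ξ ≠ 0 →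
    rhoSq a x * (1 / 2 * poisson (pK M a) (multSymbol M b s₁ s₀) x τ ξ
        + pK M a x τ ξ * corrSymbol M δ₁ b e₀ e₁ x τ ξ)
      = ∑ j, muSq M a C b ν x τ ξ j

/-! ### Removing the singularity at zero frequency -/

/-- Multiplication of a space symbol by `χ(|ξ|)`. -/
noncomputable def trunc (χ : ℝ → ℝ) (s : E3 → E3 → ℝ) (x ξ : E3) : ℝ := χ ‖ξ‖ * s x ξ

/-- `s_K = b(r) (1 - 3M/r) ξ_r + χ(|ξ|)² s̃₁ + χ(|ξ|)² s̃₀ τ`. -/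
noncomputable def sK (M : ℝ) (b χ : ℝ → ℝ) (s₁ s₀ : E3 → E3 → ℝ) : E3 → ℝ → E3 → ℝ :=
  multSymbol M b (trunc (fun y => χ y ^ 2) s₁) (trunc (fun y => χ y ^ 2) s₀)

/-- `e_K = q_S + χ(|ξ|)² ẽ₀ + χ(|ξ|)² ẽ_{-1} τ`. -/
noncomputable def eK (M δ₁ : ℝ) (b χ : ℝ → ℝ) (e₀ e₁ : E3 → E3 → ℝ) : E3 → ℝ → E3 → ℝ :=
  corrSymbol M δ₁ b (trunc (fun y => χ y ^ 2) e₀) (trunc (fun y => χ y ^ 2) e₁)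

/-- `ϱ₁ (τ - τ₂)`, where `ϱ₁ = χ'(|ξ|) ϱ̃₁` and `τ₂ = χ(|ξ|) τ̃₂`. -/
noncomputable def vanish1 (M a : ℝ) (χ χ' : ℝ → ℝ) (x : E3) (τ : ℝ) (ξ : E3) : ℝ :=
  trunc χ' (rho1 M a) x ξ * (τ - trunc χ (tau2 M a) x ξ)

/-- `ϱ₂ (τ - τ₁)`, where `ϱ₂ = χ'(|ξ|) ϱ̃₂` and `τ₁ = χ(|ξ|) τ̃₁`. -/
noncomputable def vanish2 (M a : ℝ) (χ χ' : ℝ → ℝ) (x : E3) (τ : ℝ) (ξ : E3) : ℝ :=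
  trunc χ' (rho2 M a) x ξ * (τ - trunc χ (tau1 M a) x ξ)

/-- Over the shell, `f` has the form
`c₁ ϱ₁ (τ - τ₂) + c₂ ϱ₂ (τ - τ₁) + (c₃ + c₄ τ) ξ_r + r` with `c₁, c₂ ∈ S^m`, `c₃ ∈ S^m`,
`c₄ ∈ S^{m-1}` and `r ∈ S^{-∞} + τ S^{-∞}`. -/
def Decomposes (M a : ℝ) (χ χ' : ℝ → ℝ) (m : ℤ) (f : E3 → ℝ → E3 → ℝ) : Prop :=
  ∃ c₁ c₂ c₃ c₄ : E3 → E3 → ℝ, ∃ r : E3 → ℝ → E3 → ℝ,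
    IsSymbol M m c₁ ∧ IsSymbol M m c₂ ∧ IsSymbol M m c₃ ∧ IsSymbol M (m - 1) c₄ ∧
    IsSmoothingTau M r ∧
    ∀ x ∈ shell M, ∀ (τ : ℝ) (ξ : E3),
      f x τ ξ = c₁ x ξ * vanish1 M a χ χ' x τ ξ + c₂ x ξ * vanish2 M a χ χ' x τ ξ
        + (c₃ x ξ + c₄ x ξ * τ) * xiR x ξ + r x τ ξ

/-- The same without the term `c₄ τ ξ_r`. -/
def DecomposesStrict (M a : ℝ) (χ χ' : ℝ → ℝ) (m : ℤ) (f : E3 → ℝ → E3 → ℝ) : Prop :=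
  ∃ c₁ c₂ c₃ : E3 → E3 → ℝ, ∃ r : E3 → ℝ → E3 → ℝ,
    IsSymbol M m c₁ ∧ IsSymbol M m c₂ ∧ IsSymbol M m c₃ ∧ IsSmoothingTau M r ∧
    ∀ x ∈ shell M, ∀ (τ : ℝ) (ξ : E3),
      f x τ ξ = c₁ x ξ * vanish1 M a χ χ' x τ ξ + c₂ x ξ * vanish2 M a χ χ' x τ ξ
        + c₃ x ξ * xiR x ξ + r x τ ξ

end KerrTrap

/-! Both implicit equations become explicit on the characteristic set, where `τ` is one of the roots
`τ̃₁`, `τ̃₂` of `p_K`. The first one forces `σ̃_K`, which is affine in `τ`, to be `ξ_r Q`, where `Q`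
is the affine interpolant of the values `r⁻¹ b ϱ̃ᵢ` at `τ = τ̃ᵢ`: `Q = r⁻¹ b (ϱ̃₁ (τ - τ̃₂) - ϱ̃₂ (τ
- τ̃₁)) / (τ̃₁ - τ̃₂)`. This gives uniqueness (`IsKerrMultiplier.eq`). For existence, the error of
the interpolation is divisible by `p_K`, with a smooth quotient built from the divided differences
of `r_a` (`isKerrMultiplier_mult`). The formula is itself the required form of `s_K`, and the
Leibniz rule for `ξ_r Q` gives the form of its derivatives.

For `ẽ_K` consider `N = ρ⁻² ∑ μⱼ² - {p_K, σ̃_K} / 2`, a cubic in `τ`. With `τ` frozen at `τ̃ᵢ`, the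
bracket with `p_K` kills `Φ` and `τ̃ᵢ`, so `{p_K, ϱ̃ᵢ} = {p_K, r}`, while `{p_K, ξ_r}` is expressed
through `R_a`. The definitions of `α` and `β` then make `N` vanish at both roots (`num_tau1`,
`num_tau2`). Hence `N = p_K ẽ_K` with `ẽ_K` affine in `τ`, which gives existence; uniqueness follows
by cancelling `p_K` off its zeros. The value of `ẽ_K` at `τ̃ᵢ` is the quotient of the `τ`
derivatives of `N` and `p_K`. Every term of the derivative of `N` at `τ̃ᵢ` contains `ϱ̃ᵢ` or `ξ_r`
(`numDeriv_tau1`, `numDeriv_tau2`), and interpolating between the two roots yields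
`corr_decomposition`.

The symbol estimates come from homogeneity and compactness (`EvHom.isSymbol`). For this the explicit
symbols are built over a larger shell, which contains the compact closure of the given one.
Truncating the coefficients leaves the identities intact for `|ξ| > 1`, so the error is affine in
`τ`, smooth and zero at high frequency (`isSmoothingTau_remainder`).

Smallness of `a` enters in three ways: `R_a(·, 1, w)` is strictly increasing near `3M`
(`le_RaSlope`), so `r_a` exists and is smooth; the roots `τ̃ᵢ` have opposite signs (`disc_gt`); and
`p_K = 0` implies `|Φ| < 6M |τ|` (`abs_angPhi_lt`), so `r_a(Φ/τ̃ᵢ)` makes sense. -/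

namespace KerrTrap

/-! ### The two shells. -/

/-- The larger spatial region `|r - 3M| < M/2`, a neighbourhood of the closure of `shell M`. -/
def wide (M : ℝ) : Set E3 := {x | |‖x‖ - 3 * M| < M / 2}

theorem isOpen_wide (M : ℝ) : IsOpen (wide M) :=
  isOpen_lt (by fun_prop) continuous_const

theorem isOpen_shell (M : ℝ) : IsOpen (shell M) :=
  isOpen_lt (by fun_prop) continuous_const

theorem shell_subset_wide {M : ℝ} (hM : 0 < M) : shell M ⊆ wide M := fun x hx => by
  have h : |‖x‖ - 3 * M| < M / 3 := hx
  have : |‖x‖ - 3 * M| < M / 2 := by linarith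
  exact this

theorem isOpen_wide_prod (M : ℝ) : IsOpen (wide M ×ˢ (Set.univ : Set E3)) :=
  (isOpen_wide M).prod isOpen_univ

theorem isOpen_wide_prod_compl (M : ℝ) : IsOpen (wide M ×ˢ ({0}ᶜ : Set E3)) :=
  (isOpen_wide M).prod isOpen_compl_singleton

/-! ### Joint smoothness of iterated partial derivatives. -/

section PartialDerivatives

variable {E F G : Type*} [NormedAddCommGroup E] [NormedSpace ℝ E] [NormedAddCommGroup F]
  [NormedSpace ℝ F] [NormedAddCommGroup G] [NormedSpace ℝ G]

/-- A derivative in the second variable is the total derivative composed with the inclusion `inr`,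
so each step of the induction stays jointly smooth. The symbol estimates use derivatives taken in
one variable at a time, whence this form. -/
theorem ContDiffOn.iteratedFDeriv_snd {s : E → F → G} {U : Set (E × F)} (hU : IsOpen U)
    (hs : ContDiffOn ℝ ∞ (fun z : E × F => s z.1 z.2) U) (k : ℕ) :
    ContDiffOn ℝ ∞ (fun z : E × F => iteratedFDeriv ℝ k (s z.1) z.2) U := by
  induction k with
  | zero =>
    simp only [iteratedFDeriv_zero_eq_comp]
    exact (continuousMultilinearCurryFin0 ℝ F G).symm.contDiff.comp_contDiffOn hs
  | succ k ih =>
    simp only [iteratedFDeriv_succ_eq_comp_left]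
    have h1 : ContDiffOn ℝ ∞ (fun z : E × F =>
        (fderiv ℝ (fun z : E × F => iteratedFDeriv ℝ k (s z.1) z.2) z).comp
          (ContinuousLinearMap.inr ℝ E F)) U :=
      (ih.fderiv_of_isOpen hU (by simp)).clm_comp contDiffOn_const
    refine (h1.continuousLinearMap_comp
      ((continuousMultilinearCurryLeftEquiv ℝ (fun _ : Fin (k + 1) => F) G).symm :
        _ →L[ℝ] F [×(k + 1)]→L[ℝ] G)).congr fun z hz => ?_
    have hd : HasFDerivAt (fun z : E × F => iteratedFDeriv ℝ k (s z.1) z.2)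
        (fderiv ℝ (fun z : E × F => iteratedFDeriv ℝ k (s z.1) z.2) z) (z.1, z.2) :=
      ((ih.contDiffAt (hU.mem_nhds hz)).differentiableAt (by simp)).hasFDerivAt
    have h2 : HasFDerivAt (fun η => (z.1, η)) (ContinuousLinearMap.inr ℝ E F) z.2 :=
      hasFDerivAt_prodMk_right z.1 z.2
    exact congrArg (continuousMultilinearCurryLeftEquiv ℝ (fun _ : Fin (k + 1) => F) G).symm
      (hd.comp z.2 h2).fderiv

theorem ContDiffOn.iteratedFDeriv_fst {s : E → F → G} {U : Set (E × F)} (hU : IsOpen U)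
    (hs : ContDiffOn ℝ ∞ (fun z : E × F => s z.1 z.2) U) (k : ℕ) :
    ContDiffOn ℝ ∞ (fun z : E × F => iteratedFDeriv ℝ k (fun y => s y z.2) z.1) U := by
  have hU' : IsOpen (Prod.swap ⁻¹' U : Set (F × E)) := hU.preimage continuous_swap
  have h := ContDiffOn.iteratedFDeriv_snd (s := fun (ξ : F) (y : E) => s y ξ) hU'
    (hs.comp (g := fun z : E × F => s z.1 z.2) (f := Prod.swap)
      (contDiff_snd.prodMk contDiff_fst).contDiffOn (fun _ h => h)) k
  exact h.comp (f := Prod.swap) (contDiff_snd.prodMk contDiff_fst).contDiffOn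
    (fun z hz => by simpa using hz)

end PartialDerivatives

/-! ### Symbol estimates from homogeneity at high frequency. -/

/-- Smooth symbols over the wide shell that are homogeneous of degree `m` at frequencies above `1`. -/
def EvHom (M : ℝ) (m : ℤ) (s : E3 → E3 → ℝ) : Prop :=
  ContDiffOn ℝ ∞ (fun z : E3 × E3 => s z.1 z.2) (wide M ×ˢ Set.univ) ∧
  ∀ x ∈ wide M, ∀ ξ : E3, 1 < ‖ξ‖ → ∀ c : ℝ, 1 ≤ c → s x (c • ξ) = c ^ m * s x ξ

/-- Differentiating `η ↦ s x (c • η)` produces one factor `c` per derivative, which lowers the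
degree by one. The scaling identity may be differentiated because it holds on the open set `|η| >
1`. -/
theorem EvHom.iteratedFDeriv_smul {M : ℝ} {m : ℤ} {s : E3 → E3 → ℝ} (h : EvHom M m s) (k : ℕ)
    {x : E3} (hx : x ∈ wide M) {ξ : E3} (hξ : 1 < ‖ξ‖) {c : ℝ} (hc : 1 ≤ c) :
    iteratedFDeriv ℝ k (s x) (c • ξ) = c ^ (m - k) • iteratedFDeriv ℝ k (s x) ξ := by
  induction k generalizing ξ with
  | zero =>
    ext v
    simp [h.2 x hx ξ hξ c hc]
  | succ k ih =>
    have hc0 : c ≠ 0 := by positivity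
    have hev : (fun η => iteratedFDeriv ℝ k (s x) (c • η)) =ᶠ[nhds ξ]
        fun η => c ^ (m - k) • iteratedFDeriv ℝ k (s x) η := by
      filter_upwards [(isOpen_lt continuous_const continuous_norm).mem_nhds hξ] with η hη
      exact ih hη
    have h1 : c • fderiv ℝ (iteratedFDeriv ℝ k (s x)) (c • ξ)
        = c ^ (m - (k : ℤ)) • fderiv ℝ (iteratedFDeriv ℝ k (s x)) ξ := by
      have e := hev.fderiv_eq (𝕜 := ℝ)
      rw [fderiv_comp_smul] at e
      rw [e]
      exact congrFun (fderiv_const_smul_field (c ^ (m - (k : ℤ)))) ξ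
    have h2 : fderiv ℝ (iteratedFDeriv ℝ k (s x)) (c • ξ)
        = c ^ (m - (k + 1 : ℕ)) • fderiv ℝ (iteratedFDeriv ℝ k (s x)) ξ := by
      have : c⁻¹ • (c • fderiv ℝ (iteratedFDeriv ℝ k (s x)) (c • ξ))
        = c⁻¹ • (c ^ (m - k) • fderiv ℝ (iteratedFDeriv ℝ k (s x)) ξ) := by rw [h1]
      rw [smul_smul, inv_mul_cancel₀ hc0, one_smul, smul_smul] at this
      rw [this]
      congr 1
      rw [show m - ((k + 1 : ℕ) : ℤ) = -1 + (m - k) by push_cast; ring, zpow_add₀ hc0, zpow_neg_one]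
    simp only [iteratedFDeriv_succ_eq_comp_left, Function.comp, h2, map_smul]

/-- Used with `t = ⟨ξ⟩` and `c` a comparable scale; the exponent `m - k` can have either sign, so
both inequalities between `c` and `t` are needed. -/
theorem zpow_le_mul_zpow {c t : ℝ} (hc : 0 < c) (h1 : c ≤ t) (h2 : t ≤ 3 * c) (n : ℤ) :
    c ^ n ≤ 3 ^ n.natAbs * t ^ n := by
  have ht : 0 < t := hc.trans_le h1
  obtain ⟨k, rfl | rfl⟩ := n.eq_nat_or_neg
  · simp only [zpow_natCast, Int.natAbs_natCast]
    calc c ^ k ≤ t ^ k := by gcongr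
      _ = 1 * t ^ k := by ring
      _ ≤ 3 ^ k * t ^ k := by gcongr; exact one_le_pow₀ (by norm_num)
  · simp only [zpow_neg, zpow_natCast, Int.natAbs_neg, Int.natAbs_natCast]
    rw [← div_eq_mul_inv, le_div_iff₀ (by positivity), ← div_eq_inv_mul,
      div_le_iff₀ (by positivity), ← mul_pow]
    gcongr

/-- For `|ξ| ≤ 2` continuity on a compact set gives the bound. For `|ξ| > 2` scaling brings `ξ` back
to the sphere of radius `2`, and the factor `c ^ (m - k)` is comparable to the required power of
`⟨ξ⟩`. -/
theorem EvHom.isSymbol {M : ℝ} (hM : 0 < M) {m : ℤ} {s : E3 → E3 → ℝ} (h : EvHom M m s) :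
    IsSymbol M m s := by
  refine ⟨h.1.mono (Set.prod_mono (shell_subset_wide hM) le_rfl), fun j k => ?_⟩
  have hsm : ContDiffOn ℝ ∞ (fun z : E3 × E3 =>
      iteratedFDeriv ℝ j (fun y => iteratedFDeriv ℝ k (s y) z.2) z.1) (wide M ×ˢ Set.univ) :=
    ContDiffOn.iteratedFDeriv_fst (s := fun y ξ => iteratedFDeriv ℝ k (s y) ξ)
      (isOpen_wide_prod M) (ContDiffOn.iteratedFDeriv_snd (isOpen_wide_prod M) h.1 k) j
  have hK1 : IsCompact {x : E3 | |‖x‖ - 3 * M| ≤ M / 3} := by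
    refine (isCompact_closedBall (0 : E3) (4 * M)).of_isClosed_subset
      (isClosed_le (by fun_prop) continuous_const) fun x hx => ?_
    have := (abs_le.1 (show |‖x‖ - 3 * M| ≤ M / 3 from hx)).2
    simp only [Metric.mem_closedBall, dist_zero_right]
    linarith
  have hK := hK1.prod (isCompact_closedBall (0 : E3) 2)
  obtain ⟨C, hC⟩ := hK.exists_bound_of_continuousOn (hsm.continuousOn.mono (by
    rintro ⟨x, ξ⟩ ⟨hx, -⟩
    refine ⟨?_, trivial⟩
    have h1 : |‖x‖ - 3 * M| ≤ M / 3 := hx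
    have : |‖x‖ - 3 * M| < M / 2 := by linarith
    exact this))
  refine ⟨C * 3 ^ (m - k).natAbs, fun x hx ξ => ?_⟩
  have hx' : |‖x‖ - 3 * M| ≤ M / 3 := le_of_lt hx
  have hxw := shell_subset_wide hM hx
  have hC0 : 0 ≤ C := (norm_nonneg _).trans (hC (x, 0) ⟨hx', by simp⟩)
  -- The two hypotheses say `c ≤ ⟨ξ⟩ ≤ 3c`. They hold with `c = 1` for `|ξ| ≤ 2`, and with `c = |ξ|
  -- / 2` otherwise.
  have hjap : ∀ c : ℝ, 0 < c → c ^ 2 ≤ 1 + ‖ξ‖ ^ 2 → 1 + ‖ξ‖ ^ 2 ≤ (3 * c) ^ 2 →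
      C * c ^ (m - (k : ℤ)) ≤ C * 3 ^ (m - k).natAbs * √(1 + ‖ξ‖ ^ 2) ^ (m - (k : ℤ)) := by
    intro c hc h1 h2
    rw [mul_assoc]
    gcongr
    exact zpow_le_mul_zpow hc (Real.le_sqrt_of_sq_le h1)
      (Real.sqrt_le_iff.2 ⟨by positivity, h2⟩) _
  rcases le_or_gt ‖ξ‖ 2 with hξ | hξ
  · refine (hC (x, ξ) ⟨hx', by simpa using hξ⟩).trans ?_
    have h3 : ‖ξ‖ ^ 2 ≤ 4 := by nlinarith [norm_nonneg ξ]
    simpa using hjap 1 one_pos (by nlinarith [norm_nonneg ξ]) (by linarith)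
  · set c : ℝ := ‖ξ‖ / 2 with hcdef
    have hc1 : 1 ≤ c := by linarith
    have hc0 : 0 < c := by linarith
    set ζ : E3 := c⁻¹ • ξ with hζ
    have hξζ : ξ = c • ζ := by rw [hζ, smul_inv_smul₀ hc0.ne']
    have hnζ : ‖ζ‖ = 2 := by
      rw [hζ, norm_smul, norm_inv, Real.norm_of_nonneg hc0.le, hcdef]
      field_simp
    -- The scale `c` depends on `ξ` only, so the identity holds for all `y` near `x` and can be
    -- differentiated in `y`.
    have hev : (fun y => iteratedFDeriv ℝ k (s y) ξ) =ᶠ[nhds x]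
        (c ^ (m - (k : ℤ)) • fun y => iteratedFDeriv ℝ k (s y) ζ) := by
      filter_upwards [(isOpen_wide M).mem_nhds hxw] with y hy
      rw [hξζ]
      exact h.iteratedFDeriv_smul k hy (by rw [hnζ]; norm_num) hc1
    have hcd : ContDiffAt ℝ j (fun y => iteratedFDeriv ℝ k (s y) ζ) x := by
      have h1 := ((ContDiffOn.iteratedFDeriv_snd (isOpen_wide_prod M) h.1 k).contDiffAt
        ((isOpen_wide_prod M).mem_nhds
        (show (x, ζ) ∈ wide M ×ˢ (Set.univ : Set E3) from ⟨hxw, trivial⟩)))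
      exact (h1.comp x (f := fun y => (y, ζ)) (by fun_prop)).of_le (by exact_mod_cast le_top)
    rw [(Filter.EventuallyEq.iteratedFDeriv ℝ hev j).eq_of_nhds, iteratedFDeriv_const_smul_apply hcd, norm_smul,
      Real.norm_of_nonneg (by positivity), mul_comm]
    have h4 := hC (x, ζ) ⟨hx', by simp [hnζ]⟩
    refine (mul_le_mul_of_nonneg_right h4 (by positivity)).trans ?_
    exact hjap c hc0 (by nlinarith) (by nlinarith)

/-! ### Calculus of homogeneous symbols. -/

/-- Homogeneous symbols over the wide shell. -/
def WideHom (M : ℝ) (m : ℤ) (s : E3 → E3 → ℝ) : Prop :=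
  ContDiffOn ℝ ∞ (fun z : E3 × E3 => s z.1 z.2) (wide M ×ˢ {0}ᶜ) ∧
  ∀ x ∈ wide M, ∀ ξ : E3, ξ ≠ 0 → ∀ c : ℝ, 0 < c → s x (c • ξ) = c ^ m * s x ξ

namespace WideHom

variable {M : ℝ} {m n : ℤ} {s t : E3 → E3 → ℝ}

theorem isHomSymbol (hM : 0 < M) (h : WideHom M m s) : IsHomSymbol M m s :=
  ⟨h.1.mono (Set.prod_mono (shell_subset_wide hM) le_rfl),
    fun x hx => h.2 x (shell_subset_wide hM hx)⟩

theorem congr (h : WideHom M m s) (e : ∀ x ∈ wide M, ∀ ξ ≠ 0, t x ξ = s x ξ) :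
    WideHom M m t := by
  refine ⟨h.1.congr fun z hz => e _ hz.1 _ hz.2, fun x hx ξ hξ c hc => ?_⟩
  rw [e x hx _ (smul_ne_zero hc.ne' hξ), e x hx ξ hξ, h.2 x hx ξ hξ c hc]

theorem cast (h : WideHom M m s) (e : m = n) : WideHom M n s := e ▸ h

theorem add (hs : WideHom M m s) (ht : WideHom M m t) :
    WideHom M m (fun x ξ => s x ξ + t x ξ) :=
  ⟨hs.1.add ht.1, fun x hx ξ hξ c hc => by
    beta_reduce
    rw [hs.2 x hx ξ hξ c hc, ht.2 x hx ξ hξ c hc]; ring⟩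

theorem neg (hs : WideHom M m s) : WideHom M m (fun x ξ => -s x ξ) :=
  ⟨hs.1.neg, fun x hx ξ hξ c hc => by
    beta_reduce
    rw [hs.2 x hx ξ hξ c hc]; ring⟩

theorem sub (hs : WideHom M m s) (ht : WideHom M m t) :
    WideHom M m (fun x ξ => s x ξ - t x ξ) :=
  ⟨hs.1.sub ht.1, fun x hx ξ hξ c hc => by
    beta_reduce
    rw [hs.2 x hx ξ hξ c hc, ht.2 x hx ξ hξ c hc]; ring⟩

theorem mul (hs : WideHom M m s) (ht : WideHom M n t) :
    WideHom M (m + n) (fun x ξ => s x ξ * t x ξ) :=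
  ⟨hs.1.mul ht.1, fun x hx ξ hξ c hc => by
    beta_reduce
    rw [hs.2 x hx ξ hξ c hc, ht.2 x hx ξ hξ c hc, zpow_add₀ hc.ne']; ring⟩

theorem inv (hs : WideHom M m s) (h0 : ∀ x ∈ wide M, ∀ ξ ≠ 0, s x ξ ≠ 0) :
    WideHom M (-m) (fun x ξ => (s x ξ)⁻¹) :=
  ⟨hs.1.inv fun z hz => h0 _ hz.1 _ hz.2, fun x hx ξ hξ c hc => by
    beta_reduce
    rw [hs.2 x hx ξ hξ c hc, mul_inv, zpow_neg]⟩

theorem div (hs : WideHom M m s) (ht : WideHom M n t)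
    (h0 : ∀ x ∈ wide M, ∀ ξ ≠ 0, t x ξ ≠ 0) :
    WideHom M (m - n) (fun x ξ => s x ξ / t x ξ) := by
  simp only [div_eq_mul_inv, sub_eq_add_neg]
  exact hs.mul (ht.inv h0)

theorem sqrt (hs : WideHom M m s) (h0 : ∀ x ∈ wide M, ∀ ξ ≠ 0, 0 < s x ξ) (e : m = n + n) :
    WideHom M n (fun x ξ => √(s x ξ)) := by
  refine ⟨hs.1.sqrt fun z hz => (h0 _ hz.1 _ hz.2).ne', fun x hx ξ hξ c hc => ?_⟩
  beta_reduce
  rw [hs.2 x hx ξ hξ c hc, e, zpow_add₀ hc.ne', Real.sqrt_mul (by positivity),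
    Real.sqrt_mul_self (by positivity)]

theorem pow (hs : WideHom M m s) (k : ℕ) : WideHom M (k * m) (fun x ξ => s x ξ ^ k) :=
  ⟨hs.1.pow k, fun x hx ξ hξ c hc => by
    beta_reduce
    rw [hs.2 x hx ξ hξ c hc, mul_pow, ← zpow_natCast, ← zpow_mul, mul_comm m]⟩

theorem of_space {f : E3 → ℝ} (hf : ContDiffOn ℝ ∞ f (wide M)) :
    WideHom M 0 (fun x _ => f x) :=
  ⟨hf.comp contDiffOn_fst fun _ h => h.1, fun _ _ _ _ _ _ => by simp⟩

theorem const (a : ℝ) : WideHom M 0 (fun _ _ => a) := of_space contDiffOn_const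

/-- Composition of a degree zero symbol with a smooth function. -/
theorem comp₀ (hs : WideHom M 0 s) {g : ℝ → ℝ} {U : Set ℝ} (hg : ContDiffOn ℝ ∞ g U)
    (hU : ∀ x ∈ wide M, ∀ ξ ≠ 0, s x ξ ∈ U) : WideHom M 0 (fun x ξ => g (s x ξ)) :=
  ⟨hg.comp hs.1 fun z hz => hU _ hz.1 _ hz.2, fun x hx ξ hξ c hc => by
    simp [hs.2 x hx ξ hξ c hc]⟩

end WideHom

/-! ### Cutting off low frequencies. -/

/-- The symbols smooth up to zero frequency over the wide shell. -/
def SmoothAll (M : ℝ) (s : E3 → E3 → ℝ) : Prop :=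
  ContDiffOn ℝ ∞ (fun z : E3 × E3 => s z.1 z.2) (wide M ×ˢ Set.univ)

/-- Near `ξ = 0` the cutoff makes the product identically zero; elsewhere `|ξ|` and `s` are both
smooth. -/
theorem WideHom.smoothAll_trunc {M : ℝ} {m : ℤ} {s : E3 → E3 → ℝ} (h : WideHom M m s) {χ : ℝ → ℝ}
    (hχ : IsFreqCutoff χ) : SmoothAll M (trunc χ s) := by
  obtain ⟨h1, -, c, hc, h0⟩ := hχ
  rintro ⟨x, ξ⟩ ⟨hx, -⟩
  apply ContDiffAt.contDiffWithinAt
  by_cases hξ : ξ = 0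
  · have : (fun z : E3 × E3 => trunc χ s z.1 z.2) =ᶠ[nhds (x, ξ)] fun _ => (0 : ℝ) := by
      have ho : IsOpen {z : E3 × E3 | ‖z.2‖ < c} := isOpen_lt (by fun_prop) continuous_const
      filter_upwards [ho.mem_nhds (show ‖ξ‖ < c by simpa [hξ] using hc)] with z hz
      have hz' : ‖z.2‖ < c := hz
      simp [trunc, h0 _ hz'.le]
    exact contDiffAt_const.congr_of_eventuallyEq this
  · have hs := h.1.contDiffAt ((isOpen_wide_prod_compl M).mem_nhds
      (show (x, ξ) ∈ wide M ×ˢ ({0}ᶜ : Set E3) from ⟨hx, hξ⟩))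
    have hn : ContDiffAt ℝ ∞ (fun z : E3 × E3 => ‖z.2‖) (x, ξ) :=
      (contDiffAt_norm ℝ (n := ∞) (x := ξ) hξ).comp (x, ξ) (f := Prod.snd) contDiffAt_snd
    exact (h1.contDiffAt.comp (x, ξ) hn).mul hs

theorem WideHom.evHom_trunc {M : ℝ} {m : ℤ} {s : E3 → E3 → ℝ} (h : WideHom M m s) {χ : ℝ → ℝ}
    (hχ : IsFreqCutoff χ) : EvHom M m (trunc χ s) := by
  refine ⟨h.smoothAll_trunc hχ, fun x hx ξ hξ c hc => ?_⟩
  have h1 : 1 ≤ ‖c • ξ‖ := by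
    rw [norm_smul, Real.norm_of_nonneg (by linarith)]
    nlinarith
  have hξ0 : ξ ≠ 0 := by
    rintro rfl
    simp at hξ
    linarith
  simp only [trunc]
  rw [hχ.2.1 _ h1, hχ.2.1 _ hξ.le, one_mul, one_mul, h.2 x hx ξ hξ0 c (by linarith)]

/-- A symbol vanishing for `|ξ| > 1` is homogeneous there of every degree, so `EvHom.isSymbol`
applies for all `m`. -/
theorem SmoothAll.isSmoothing {M : ℝ} (hM : 0 < M) {s : E3 → E3 → ℝ} (h : SmoothAll M s)
    (h0 : ∀ x ∈ wide M, ∀ ξ : E3, 1 < ‖ξ‖ → s x ξ = 0) : IsSmoothing M s := fun m => by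
  refine EvHom.isSymbol hM ⟨h, fun x hx ξ hξ c hc => ?_⟩
  have h1 : 1 < ‖c • ξ‖ := by
    rw [norm_smul, Real.norm_of_nonneg (by linarith)]
    nlinarith
  rw [h0 x hx _ h1, h0 x hx ξ hξ, mul_zero]

namespace SmoothAll

variable {M : ℝ} {s t : E3 → E3 → ℝ}

theorem add (hs : SmoothAll M s) (ht : SmoothAll M t) : SmoothAll M (fun x ξ => s x ξ + t x ξ) :=
  ContDiffOn.add hs ht

theorem sub (hs : SmoothAll M s) (ht : SmoothAll M t) : SmoothAll M (fun x ξ => s x ξ - t x ξ) :=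
  ContDiffOn.sub hs ht

theorem mul (hs : SmoothAll M s) (ht : SmoothAll M t) : SmoothAll M (fun x ξ => s x ξ * t x ξ) :=
  ContDiffOn.mul hs ht

end SmoothAll

theorem IsFreqCutoff.sq {χ : ℝ → ℝ} (h : IsFreqCutoff χ) : IsFreqCutoff (fun y => χ y ^ 2) := by
  obtain ⟨h1, h2, c, hc, h0⟩ := h
  exact ⟨h1.pow 2, fun y hy => by simp [h2 y hy], c, hc, fun y hy => by simp [h0 y hy]⟩

/-! ### The trapped radius: existence, smoothness, divided differences. -/

/-- The divided difference of `R_a(r, 1, w)` in `r`. -/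
def RaSlope (M a r s w : ℝ) : ℝ :=
  (r ^ 4 + r ^ 3 * s + r ^ 2 * s ^ 2 + r * s ^ 3 + s ^ 4)
    - 3 * M * (r ^ 3 + r ^ 2 * s + r * s ^ 2 + s ^ 3) + 2 * a ^ 2 * (r ^ 2 + r * s + s ^ 2)
    - 2 * a ^ 2 * M * (r + s) + a ^ 4 - 2 * a * M * w * (r + s) - a ^ 2 * w ^ 2

/-- The divided difference of `R_a(s, 1, w)` in `w`. -/
def RaSlopeW (M a s w v : ℝ) : ℝ := -(2 * a * M * (s ^ 2 - a ^ 2)) - a ^ 2 * (s - M) * (w + v)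

theorem Ra_sub_Ra (M a r s w : ℝ) : Ra M a r 1 w - Ra M a s 1 w = (r - s) * RaSlope M a r s w := by
  simp only [Ra, RaSlope]; ring

theorem Ra_sub_Ra_right (M a s w v : ℝ) :
    Ra M a s 1 w - Ra M a s 1 v = (w - v) * RaSlopeW M a s w v := by
  simp only [Ra, RaSlopeW]; ring

/-- The size assumption on the angular momentum used throughout. -/
structure Small (M a : ℝ) : Prop where
  mass_pos : 0 < M
  pos : 0 < a
  lt : a < M / 1000

theorem mem_window {M r : ℝ} (h : |r - 3 * M| ≤ M / 2) : 5 / 2 * M ≤ r ∧ r ≤ 7 / 2 * M := by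
  have := abs_le.1 h
  constructor <;> linarith [this.1, this.2]

/-- At `a = 0` the divided difference is a polynomial bounded below on the window, and the terms
carrying `a` are small perturbations. This one bound yields uniqueness of the root, its Lipschitz
continuity and the positivity of `R̂_a`. -/
theorem le_RaSlope {M a r s w : ℝ} (h : Small M a) (hr : |r - 3 * M| ≤ M / 2)
    (hs : |s - 3 * M| ≤ M / 2) (hw : |w| < 6 * M) : M ^ 4 ≤ RaSlope M a r s w := by
  obtain ⟨hM, ha, ham⟩ := h
  obtain ⟨hr1, hr2⟩ := mem_window hr
  obtain ⟨hs1, hs2⟩ := mem_window hs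
  obtain ⟨hw1, hw2⟩ := abs_lt.1 hw
  obtain ⟨u, rfl⟩ : ∃ u, r = 5 / 2 * M + u := ⟨r - 5 / 2 * M, by ring⟩
  obtain ⟨v, rfl⟩ : ∃ v, s = 5 / 2 * M + v := ⟨s - 5 / 2 * M, by ring⟩
  have hu : 0 ≤ u := by linarith
  have hv : 0 ≤ v := by linarith
  set S := 5 / 2 * M + u + (5 / 2 * M + v) with hS
  have hS0 : 0 ≤ S := by positivity
  have hS7 : S ≤ 7 * M := by linarith
  -- In units of `M ^ 4` the `a = 0` part equals `125/16 > 7` at `u = v = 0`, and the expansion in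
  -- `u, v ≥ 0` has no negative terms. The three negative perturbations estimated below cost at most
  -- `M ^ 4` each.
  have h1 : 7 * M ^ 4 ≤ ((5 / 2 * M + u) ^ 4 + (5 / 2 * M + u) ^ 3 * (5 / 2 * M + v)
      + (5 / 2 * M + u) ^ 2 * (5 / 2 * M + v) ^ 2 + (5 / 2 * M + u) * (5 / 2 * M + v) ^ 3
      + (5 / 2 * M + v) ^ 4)
    - 3 * M * ((5 / 2 * M + u) ^ 3 + (5 / 2 * M + u) ^ 2 * (5 / 2 * M + v)
      + (5 / 2 * M + u) * (5 / 2 * M + v) ^ 2 + (5 / 2 * M + v) ^ 3) := by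
    rw [← sub_nonneg]
    ring_nf
    positivity
  have hw3 : w * S ≤ 6 * M * (7 * M) := by
    calc w * S ≤ 6 * M * S := by gcongr
      _ ≤ 6 * M * (7 * M) := by gcongr
  have h2 : 2 * a * M * w * S ≤ M ^ 4 := by
    calc 2 * a * M * w * S = 2 * a * M * (w * S) := by ring
      _ ≤ 2 * a * M * (6 * M * (7 * M)) := by gcongr
      _ ≤ 2 * (M / 1000) * M * (6 * M * (7 * M)) := by gcongr
      _ ≤ M ^ 4 := by nlinarith [pow_pos hM 4]
  have h3 : a ^ 2 * w ^ 2 ≤ M ^ 4 := by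
    have hw4 := sq_le_sq' hw1.le hw2.le
    calc a ^ 2 * w ^ 2 ≤ (M / 1000) ^ 2 * (6 * M) ^ 2 := mul_le_mul (by gcongr) hw4 (by positivity) (by positivity)
      _ ≤ M ^ 4 := by nlinarith [pow_pos hM 4]
  have h4 : 2 * a ^ 2 * M * S ≤ M ^ 4 := by
    calc 2 * a ^ 2 * M * S ≤ 2 * (M / 1000) ^ 2 * M * (7 * M) := by gcongr
      _ ≤ M ^ 4 := by nlinarith [pow_pos hM 4]
  have h5 : 0 ≤ 2 * a ^ 2 * ((5 / 2 * M + u) ^ 2 + (5 / 2 * M + u) * (5 / 2 * M + v)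
      + (5 / 2 * M + v) ^ 2) := by positivity
  have h6 : 0 ≤ a ^ 4 := by positivity
  simp only [RaSlope, ← hS]
  linarith [pow_pos hM 4]

theorem RaSlope_pos {M a r s w : ℝ} (h : Small M a) (hr : |r - 3 * M| ≤ M / 2)
    (hs : |s - 3 * M| ≤ M / 2) (hw : |w| < 6 * M) : 0 < RaSlope M a r s w :=
  (pow_pos h.mass_pos 4).trans_le (le_RaSlope h hr hs hw)

/-- Every term carries a factor `a`, so the dependence on `w` is weak. The bound matches the lower
bound in `le_RaSlope`, which makes `r_a` Lipschitz with constant one. -/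
theorem abs_RaSlopeW_le {M a s w v : ℝ} (h : Small M a) (hs : |s - 3 * M| ≤ M / 2)
    (hw : |w| < 6 * M) (hv : |v| < 6 * M) : |RaSlopeW M a s w v| ≤ M ^ 4 := by
  obtain ⟨hM, ha, ham⟩ := h
  obtain ⟨hs1, hs2⟩ := mem_window hs
  have hwv : |w + v| ≤ 12 * M := (abs_add_le _ _).trans (by linarith)
  have h1 : |2 * a * M * (s ^ 2 - a ^ 2)| ≤ 2 * (M / 1000) * M * (7 / 2 * M) ^ 2 := by
    have h2 : 0 ≤ s ^ 2 - a ^ 2 := by nlinarith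
    rw [abs_of_nonneg (by positivity)]
    have h3 : s ^ 2 ≤ (7 / 2 * M) ^ 2 := by
      have : 0 ≤ s := by linarith
      gcongr
    have h4 : s ^ 2 - a ^ 2 ≤ (7 / 2 * M) ^ 2 := by nlinarith
    gcongr
  have h2 : |a ^ 2 * (s - M) * (w + v)| ≤ (M / 1000) ^ 2 * (5 / 2 * M) * (12 * M) := by
    have h3 : 0 ≤ s - M := by linarith
    have h4 : s - M ≤ 5 / 2 * M := by linarith
    rw [abs_mul, abs_of_nonneg (by positivity)]
    gcongr
  rw [RaSlopeW]
  refine (abs_sub _ _).trans ?_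
  rw [abs_neg]
  nlinarith [pow_pos hM 4]

/-- An intermediate value argument on the window, based on the size of `R_a` at `3M` and the slope
bound. -/
theorem rTrap_spec {M a w : ℝ} (h : Small M a) (hw : |w| < 6 * M) :
    |rTrap M a w - 3 * M| ≤ M / 2 ∧ Ra M a (rTrap M a w) 1 w = 0 := by
  refine Classical.epsilon_spec (p := fun r : ℝ => |r - 3 * M| ≤ M / 2 ∧ Ra M a r 1 w = 0) ?_
  have hM := h.mass_pos
  have hmid : |3 * M - 3 * M| ≤ M / 2 := by simp; linarith
  -- For `a = 0` the root is exactly `3M`, so this value is `O(a)`. The bound `M ^ 5 / 2` is what a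
  -- slope of at least `M ^ 4` compensates over the half-width `M / 2`.
  have h0 : |Ra M a (3 * M) 1 w| ≤ M ^ 5 / 2 := by
    obtain ⟨-, ha, ham⟩ := h
    have e : Ra M a (3 * M) 1 w = a * (a * M * ((9 * M ^ 2 + a ^ 2) * 4)
        - 2 * M * (9 * M ^ 2 - a ^ 2) * w - a * (2 * M) * w ^ 2) := by
      simp only [Ra]; ring
    have haM : a ≤ M := by linarith
    obtain ⟨hw1, hw2⟩ := abs_lt.1 hw
    have hw3 : w ^ 2 ≤ (6 * M) ^ 2 := sq_le_sq' hw1.le hw2.le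
    have i1 : |a * M * ((9 * M ^ 2 + a ^ 2) * 4)| ≤ M * M * ((9 * M ^ 2 + M ^ 2) * 4) := by
      rw [abs_of_nonneg (by positivity)]; gcongr
    have i2 : |2 * M * (9 * M ^ 2 - a ^ 2) * w| ≤ 2 * M * (9 * M ^ 2) * (6 * M) := by
      have : 0 ≤ 9 * M ^ 2 - a ^ 2 := by nlinarith
      rw [abs_mul, abs_of_nonneg (by positivity)]
      gcongr
      nlinarith
    have i3 : |a * (2 * M) * w ^ 2| ≤ M * (2 * M) * (6 * M) ^ 2 := by
      rw [abs_of_nonneg (by positivity)]; gcongr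
    rw [e, abs_mul, abs_of_pos ha]
    calc a * _ ≤ (M / 1000) * (M * M * ((9 * M ^ 2 + M ^ 2) * 4)
        + 2 * M * (9 * M ^ 2) * (6 * M) + M * (2 * M) * (6 * M) ^ 2) := by
          gcongr
          exact (abs_sub _ _).trans (add_le_add ((abs_sub _ _).trans (add_le_add i1 i2)) i3)
      _ ≤ M ^ 5 / 2 := by nlinarith [pow_pos hM 5]
  obtain ⟨h01, h02⟩ := abs_le.1 h0
  have hlo : |5 / 2 * M - 3 * M| ≤ M / 2 := by rw [abs_le]; constructor <;> linarith
  have hhi : |7 / 2 * M - 3 * M| ≤ M / 2 := by rw [abs_le]; constructor <;> linarith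
  have e1 := Ra_sub_Ra M a (5 / 2 * M) (3 * M) w
  have e2 := Ra_sub_Ra M a (7 / 2 * M) (3 * M) w
  have p1 := le_RaSlope h hlo hmid hw
  have p2 := le_RaSlope h hhi hmid hw
  have n1 : Ra M a (5 / 2 * M) 1 w ≤ 0 := by nlinarith
  have n2 : 0 ≤ Ra M a (7 / 2 * M) 1 w := by nlinarith
  have hcont : ContinuousOn (fun r => Ra M a r 1 w) (Set.Icc (5 / 2 * M) (7 / 2 * M)) := by
    unfold Ra; fun_prop
  obtain ⟨r, hr, hr0⟩ := intermediate_value_Icc (by linarith) hcont ⟨n1, n2⟩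
  exact ⟨r, abs_le.2 ⟨by linarith [hr.1], by linarith [hr.2]⟩, hr0⟩

/-- The divided difference of the trapped radius. -/
noncomputable def trapSlope (M a w v : ℝ) : ℝ :=
  -RaSlopeW M a (rTrap M a v) w v / RaSlope M a (rTrap M a w) (rTrap M a v) w

theorem rTrap_sub {M a w v : ℝ} (h : Small M a) (hw : |w| < 6 * M) (hv : |v| < 6 * M) :
    rTrap M a w - rTrap M a v = (w - v) * trapSlope M a w v := by
  obtain ⟨w1, w2⟩ := rTrap_spec h hw
  obtain ⟨v1, v2⟩ := rTrap_spec h hv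
  have e1 := Ra_sub_Ra M a (rTrap M a w) (rTrap M a v) w
  have e2 := Ra_sub_Ra_right M a (rTrap M a v) w v
  have hp := (RaSlope_pos h w1 v1 hw).ne'
  rw [trapSlope]
  field_simp
  linarith

theorem abs_rTrap_sub_le {M a w v : ℝ} (h : Small M a) (hw : |w| < 6 * M) (hv : |v| < 6 * M) :
    |rTrap M a w - rTrap M a v| ≤ |w - v| := by
  obtain ⟨w1, w2⟩ := rTrap_spec h hw
  obtain ⟨v1, v2⟩ := rTrap_spec h hv
  rw [rTrap_sub h hw hv, abs_mul]
  refine mul_le_of_le_one_right (abs_nonneg _) ?_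
  rw [trapSlope, abs_div, abs_neg, abs_of_pos (RaSlope_pos h w1 v1 hw)]
  exact div_le_one_of_le₀ ((abs_RaSlopeW_le h v1 hw hv).trans (le_RaSlope h w1 v1 hw))
    (RaSlope_pos h w1 v1 hw).le

/-- The angular momenta per energy for which the trapped radius is defined. -/
def trapDom (M : ℝ) : Set ℝ := {w | |w| < 6 * M}

theorem isOpen_trapDom (M : ℝ) : IsOpen (trapDom M) := isOpen_lt continuous_abs continuous_const

theorem continuousOn_rTrap {M a : ℝ} (h : Small M a) : ContinuousOn (rTrap M a) (trapDom M) := by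
  refine LipschitzOnWith.continuousOn (K := 1) (LipschitzOnWith.of_dist_le_mul fun w hw v hv => ?_)
  simpa [Real.dist_eq] using abs_rTrap_sub_le h hw hv

theorem hasDerivAt_rTrap {M a v : ℝ} (h : Small M a) (hv : v ∈ trapDom M) :
    HasDerivAt (rTrap M a) (trapSlope M a v v) v := by
  have hnh := (isOpen_trapDom M).mem_nhds hv
  have hc : ContinuousAt (rTrap M a) v := (continuousOn_rTrap h).continuousAt hnh
  have hs : ContinuousAt (fun w => trapSlope M a w v) v := by
    refine ContinuousAt.div ?_ ?_ (RaSlope_pos h (rTrap_spec h hv).1 (rTrap_spec h hv).1 hv).ne'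
    · unfold RaSlopeW; fun_prop
    · unfold RaSlope; fun_prop
  rw [hasDerivAt_iff_tendsto_slope]
  refine (hs.tendsto.mono_left nhdsWithin_le_nhds).congr' ?_
  filter_upwards [self_mem_nhdsWithin, nhdsWithin_le_nhds hnh] with w hw hw'
  rw [slope_def_field, rTrap_sub h hw' hv]
  have : w - v ≠ 0 := sub_ne_zero.2 hw
  field_simp

/-- A bootstrap: the derivative of `r_a` is a rational function of `w` and `r_a(w)` with
nonvanishing denominator, so `C^n` implies `C^(n+1)`. -/
theorem contDiffOn_rTrap {M a : ℝ} (h : Small M a) : ContDiffOn ℝ ∞ (rTrap M a) (trapDom M) := by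
  rw [contDiffOn_infty]
  intro n
  induction n with
  | zero => exact contDiffOn_zero.2 (continuousOn_rTrap h)
  | succ n ih =>
    rw [show ((n + 1 : ℕ) : WithTop ℕ∞) = (n : WithTop ℕ∞) + 1 by push_cast; rfl,
      contDiffOn_succ_iff_deriv_of_isOpen (isOpen_trapDom M)]
    refine ⟨fun v hv => (hasDerivAt_rTrap h hv).differentiableAt.differentiableWithinAt,
      by simp, ?_⟩
    have : ContDiffOn ℝ n (fun v => trapSlope M a v v) (trapDom M) := by
      refine ContDiffOn.div ?_ ?_ fun v hv =>
        (RaSlope_pos h (rTrap_spec h hv).1 (rTrap_spec h hv).1 hv).ne'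
      · unfold RaSlopeW; fun_prop
      · unfold RaSlope; fun_prop
    exact this.congr fun v hv => (hasDerivAt_rTrap h hv).deriv

theorem contDiffOn_trapSlope {M a : ℝ} (h : Small M a) :
    ContDiffOn ℝ ∞ (fun p : ℝ × ℝ => trapSlope M a p.1 p.2) (trapDom M ×ˢ trapDom M) := by
  have h1 : ContDiffOn ℝ ∞ (fun p : ℝ × ℝ => rTrap M a p.1) (trapDom M ×ˢ trapDom M) :=
    (contDiffOn_rTrap h).comp contDiffOn_fst fun _ h => h.1
  have h2 : ContDiffOn ℝ ∞ (fun p : ℝ × ℝ => rTrap M a p.2) (trapDom M ×ˢ trapDom M) :=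
    (contDiffOn_rTrap h).comp contDiffOn_snd fun _ h => h.2
  refine ContDiffOn.div ?_ ?_ fun p hp =>
    (RaSlope_pos h (rTrap_spec h hp.1).1 (rTrap_spec h hp.2).1 hp.1).ne'
  · unfold RaSlopeW; fun_prop
  · unfold RaSlope; fun_prop

/-- Replaces the case distinction in `dslope` by a polynomial, which makes smoothness and positivity
across `r = r_a` visible. -/
theorem RHat_eq (M a r w : ℝ) : RHat M a r w = RaSlope M a r (rTrap M a w) w := by
  rcases eq_or_ne r (rTrap M a w) with hr | hr
  · rw [RHat, hr, dslope_same]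
    have : HasDerivAt (fun r' => Ra M a r' 1 w) (RaSlope M a (rTrap M a w) (rTrap M a w) w)
        (rTrap M a w) := by
      rw [hasDerivAt_iff_tendsto_slope]
      have hc : ContinuousAt (fun r => RaSlope M a r (rTrap M a w) w) (rTrap M a w) := by
        unfold RaSlope; fun_prop
      refine (hc.tendsto.mono_left nhdsWithin_le_nhds).congr' ?_
      filter_upwards [self_mem_nhdsWithin] with r hr
      have : r - rTrap M a w ≠ 0 := sub_ne_zero.2 hr
      rw [slope_def_field, Ra_sub_Ra]
      field_simp
    exact this.deriv
  · have : r - rTrap M a w ≠ 0 := sub_ne_zero.2 hr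
    rw [RHat, dslope_of_ne _ hr, slope_def_field, Ra_sub_Ra]
    field_simp

/-- `R_a(r, τ, Φ) = τ² R̂_a(r, Φ/τ) (r - r_a(Φ/τ))`. -/
theorem Ra_eq_RHat {M a r τ Φ : ℝ} (h : Small M a) (hτ : τ ≠ 0) (hw : |Φ / τ| < 6 * M) :
    Ra M a r τ Φ = τ ^ 2 * RHat M a r (Φ / τ) * (r - rTrap M a (Φ / τ)) := by
  have e := Ra_sub_Ra M a r (rTrap M a (Φ / τ)) (Φ / τ)
  rw [(rTrap_spec h hw).2, sub_zero, ← RHat_eq] at e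
  have : Ra M a r τ Φ = τ ^ 2 * Ra M a r 1 (Φ / τ) := by
    simp only [Ra]; field_simp
  rw [this, e]; ring

theorem RHat_pos {M a r w : ℝ} (h : Small M a) (hr : |r - 3 * M| ≤ M / 2) (hw : |w| < 6 * M) :
    0 < RHat M a r w := by
  rw [RHat_eq]
  exact RaSlope_pos h hr (rTrap_spec h hw).1 hw

/-! ### Signs and roots of the Kerr symbol over the wide shell. -/

section Geometry

variable {M a : ℝ} {x ξ : E3}

theorem norm_sq_coord (x : E3) : ‖x‖ ^ 2 = x 0 ^ 2 + x 1 ^ 2 + x 2 ^ 2 := by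
  rw [EuclideanSpace.norm_sq_eq, Fin.sum_univ_three]
  simp only [Real.norm_eq_abs, sq_abs]

theorem inner_coord (x ξ : E3) : inner ℝ x ξ = x 0 * ξ 0 + x 1 * ξ 1 + x 2 * ξ 2 := by
  rw [PiLp.inner_apply, Fin.sum_univ_three]
  simp only [RCLike.inner_apply, conj_trivial]
  ring

theorem lam_zero (x ξ : E3) : lam 0 x ξ = x 1 * ξ 2 - x 2 * ξ 1 := rfl
theorem lam_one (x ξ : E3) : lam 1 x ξ = x 2 * ξ 0 - x 0 * ξ 2 := rfl
theorem lam_two (x ξ : E3) : lam 2 x ξ = angPhi x ξ := rfl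

/-- Lagrange's identity. -/
theorem lamSq_eq (x ξ : E3) : lamSq x ξ = ‖x‖ ^ 2 * ‖ξ‖ ^ 2 - inner ℝ x ξ ^ 2 := by
  rw [lamSq, Fin.sum_univ_three, lam_zero, lam_one, lam_two, norm_sq_coord, norm_sq_coord,
    inner_coord, angPhi]
  ring

theorem angPhi_sq_le_lamSq (x ξ : E3) : angPhi x ξ ^ 2 ≤ lamSq x ξ := by
  rw [lamSq, Fin.sum_univ_three, lam_two]
  nlinarith [sq_nonneg (lam 0 x ξ), sq_nonneg (lam 1 x ξ)]

theorem wide_bounds (hx : x ∈ wide M) : 5 / 2 * M < ‖x‖ ∧ ‖x‖ < 7 / 2 * M := by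
  have := abs_lt.1 (show |‖x‖ - 3 * M| < M / 2 from hx)
  constructor <;> linarith [this.1, this.2]

theorem wide_window (hx : x ∈ wide M) : |‖x‖ - 3 * M| ≤ M / 2 :=
  le_of_lt (show |‖x‖ - 3 * M| < M / 2 from hx)

theorem norm_pos_of_wide (hM : 0 < M) (hx : x ∈ wide M) : 0 < ‖x‖ := by
  linarith [(wide_bounds hx).1]

theorem kDelta_ge (h : Small M a) (hx : x ∈ wide M) : 5 / 4 * M ^ 2 < kDelta M a ‖x‖ := by
  have := h.mass_pos
  have := wide_bounds hx
  rw [kDelta]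
  nlinarith [sq_nonneg a]

theorem kDelta_pos (h : Small M a) (hx : x ∈ wide M) : 0 < kDelta M a ‖x‖ :=
  lt_trans (by have := h.mass_pos; positivity) (kDelta_ge h hx)

theorem rhoSq_pos (hM : 0 < M) (hx : x ∈ wide M) : 0 < rhoSq a x := by
  have := norm_pos_of_wide hM hx
  rw [rhoSq]
  positivity

theorem sinSq_nonneg (x : E3) : 0 ≤ sinSq x := by rw [sinSq]; positivity

theorem sinSq_le_one (x : E3) : sinSq x ≤ 1 := by
  rw [sinSq, norm_sq_coord]
  exact div_le_one_of_le₀ (by nlinarith [sq_nonneg (x 2)]) (by positivity)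

/-- The radial factor `(r² + a²)² - a² Δ sin² θ` of `-g^{tt}`. -/
theorem gtt_num_pos (h : Small M a) (hx : x ∈ wide M) :
    0 < (‖x‖ ^ 2 + a ^ 2) ^ 2 - a ^ 2 * kDelta M a ‖x‖ * sinSq x := by
  have hM := h.mass_pos
  have hr := norm_pos_of_wide hM hx
  have hΔ := kDelta_pos h hx
  have h1 : a ^ 2 * kDelta M a ‖x‖ * sinSq x ≤ a ^ 2 * kDelta M a ‖x‖ :=
    mul_le_of_le_one_right (by positivity) (sinSq_le_one x)
  have h2 : kDelta M a ‖x‖ < ‖x‖ ^ 2 + a ^ 2 := by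
    rw [kDelta]; nlinarith
  have h3 : a ^ 2 * kDelta M a ‖x‖ ≤ (‖x‖ ^ 2 + a ^ 2) * kDelta M a ‖x‖ := by
    gcongr; nlinarith
  have h4 : (‖x‖ ^ 2 + a ^ 2) * kDelta M a ‖x‖ < (‖x‖ ^ 2 + a ^ 2) ^ 2 := by
    rw [sq (‖x‖ ^ 2 + a ^ 2)]
    gcongr
  linarith

theorem gtt_neg (h : Small M a) (hx : x ∈ wide M) : gtt M a x < 0 :=
  div_neg_of_neg_of_pos (neg_neg_of_pos (gtt_num_pos h hx))
    (mul_pos (rhoSq_pos h.mass_pos hx) (kDelta_pos h hx))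

/-- By Lagrange's identity `λ² = |x|² |ξ|² > 0` when `ξ_r = 0`; otherwise the radial term is
positive. -/
theorem radial_form_pos {c : ℝ} (hM : 0 < M) (hx : x ∈ wide M) (hξ : ξ ≠ 0) (hc : 0 < c) :
    0 < lamSq x ξ + c * xiR x ξ ^ 2 := by
  have hr := norm_pos_of_wide hM hx
  have hn : 0 < ‖ξ‖ := norm_pos_iff.2 hξ
  have hl : 0 ≤ lamSq x ξ := (sq_nonneg _).trans (angPhi_sq_le_lamSq x ξ)
  rcases eq_or_ne (inner ℝ x ξ) 0 with h0 | h0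
  · have : 0 < lamSq x ξ := by rw [lamSq_eq, h0]; ring_nf; positivity
    positivity
  · have : xiR x ξ ≠ 0 := div_ne_zero h0 hr.ne'
    positivity

theorem pSpace_pos (h : Small M a) (hx : x ∈ wide M) (hξ : ξ ≠ 0) : 0 < pSpace M a x ξ := by
  have hM := h.mass_pos
  have ha := h.pos
  have hΔ := kDelta_pos h hx
  refine div_pos ?_ (rhoSq_pos hM hx)
  have h1 : a ^ 2 / kDelta M a ‖x‖ < 1 / 2 := by
    rw [div_lt_iff₀ hΔ]
    have := kDelta_ge h hx
    have := h.lt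
    nlinarith
  -- Half of `λ²` absorbs the negative `Φ²` term, because `a² / Δ < 1/2`; the other half together
  -- with `Δ ξ_r²` is half of this positive form.
  have h2 := radial_form_pos (c := 2 * kDelta M a ‖x‖) hM hx hξ (by positivity)
  have h3 : a ^ 2 / kDelta M a ‖x‖ * angPhi x ξ ^ 2 ≤ 1 / 2 * lamSq x ξ :=
    mul_le_mul h1.le (angPhi_sq_le_lamSq x ξ) (by positivity) (by norm_num)
  linarith

/-- Over this shell `-g^{tt}` and the spatial part of `p_K` are both positive. Strictness is the
point: it makes `√disc` dominate the linear term, so that `τ̃₂ < 0 < τ̃₁`. -/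
theorem disc_gt (h : Small M a) (hx : x ∈ wide M) (hξ : ξ ≠ 0) :
    (gtphi M a x * angPhi x ξ) ^ 2 < disc M a x ξ := by
  have := mul_pos (neg_pos.2 (gtt_neg h hx)) (pSpace_pos h hx hξ)
  rw [disc]
  linarith

theorem disc_pos (h : Small M a) (hx : x ∈ wide M) (hξ : ξ ≠ 0) : 0 < disc M a x ξ :=
  (sq_nonneg _).trans_lt (disc_gt h hx hξ)

theorem abs_lt_sqrt_disc (h : Small M a) (hx : x ∈ wide M) (hξ : ξ ≠ 0) :
    |gtphi M a x * angPhi x ξ| < √(disc M a x ξ) := by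
  rw [← Real.sqrt_sq_eq_abs]
  exact Real.sqrt_lt_sqrt (sq_nonneg _) (disc_gt h hx hξ)

theorem tau1_pos (h : Small M a) (hx : x ∈ wide M) (hξ : ξ ≠ 0) : 0 < tau1 M a x ξ := by
  have := abs_lt.1 (abs_lt_sqrt_disc h hx hξ)
  exact div_pos_of_neg_of_neg (by linarith) (gtt_neg h hx)

theorem tau2_neg (h : Small M a) (hx : x ∈ wide M) (hξ : ξ ≠ 0) : tau2 M a x ξ < 0 := by
  have := abs_lt.1 (abs_lt_sqrt_disc h hx hξ)
  exact div_neg_of_pos_of_neg (by linarith) (gtt_neg h hx)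

theorem pK_eq_factor (h : Small M a) (hx : x ∈ wide M) (hξ : ξ ≠ 0) (τ : ℝ) :
    pK M a x τ ξ = gtt M a x * (τ - tau1 M a x ξ) * (τ - tau2 M a x ξ) :=
  pK_factor M a x τ ξ (gtt_neg h hx).ne (disc_pos h hx hξ).le

theorem pK_clear (h : Small M a) (hx : x ∈ wide M) (τ : ℝ) (ξ : E3) :
    rhoSq a x * kDelta M a ‖x‖ * pK M a x τ ξ =
      -((‖x‖ ^ 2 + a ^ 2) ^ 2 - a ^ 2 * kDelta M a ‖x‖ * sinSq x) * τ ^ 2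
      - 4 * a * M * ‖x‖ * τ * angPhi x ξ - a ^ 2 * angPhi x ξ ^ 2
      + kDelta M a ‖x‖ * (lamSq x ξ + kDelta M a ‖x‖ * xiR x ξ ^ 2) := by
  have h1 := (rhoSq_pos (a := a) h.mass_pos hx).ne'
  have h2 := (kDelta_pos h hx).ne'
  rw [pK, gtt, gtphi, pSpace]
  field_simp
  ring

/-- For `a = 0` this says `r³ / (r - 2M) < 36 M²`; on the window the left side is at most `31.25
M²`, attained at `r = 5M/2`. The margin covers the terms with `a`, which cost at most `3 M ^ 4`. -/
theorem photon_bound (h : Small M a) (hx : x ∈ wide M) :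
    (‖x‖ ^ 2 + a ^ 2) ^ 2 + 24 * a * M ^ 2 * ‖x‖ + 36 * M ^ 2 * a ^ 2
      < 36 * M ^ 2 * kDelta M a ‖x‖ := by
  obtain ⟨hM, ha, hlt⟩ := h
  obtain ⟨w1, w2⟩ := wide_bounds hx
  have hM4 := pow_pos hM 4
  rw [kDelta]
  generalize ‖x‖ = r at w1 w2 ⊢
  have hr : 0 < r := by linarith
  have c1 : (r ^ 2 + a ^ 2) ^ 2 ≤ r ^ 4 + M ^ 4 := by
    have d3 : a ^ 2 * r ^ 2 ≤ (M / 1000) ^ 2 * (7 / 2 * M) ^ 2 := by gcongr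
    have d4 : a ^ 2 * a ^ 2 ≤ (M / 1000) ^ 2 * (M / 1000) ^ 2 := by gcongr
    linarith
  have c2 : 24 * a * M ^ 2 * r ≤ M ^ 4 := by
    calc 24 * a * M ^ 2 * r ≤ 24 * (M / 1000) * M ^ 2 * (7 / 2 * M) := by gcongr
      _ ≤ M ^ 4 := by linarith
  have c3 : 36 * M ^ 2 * a ^ 2 ≤ M ^ 4 := by
    calc 36 * M ^ 2 * a ^ 2 ≤ 36 * M ^ 2 * (M / 1000) ^ 2 := by gcongr
      _ ≤ M ^ 4 := by linarith
  have c4 : r ^ 4 + 3 * M ^ 4 < 36 * M ^ 2 * (r ^ 2 - 2 * M * r) := by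
    obtain ⟨u, rfl⟩ : ∃ u, r = 5 / 2 * M + u := ⟨r - 5 / 2 * M, by ring⟩
    have hu0 : 0 < u := by linarith
    have hu1 : u ≤ M := by linarith
    have e1 : u * u * M ^ 2 ≤ u * M * M ^ 2 := by gcongr
    have e2 : u * u ^ 2 * M ≤ u * M ^ 2 * M := by gcongr
    have e3 : u * u ^ 3 ≤ u * M ^ 3 := by gcongr
    have e4 : 0 < u * M ^ 3 := by positivity
    have e5 : 0 < u * u * M ^ 2 := by positivity
    rw [← sub_pos]
    ring_nf
    ring_nf at e1 e2 e3 e4 e5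
    linarith
  have c5 : 0 ≤ M ^ 2 * a ^ 2 := by positivity
  linarith

/-- On the characteristic set `Φ² ≤ λ²` gives `Δ Φ² ≤ (r² + a²)² τ² + 4 a M r |τ Φ| + a² Φ²`.
Inserting `6M |τ| ≤ |Φ|` would contradict `photon_bound`. The case `Φ = 0` is separate: it would
force `τ = 0`, against the positivity of the spatial part. -/
theorem abs_angPhi_lt (h : Small M a) (hx : x ∈ wide M) (hξ : ξ ≠ 0) {τ : ℝ}
    (h0 : pK M a x τ ξ = 0) : |angPhi x ξ| < 6 * M * |τ| := by
  have hM := h.mass_pos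
  have ha := h.pos
  by_contra! hcon
  have e := pK_clear h hx τ ξ
  rw [h0, mul_zero] at e
  have hΔ := kDelta_pos h hx
  have hr := norm_pos_of_wide hM hx
  have hrad := mul_pos hΔ (radial_form_pos (c := kDelta M a ‖x‖) hM hx hξ hΔ)
  have hlam : kDelta M a ‖x‖ * angPhi x ξ ^ 2
      ≤ kDelta M a ‖x‖ * (lamSq x ξ + kDelta M a ‖x‖ * xiR x ξ ^ 2) := by
    gcongr
    exact (angPhi_sq_le_lamSq x ξ).trans (le_add_of_nonneg_right (by positivity))
  have hs : 0 ≤ a ^ 2 * kDelta M a ‖x‖ * sinSq x * τ ^ 2 := by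
    have := sinSq_nonneg x
    positivity
  rcases eq_or_ne (angPhi x ξ) 0 with hΦ | hΦ
  · rw [hΦ, abs_zero] at hcon
    have hτ : τ = 0 := by
      by_contra hτ
      have : 0 < 6 * M * |τ| := by positivity
      linarith
    rw [hΦ, hτ] at e
    linarith
  set A := |angPhi x ξ| with hA
  set T := |τ| with hT
  have hA0 : 0 < A := abs_pos.2 hΦ
  have hT0 : 0 ≤ T := abs_nonneg _
  have hA2 : angPhi x ξ ^ 2 = A ^ 2 := (sq_abs _).symm
  have hT2 : τ ^ 2 = T ^ 2 := (sq_abs _).symm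
  have hcross : 4 * a * M * ‖x‖ * τ * angPhi x ξ ≤ 4 * a * M * ‖x‖ * (T * A) := by
    rw [mul_assoc _ τ, hT, hA, ← abs_mul]
    gcongr
    exact le_abs_self _
  have b1 : kDelta M a ‖x‖ * A ^ 2
      ≤ (‖x‖ ^ 2 + a ^ 2) ^ 2 * T ^ 2 + 4 * a * M * ‖x‖ * (T * A) + a ^ 2 * A ^ 2 := by
    rw [hA2] at hlam e
    rw [hT2] at e hs
    linarith
  have b2 : (6 * M) ^ 2 * T ^ 2 ≤ A ^ 2 := by
    rw [← mul_pow]; gcongr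
  have b3 : 6 * M * (T * A) ≤ A ^ 2 := by nlinarith
  have key := photon_bound h hx
  have b4 : (6 * M) ^ 2 * (kDelta M a ‖x‖ * A ^ 2)
      ≤ (‖x‖ ^ 2 + a ^ 2) ^ 2 * A ^ 2 + 24 * a * M ^ 2 * ‖x‖ * A ^ 2
        + 36 * M ^ 2 * a ^ 2 * A ^ 2 := by
    have f1 : (‖x‖ ^ 2 + a ^ 2) ^ 2 * ((6 * M) ^ 2 * T ^ 2) ≤ (‖x‖ ^ 2 + a ^ 2) ^ 2 * A ^ 2 := by
      gcongr
    have f2 : 24 * a * M ^ 2 * ‖x‖ * (6 * M * (T * A)) ≤ 24 * a * M ^ 2 * ‖x‖ * A ^ 2 := by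
      gcongr
    have f3 := mul_le_mul_of_nonneg_left b1 (sq_nonneg (6 * M))
    linarith
  have := mul_lt_mul_of_pos_right key (pow_pos hA0 2)
  linarith

theorem pK_tau1 (h : Small M a) (hx : x ∈ wide M) (hξ : ξ ≠ 0) :
    pK M a x (tau1 M a x ξ) ξ = 0 := by rw [pK_eq_factor h hx hξ]; ring

theorem pK_tau2 (h : Small M a) (hx : x ∈ wide M) (hξ : ξ ≠ 0) :
    pK M a x (tau2 M a x ξ) ξ = 0 := by rw [pK_eq_factor h hx hξ]; ring

theorem div_mem_trapDom {Φ τ : ℝ} (h : |Φ| < 6 * M * |τ|) (hτ : τ ≠ 0) :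
    Φ / τ ∈ trapDom M := by
  have : |Φ / τ| < 6 * M := by
    rw [abs_div, div_lt_iff₀ (abs_pos.2 hτ)]
    exact h
  exact this

theorem div_tau1_mem (h : Small M a) (hx : x ∈ wide M) (hξ : ξ ≠ 0) :
    angPhi x ξ / tau1 M a x ξ ∈ trapDom M :=
  div_mem_trapDom (abs_angPhi_lt h hx hξ (pK_tau1 h hx hξ)) (tau1_pos h hx hξ).ne'

theorem div_tau2_mem (h : Small M a) (hx : x ∈ wide M) (hξ : ξ ≠ 0) :
    angPhi x ξ / tau2 M a x ξ ∈ trapDom M :=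
  div_mem_trapDom (abs_angPhi_lt h hx hξ (pK_tau2 h hx hξ)) (tau2_neg h hx hξ).ne

theorem tau_sub_pos (h : Small M a) (hx : x ∈ wide M) (hξ : ξ ≠ 0) :
    0 < tau1 M a x ξ - tau2 M a x ξ := by
  linarith [tau1_pos h hx hξ, tau2_neg h hx hξ]

end Geometry

/-! ### Homogeneity and smoothness of the roots and of `ϱ̃₁`, `ϱ̃₂`. -/

section Smoothness

variable {M a : ℝ}

theorem contDiffOn_norm_wide (hM : 0 < M) : ContDiffOn ℝ ∞ (fun x : E3 => ‖x‖) (wide M) :=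
  fun _ hx => (contDiffAt_norm ℝ (norm_pos_iff.1 (norm_pos_of_wide hM hx))).contDiffWithinAt

theorem contDiffOn_radial (hM : 0 < M) {f : ℝ → ℝ} (hf : ContDiffOn ℝ ∞ f (Set.Ioi (2 * M))) :
    ContDiffOn ℝ ∞ (fun x : E3 => f ‖x‖) (wide M) :=
  hf.comp (contDiffOn_norm_wide hM) fun _ hx => by
    have := (wide_bounds hx).1
    simp only [Set.mem_Ioi]
    linarith

theorem contDiff_coord (j : Fin 3) : ContDiff ℝ ∞ (fun x : E3 => x j) := by fun_prop

theorem contDiffOn_kDelta (hM : 0 < M) : ContDiffOn ℝ ∞ (fun x : E3 => kDelta M a ‖x‖) (wide M) := by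
  have := contDiffOn_norm_wide hM
  unfold kDelta
  fun_prop

theorem contDiffOn_rhoSq (hM : 0 < M) : ContDiffOn ℝ ∞ (rhoSq a) (wide M) := by
  have h1 := contDiffOn_norm_wide hM
  have h2 : ContDiffOn ℝ ∞ (fun x : E3 => x 2 ^ 2) (wide M) :=
    ((contDiff_coord 2).pow 2).contDiffOn
  have h3 : ContDiffOn ℝ ∞ (fun x : E3 => x 2 ^ 2 / ‖x‖ ^ 2) (wide M) :=
    h2.div (h1.pow 2) fun x hx => (pow_pos (norm_pos_of_wide hM hx) 2).ne'
  exact (h1.pow 2).add (contDiffOn_const.mul h3)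

theorem contDiffOn_sinSq (hM : 0 < M) : ContDiffOn ℝ ∞ sinSq (wide M) := by
  have h2 : ContDiffOn ℝ ∞ (fun x : E3 => x 0 ^ 2 + x 1 ^ 2) (wide M) :=
    (((contDiff_coord 0).pow 2).add ((contDiff_coord 1).pow 2)).contDiffOn
  exact h2.div ((contDiffOn_norm_wide hM).pow 2) fun x hx =>
    (pow_pos (norm_pos_of_wide hM hx) 2).ne'

theorem contDiffOn_gtt (h : Small M a) : ContDiffOn ℝ ∞ (gtt M a) (wide M) := by
  have h0 := contDiffOn_norm_wide h.mass_pos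
  have h1 := contDiffOn_rhoSq (a := a) h.mass_pos
  have h2 := contDiffOn_sinSq h.mass_pos
  have h3 := contDiffOn_kDelta (a := a) h.mass_pos
  refine ContDiffOn.div ?_ (h1.mul h3) fun x hx =>
    (mul_pos (rhoSq_pos h.mass_pos hx) (kDelta_pos h hx)).ne'
  fun_prop

theorem contDiffOn_gtphi (h : Small M a) : ContDiffOn ℝ ∞ (gtphi M a) (wide M) := by
  have h0 := contDiffOn_norm_wide h.mass_pos
  have h1 := contDiffOn_rhoSq (a := a) h.mass_pos
  have h3 := contDiffOn_kDelta (a := a) h.mass_pos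
  refine ContDiffOn.div ?_ (h1.mul h3) fun x hx =>
    (mul_pos (rhoSq_pos h.mass_pos hx) (kDelta_pos h hx)).ne'
  fun_prop

theorem SmoothAll.of_space {f : E3 → ℝ} (hf : ContDiffOn ℝ ∞ f (wide M)) :
    SmoothAll M (fun x _ => f x) :=
  hf.comp contDiffOn_fst fun _ h => h.1

theorem SmoothAll.wideHom {m : ℤ} {s : E3 → E3 → ℝ} (hs : SmoothAll M s)
    (h : ∀ x ξ, ∀ c : ℝ, 0 < c → s x (c • ξ) = c ^ m * s x ξ) :
    WideHom M m s :=
  ⟨hs.mono (Set.prod_mono le_rfl (Set.subset_univ _)), fun x _ ξ _ c hc => h x ξ c hc⟩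

theorem smoothAll_xiR (hM : 0 < M) : SmoothAll M xiR := by
  refine ContDiffOn.div (contDiff_fst.inner ℝ contDiff_snd).contDiffOn
    ((contDiffOn_norm_wide hM).comp contDiffOn_fst fun _ h => h.1) fun z hz =>
      (norm_pos_of_wide hM hz.1).ne'

theorem wideHom_xiR (hM : 0 < M) : WideHom M 1 xiR :=
  (smoothAll_xiR hM).wideHom fun x ξ c _ => by
    rw [xiR, xiR, inner_smul_right, zpow_one, mul_div_assoc]

theorem wideHom_lam (j : Fin 3) : WideHom M 1 (lam j) := by
  refine SmoothAll.wideHom ?_ fun x ξ c _ => ?_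
  · have h1 (k : Fin 3) : ContDiff ℝ ∞ (fun z : E3 × E3 => z.1 k) := by fun_prop
    have h2 (k : Fin 3) : ContDiff ℝ ∞ (fun z : E3 × E3 => z.2 k) := by fun_prop
    exact (((h1 _).mul (h2 _)).sub ((h1 _).mul (h2 _))).contDiffOn
  · simp only [lam, PiLp.smul_apply, smul_eq_mul, zpow_one]
    ring

theorem wideHom_angPhi : WideHom M 1 angPhi := wideHom_lam 2

theorem wideHom_lamSq : WideHom M 2 lamSq := by
  have h := ((((wideHom_lam (M := M) 0).pow 2).add ((wideHom_lam 1).pow 2)).add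
    ((wideHom_lam 2).pow 2)).cast (n := 2) (by norm_num)
  exact h.congr fun x _ ξ _ => by rw [lamSq, Fin.sum_univ_three]

theorem wideHom_pSpace (h : Small M a) : WideHom M 2 (pSpace M a) := by
  have hM := h.mass_pos
  have hΔ := WideHom.of_space (contDiffOn_kDelta (a := a) hM)
  have h1 := (((hΔ.mul ((wideHom_xiR hM).pow 2)).cast (n := 2) (by norm_num)).add wideHom_lamSq).sub
    ((((WideHom.const (a ^ 2)).div hΔ fun _ hx _ _ => (kDelta_pos h hx).ne').mul
      (wideHom_angPhi.pow 2)).cast (n := 2) (by norm_num))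
  exact (h1.div (WideHom.of_space (contDiffOn_rhoSq (a := a) hM)) fun _ hx _ _ =>
    (rhoSq_pos hM hx).ne').cast (by norm_num)

theorem wideHom_gtt (h : Small M a) : WideHom M 0 (fun x _ => gtt M a x) :=
  WideHom.of_space (contDiffOn_gtt h)

theorem wideHom_pLin (h : Small M a) :
    WideHom M 1 (fun x ξ => gtphi M a x * angPhi x ξ) :=
  ((WideHom.of_space (contDiffOn_gtphi h)).mul wideHom_angPhi).cast (by norm_num)

theorem wideHom_disc (h : Small M a) : WideHom M 2 (disc M a) :=
  (((wideHom_pLin h).pow 2).cast (n := 2) (by norm_num)).sub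
    (((wideHom_gtt h).mul (wideHom_pSpace h)).cast (by norm_num))

theorem wideHom_sqrt_disc (h : Small M a) : WideHom M 1 (fun x ξ => √(disc M a x ξ)) :=
  (wideHom_disc h).sqrt (fun _ hx _ hξ => disc_pos h hx hξ) (by norm_num)

theorem wideHom_tau1 (h : Small M a) : WideHom M 1 (tau1 M a) :=
  (((wideHom_pLin h).neg.sub (wideHom_sqrt_disc h)).div (wideHom_gtt h) fun _ hx _ _ =>
    (gtt_neg h hx).ne).cast (by norm_num)

theorem wideHom_tau2 (h : Small M a) : WideHom M 1 (tau2 M a) :=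
  (((wideHom_pLin h).neg.add (wideHom_sqrt_disc h)).div (wideHom_gtt h) fun _ hx _ _ =>
    (gtt_neg h hx).ne).cast (by norm_num)

theorem wideHom_div_tau1 (h : Small M a) :
    WideHom M 0 (fun x ξ => angPhi x ξ / tau1 M a x ξ) :=
  (wideHom_angPhi.div (wideHom_tau1 h) fun _ hx _ hξ => (tau1_pos h hx hξ).ne').cast (by norm_num)

theorem wideHom_div_tau2 (h : Small M a) :
    WideHom M 0 (fun x ξ => angPhi x ξ / tau2 M a x ξ) :=
  (wideHom_angPhi.div (wideHom_tau2 h) fun _ hx _ hξ => (tau2_neg h hx hξ).ne).cast (by norm_num)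

theorem wideHom_norm (hM : 0 < M) : WideHom M 0 (fun x _ => ‖x‖) :=
  WideHom.of_space (contDiffOn_norm_wide hM)

theorem wideHom_rho1 (h : Small M a) : WideHom M 0 (rho1 M a) :=
  (wideHom_norm h.mass_pos).sub ((wideHom_div_tau1 h).comp₀ (contDiffOn_rTrap h)
    fun _ hx _ hξ => div_tau1_mem h hx hξ)

theorem wideHom_rho2 (h : Small M a) : WideHom M 0 (rho2 M a) :=
  (wideHom_norm h.mass_pos).sub ((wideHom_div_tau2 h).comp₀ (contDiffOn_rTrap h)
    fun _ hx _ hξ => div_tau2_mem h hx hξ)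

theorem wideHom_tau_sub (h : Small M a) :
    WideHom M 1 (fun x ξ => tau1 M a x ξ - tau2 M a x ξ) :=
  (wideHom_tau1 h).sub (wideHom_tau2 h)

theorem wideHom_inv_tau_sub (h : Small M a) :
    WideHom M (-1) (fun x ξ => (tau1 M a x ξ - tau2 M a x ξ)⁻¹) :=
  (wideHom_tau_sub h).inv fun _ hx _ hξ => (tau_sub_pos h hx hξ).ne'

end Smoothness

/-! ### The multiplier symbol as an interpolant in `τ`. -/

section Multiplier

variable {M a : ℝ} {b : ℝ → ℝ} {x ξ : E3}

/-- The part without `τ` of `σ̃_K / ξ_r`. -/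
noncomputable def quot0 (M a : ℝ) (b : ℝ → ℝ) (x ξ : E3) : ℝ :=
  b ‖x‖ / ‖x‖ * (rho2 M a x ξ * tau1 M a x ξ - rho1 M a x ξ * tau2 M a x ξ)
    * (tau1 M a x ξ - tau2 M a x ξ)⁻¹

/-- The coefficient of `τ` in `σ̃_K / ξ_r`. -/
noncomputable def quot1 (M a : ℝ) (b : ℝ → ℝ) (x ξ : E3) : ℝ :=
  b ‖x‖ / ‖x‖ * (rho1 M a x ξ - rho2 M a x ξ) * (tau1 M a x ξ - tau2 M a x ξ)⁻¹

/-- The symbol `s̃₁`. -/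
noncomputable def mult1 (M a : ℝ) (b : ℝ → ℝ) (x ξ : E3) : ℝ :=
  xiR x ξ * quot0 M a b x ξ - b ‖x‖ * (1 - 3 * M / ‖x‖) * xiR x ξ

/-- The symbol `s̃₀`. -/
noncomputable def mult0 (M a : ℝ) (b : ℝ → ℝ) (x ξ : E3) : ℝ := xiR x ξ * quot1 M a b x ξ

theorem multSymbol_mult (M a : ℝ) (b : ℝ → ℝ) (x : E3) (τ : ℝ) (ξ : E3) :
    multSymbol M b (mult1 M a b) (mult0 M a b) x τ ξ
      = xiR x ξ * (quot0 M a b x ξ + quot1 M a b x ξ * τ) := by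
  simp only [multSymbol, mult1, mult0]; ring

theorem quot_eq (M a : ℝ) (b : ℝ → ℝ) (x ξ : E3) (τ : ℝ) :
    quot0 M a b x ξ + quot1 M a b x ξ * τ = b ‖x‖ / ‖x‖ * (rho1 M a x ξ * (τ - tau2 M a x ξ)
      - rho2 M a x ξ * (τ - tau1 M a x ξ)) * (tau1 M a x ξ - tau2 M a x ξ)⁻¹ := by
  simp only [quot0, quot1]; ring

theorem quot_tau1 (h : Small M a) (hx : x ∈ wide M) (hξ : ξ ≠ 0) :
    quot0 M a b x ξ + quot1 M a b x ξ * tau1 M a x ξ = b ‖x‖ / ‖x‖ * rho1 M a x ξ := by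
  have := (tau_sub_pos h hx hξ).ne'
  rw [quot_eq]
  field_simp
  ring

theorem quot_tau2 (h : Small M a) (hx : x ∈ wide M) (hξ : ξ ≠ 0) :
    quot0 M a b x ξ + quot1 M a b x ξ * tau2 M a x ξ = b ‖x‖ / ‖x‖ * rho2 M a x ξ := by
  have := (tau_sub_pos h hx hξ).ne'
  rw [quot_eq]
  field_simp
  ring

theorem contDiffOn_div_norm (hM : 0 < M) (hb : ContDiffOn ℝ ∞ b (Set.Ioi (2 * M))) :
    ContDiffOn ℝ ∞ (fun x : E3 => b ‖x‖ / ‖x‖) (wide M) :=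
  (contDiffOn_radial hM hb).div (contDiffOn_norm_wide hM) fun _ hx => (norm_pos_of_wide hM hx).ne'

theorem contDiffOn_radialPart (hM : 0 < M) (hb : ContDiffOn ℝ ∞ b (Set.Ioi (2 * M))) :
    ContDiffOn ℝ ∞ (fun x : E3 => b ‖x‖ * (1 - 3 * M / ‖x‖)) (wide M) :=
  (contDiffOn_radial hM hb).mul (contDiffOn_const.sub (contDiffOn_const.div
    (contDiffOn_norm_wide hM) fun _ hx => (norm_pos_of_wide hM hx).ne'))

theorem wideHom_div_norm (hM : 0 < M) (hb : ContDiffOn ℝ ∞ b (Set.Ioi (2 * M))) :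
    WideHom M 0 (fun x _ => b ‖x‖ / ‖x‖) := WideHom.of_space (contDiffOn_div_norm hM hb)

theorem wideHom_quot0 (h : Small M a) (hb : ContDiffOn ℝ ∞ b (Set.Ioi (2 * M))) :
    WideHom M 0 (quot0 M a b) :=
  (((wideHom_div_norm h.mass_pos hb).mul (((wideHom_rho2 h).mul (wideHom_tau1 h)).sub
    ((wideHom_rho1 h).mul (wideHom_tau2 h)))).mul (wideHom_inv_tau_sub h)).cast (by norm_num)

theorem wideHom_quot1 (h : Small M a) (hb : ContDiffOn ℝ ∞ b (Set.Ioi (2 * M))) :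
    WideHom M (-1) (quot1 M a b) :=
  (((wideHom_div_norm h.mass_pos hb).mul ((wideHom_rho1 h).sub (wideHom_rho2 h))).mul
    (wideHom_inv_tau_sub h)).cast (by norm_num)

theorem wideHom_mult1 (h : Small M a) (hb : ContDiffOn ℝ ∞ b (Set.Ioi (2 * M))) :
    WideHom M 1 (mult1 M a b) :=
  (((wideHom_xiR h.mass_pos).mul (wideHom_quot0 h hb)).cast (by norm_num)).sub
    (((WideHom.of_space (contDiffOn_radialPart h.mass_pos hb)).mul
      (wideHom_xiR h.mass_pos)).cast (by norm_num))

theorem wideHom_mult0 (h : Small M a) (hb : ContDiffOn ℝ ∞ b (Set.Ioi (2 * M))) :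
    WideHom M 0 (mult0 M a b) :=
  ((wideHom_xiR h.mass_pos).mul (wideHom_quot1 h hb)).cast (by norm_num)

/-- The quotient by `p_K` in the definition of the multiplier. -/
noncomputable def multQuot (M a : ℝ) (b : ℝ → ℝ) (x : E3) (τ : ℝ) (ξ : E3) : ℝ :=
  b ‖x‖ / ‖x‖ * xiR x ξ * angPhi x ξ * (tau1 M a x ξ - tau2 M a x ξ)⁻¹ / gtt M a x / τ
    * (trapSlope M a (angPhi x ξ / tau1 M a x ξ) (angPhi x ξ / τ) / tau1 M a x ξ
      - trapSlope M a (angPhi x ξ / tau2 M a x ξ) (angPhi x ξ / τ) / tau2 M a x ξ)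

theorem cone_wide (hM : 0 < M) {z : E3 × ℝ × E3} (hz : z ∈ cone M) :
    z.1 ∈ wide M ∧ z.2.2 ≠ 0 ∧ z.2.1 ≠ 0 ∧ angPhi z.1 z.2.2 / z.2.1 ∈ trapDom M := by
  obtain ⟨h1, h2, h3⟩ := hz
  have h4 : z.2.1 ≠ 0 := by
    intro h0
    rw [h0, abs_zero, mul_zero] at h3
    linarith [abs_nonneg (angPhi z.1 z.2.2)]
  exact ⟨shell_subset_wide hM h1, h2, h4, div_mem_trapDom h3 h4⟩

theorem WideHom.contDiffOn_cone (hM : 0 < M) {m : ℤ} {s : E3 → E3 → ℝ} (hs : WideHom M m s) :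
    ContDiffOn ℝ ∞ (fun z : E3 × ℝ × E3 => s z.1 z.2.2) (cone M) :=
  hs.1.comp (f := fun z : E3 × ℝ × E3 => (z.1, z.2.2)) (by fun_prop)
    fun z hz => ⟨(cone_wide hM hz).1, (cone_wide hM hz).2.1⟩

theorem contDiffOn_cone_div (hM : 0 < M) :
    ContDiffOn ℝ ∞ (fun z : E3 × ℝ × E3 => angPhi z.1 z.2.2 / z.2.1) (cone M) :=
  (wideHom_angPhi.contDiffOn_cone hM).div (by fun_prop) fun _ hz => (cone_wide hM hz).2.2.1

theorem contDiffOn_cone_trapSlope (h : Small M a) {s : E3 → E3 → ℝ} (hs : WideHom M 0 s)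
    (hd : ∀ x ∈ wide M, ∀ ξ ≠ 0, s x ξ ∈ trapDom M) :
    ContDiffOn ℝ ∞ (fun z : E3 × ℝ × E3 => trapSlope M a (s z.1 z.2.2)
      (angPhi z.1 z.2.2 / z.2.1)) (cone M) := by
  have hf : ContDiffOn ℝ ∞ (fun z : E3 × ℝ × E3 => (s z.1 z.2.2, angPhi z.1 z.2.2 / z.2.1))
      (cone M) := (hs.contDiffOn_cone h.mass_pos).prodMk (contDiffOn_cone_div h.mass_pos)
  have hm : Set.MapsTo (fun z : E3 × ℝ × E3 => (s z.1 z.2.2, angPhi z.1 z.2.2 / z.2.1)) (cone M)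
      (trapDom M ×ˢ trapDom M) := fun z hz =>
    ⟨hd _ (cone_wide h.mass_pos hz).1 _ (cone_wide h.mass_pos hz).2.1,
      (cone_wide h.mass_pos hz).2.2.2⟩
  have := (contDiffOn_trapSlope h).comp hf hm
  exact this

theorem contDiffOn_multQuot (h : Small M a) (hb : ContDiffOn ℝ ∞ b (Set.Ioi (2 * M))) :
    ContDiffOn ℝ ∞ (fun z : E3 × ℝ × E3 => multQuot M a b z.1 z.2.1 z.2.2) (cone M) := by
  have hM := h.mass_pos
  have g1 := (((((wideHom_div_norm hM hb).mul (wideHom_xiR hM)).mul wideHom_angPhi).mul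
    (wideHom_inv_tau_sub h)).div (wideHom_gtt h)
      fun _ hx _ _ => (gtt_neg h hx).ne).contDiffOn_cone hM
  have s1 := contDiffOn_cone_trapSlope h (wideHom_div_tau1 h) fun _ hx _ hξ => div_tau1_mem h hx hξ
  have s2 := contDiffOn_cone_trapSlope h (wideHom_div_tau2 h) fun _ hx _ hξ => div_tau2_mem h hx hξ
  have t1 := (wideHom_tau1 h).contDiffOn_cone hM
  have t2 := (wideHom_tau2 h).contDiffOn_cone hM
  have hτ : ContDiffOn ℝ ∞ (fun z : E3 × ℝ × E3 => z.2.1) (cone M) := by fun_prop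
  exact (g1.div hτ fun _ hz => (cone_wide hM hz).2.2.1).mul
    ((s1.div t1 fun _ hz => (tau1_pos h (cone_wide hM hz).1 (cone_wide hM hz).2.1).ne').sub
      (s2.div t2 fun _ hz => (tau2_neg h (cone_wide hM hz).1 (cone_wide hM hz).2.1).ne))

theorem multQuot_smul (h : Small M a) (x : E3) (τ : ℝ) (ξ : E3) (hz : (x, τ, ξ) ∈ cone M)
    (c : ℝ) (hc : 0 < c) :
    multQuot M a b x (c * τ) (c • ξ) = c ^ (-1 : ℤ) * multQuot M a b x τ ξ := by
  have hM := h.mass_pos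
  obtain ⟨hx, hξ, hτ0, -⟩ := cone_wide hM hz
  simp only at hx hξ hτ0
  have e1 := (wideHom_tau1 h).2 x hx ξ hξ c hc
  have e2 := (wideHom_tau2 h).2 x hx ξ hξ c hc
  have e3 := (wideHom_xiR hM).2 x hx ξ hξ c hc
  have e4 := (wideHom_angPhi (M := M)).2 x hx ξ hξ c hc
  rw [zpow_one] at e1 e2 e3 e4
  simp only [multQuot, e1, e2, e3, e4, mul_div_mul_left _ _ hc.ne', ← mul_sub, mul_inv,
    zpow_neg_one]
  have d1 := (tau1_pos h hx hξ).ne'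
  have d2 := (tau2_neg h hx hξ).ne
  have d3 := (tau_sub_pos h hx hξ).ne'
  have d4 := (gtt_neg h hx).ne
  have d5 := hc.ne'
  generalize trapSlope M a (angPhi x ξ / tau1 M a x ξ) (angPhi x ξ / τ) = S1
  generalize trapSlope M a (angPhi x ξ / tau2 M a x ξ) (angPhi x ξ / τ) = S2
  generalize b ‖x‖ / ‖x‖ = B
  generalize tau1 M a x ξ - tau2 M a x ξ = D at d3 ⊢
  generalize tau1 M a x ξ = t1 at d1 ⊢
  generalize tau2 M a x ξ = t2 at d2 ⊢
  generalize gtt M a x = g at d4 ⊢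
  generalize xiR x ξ = X
  generalize angPhi x ξ = Y
  field_simp

theorem isHomSpacetime_multQuot (h : Small M a) (hb : ContDiffOn ℝ ∞ b (Set.Ioi (2 * M))) :
    IsHomSpacetime M (-1) (multQuot M a b) :=
  ⟨contDiffOn_multQuot h hb, multQuot_smul h⟩

/-- Since `Φ/τ̃ᵢ - Φ/τ = Φ (τ - τ̃ᵢ) / (τ τ̃ᵢ)`, writing `r_a(Φ/τ̃ᵢ)` as `r_a(Φ/τ)` plus a divided
difference exposes the factor `(τ - τ̃₁)(τ - τ̃₂)` in the interpolation error. What remains after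
dividing by `p_K` is `multQuot`, smooth on the cone also at the roots. -/
theorem isKerrMultiplier_mult (h : Small M a) (hb : ContDiffOn ℝ ∞ b (Set.Ioi (2 * M))) :
    IsKerrMultiplier M a b (mult1 M a b) (mult0 M a b) := by
  have hM := h.mass_pos
  refine ⟨(wideHom_mult1 h hb).isHomSymbol hM, (wideHom_mult0 h hb).isHomSymbol hM,
    multQuot M a b, isHomSpacetime_multQuot h hb, fun x τ ξ hz => ?_⟩
  obtain ⟨hx, hξ, hτ0, hw⟩ := cone_wide hM hz
  simp only at hx hξ hτ0 hw
  have e1 := rTrap_sub h (div_tau1_mem h hx hξ) hw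
  have e2 := rTrap_sub h (div_tau2_mem h hx hξ) hw
  have hD := (tau_sub_pos h hx hξ).ne'
  have h1 := (tau1_pos h hx hξ).ne'
  have h2 := (tau2_neg h hx hξ).ne
  have hg := (gtt_neg h hx).ne
  rw [multSymbol_mult, quot_eq, pK_eq_factor h hx hξ, multQuot, rho1, rho2,
    show rTrap M a (angPhi x ξ / tau1 M a x ξ) = rTrap M a (angPhi x ξ / τ) +
      (angPhi x ξ / tau1 M a x ξ - angPhi x ξ / τ)
        * trapSlope M a (angPhi x ξ / tau1 M a x ξ) (angPhi x ξ / τ) by rw [← e1]; ring,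
    show rTrap M a (angPhi x ξ / tau2 M a x ξ) = rTrap M a (angPhi x ξ / τ) +
      (angPhi x ξ / tau2 M a x ξ - angPhi x ξ / τ)
        * trapSlope M a (angPhi x ξ / tau2 M a x ξ) (angPhi x ξ / τ) by rw [← e2]; ring]
  generalize trapSlope M a (angPhi x ξ / tau1 M a x ξ) (angPhi x ξ / τ) = S1
  generalize trapSlope M a (angPhi x ξ / tau2 M a x ξ) (angPhi x ξ / τ) = S2
  generalize rTrap M a (angPhi x ξ / τ) = R0
  generalize b ‖x‖ / ‖x‖ = B
  field_simp
  ring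

/-- The multiplier symbols are determined by their implicit definition. -/
theorem IsKerrMultiplier.eq (h : Small M a) {s₁ s₀ : E3 → E3 → ℝ}
    (hs : IsKerrMultiplier M a b s₁ s₀) (hx : x ∈ shell M) (hξ : ξ ≠ 0) :
    s₁ x ξ = mult1 M a b x ξ ∧ s₀ x ξ = mult0 M a b x ξ := by
  obtain ⟨-, -, q, -, hq⟩ := hs
  have hxw := shell_subset_wide h.mass_pos hx
  -- At a root, which lies in the cone by `abs_angPhi_lt`, the term `h p_K` drops out. The two
  -- distinct roots then give two linear equations that determine the pair.
  have key : ∀ τ, pK M a x τ ξ = 0 → quot0 M a b x ξ + quot1 M a b x ξ * τ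
      = b ‖x‖ / ‖x‖ * (‖x‖ - rTrap M a (angPhi x ξ / τ)) →
      s₁ x ξ + s₀ x ξ * τ = mult1 M a b x ξ + mult0 M a b x ξ * τ := by
    intro τ h0 h1
    have e := hq x τ ξ ⟨hx, hξ, abs_angPhi_lt h hxw hξ h0⟩
    rw [← h1, h0, mul_zero, add_zero, mul_comm, ← multSymbol_mult] at e
    simp only [multSymbol] at e
    linarith
  have k1 := key _ (pK_tau1 h hxw hξ) (quot_tau1 h hxw hξ)
  have k2 := key _ (pK_tau2 h hxw hξ) (quot_tau2 h hxw hξ)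
  have hD := (tau_sub_pos h hxw hξ).ne'
  have e0 : s₀ x ξ = mult0 M a b x ξ := by
    have : (s₀ x ξ - mult0 M a b x ξ) * (tau1 M a x ξ - tau2 M a x ξ) = 0 := by linarith
    rcases mul_eq_zero.1 this with h0 | h0
    · linarith
    · exact absurd h0 hD
  rw [e0] at k1
  exact ⟨by linarith, e0⟩

end Multiplier

/-! ### The Poisson bracket as a bilinear form on covectors. -/

section Bracket

/-- The differential of a phase space function. -/
noncomputable def pd (f : E3 → E3 → ℝ) (x ξ : E3) : E3 × E3 →L[ℝ] ℝ :=
  fderiv ℝ (fun z : E3 × E3 => f z.1 z.2) (x, ξ)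

/-- The `k`-th coordinate vector. -/
noncomputable abbrev ev (k : Fin 3) : E3 := EuclideanSpace.single k 1

/-- The Poisson structure on covectors of phase space. -/
noncomputable def poissonForm (u v : E3 × E3 →L[ℝ] ℝ) : ℝ :=
  ∑ k : Fin 3, (u (0, ev k) * v (ev k, 0) - u (ev k, 0) * v (0, ev k))

variable {u v w : E3 × E3 →L[ℝ] ℝ}

theorem poissonForm_self (u : E3 × E3 →L[ℝ] ℝ) : poissonForm u u = 0 := by
  simp only [poissonForm, Fin.sum_univ_three]; ring

theorem poissonForm_add_left : poissonForm (u + v) w = poissonForm u w + poissonForm v w := by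
  simp only [poissonForm, Fin.sum_univ_three, add_apply]; ring

theorem poissonForm_add_right : poissonForm w (u + v) = poissonForm w u + poissonForm w v := by
  simp only [poissonForm, Fin.sum_univ_three, add_apply]; ring

theorem poissonForm_sub_right : poissonForm w (u - v) = poissonForm w u - poissonForm w v := by
  simp only [poissonForm, Fin.sum_univ_three, sub_apply]; ring

theorem poissonForm_smul_left (c : ℝ) : poissonForm (c • u) w = c * poissonForm u w := by
  simp only [poissonForm, Fin.sum_univ_three, smul_apply, smul_eq_mul]; ring

theorem poissonForm_smul_right (c : ℝ) : poissonForm w (c • u) = c * poissonForm w u := by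
  simp only [poissonForm, Fin.sum_univ_three, smul_apply, smul_eq_mul]; ring

theorem dX_eq {f : E3 → ℝ → E3 → ℝ} {x ξ : E3} {τ : ℝ} {L : E3 × E3 →L[ℝ] ℝ}
    (h : HasFDerivAt (fun z : E3 × E3 => f z.1 τ z.2) L (x, ξ)) (k : Fin 3) :
    dX k f x τ ξ = L (ev k, 0) := by
  have h2 : HasFDerivAt (fun y => (y, ξ)) (ContinuousLinearMap.inl ℝ E3 E3) x :=
    hasFDerivAt_prodMk_left x ξ
  have h3 : HasFDerivAt (fun y => f y τ ξ) (L.comp (ContinuousLinearMap.inl ℝ E3 E3)) x :=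
    HasFDerivAt.comp (g := fun z : E3 × E3 => f z.1 τ z.2) x h h2
  rw [dX, h3.fderiv]
  simp

theorem dXi_eq {f : E3 → ℝ → E3 → ℝ} {x ξ : E3} {τ : ℝ} {L : E3 × E3 →L[ℝ] ℝ}
    (h : HasFDerivAt (fun z : E3 × E3 => f z.1 τ z.2) L (x, ξ)) (k : Fin 3) :
    dXi k f x τ ξ = L (0, ev k) := by
  have h2 : HasFDerivAt (fun η => (x, η)) (ContinuousLinearMap.inr ℝ E3 E3) ξ :=
    hasFDerivAt_prodMk_right x ξ
  have h3 : HasFDerivAt (fun η => f x τ η) (L.comp (ContinuousLinearMap.inr ℝ E3 E3)) ξ :=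
    HasFDerivAt.comp (g := fun z : E3 × E3 => f z.1 τ z.2) ξ h h2
  rw [dXi, h3.fderiv]
  simp

theorem poisson_eq {p s : E3 → ℝ → E3 → ℝ} {x ξ : E3} {τ : ℝ} {P S : E3 × E3 →L[ℝ] ℝ}
    (hp : HasFDerivAt (fun z : E3 × E3 => p z.1 τ z.2) P (x, ξ))
    (hs : HasFDerivAt (fun z : E3 × E3 => s z.1 τ z.2) S (x, ξ)) :
    poisson p s x τ ξ = poissonForm P S := by
  simp only [poisson, poissonForm, dX_eq hp, dX_eq hs, dXi_eq hp, dXi_eq hs]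

end Bracket

/-! ### Degrees of derivatives and brackets of homogeneous symbols. -/

section SymbolDerivatives

variable {M : ℝ} {m n : ℤ} {s t : E3 → E3 → ℝ} {x ξ : E3}

theorem WideHom.hasFDerivAt (hs : WideHom M m s) (hx : x ∈ wide M) (hξ : ξ ≠ 0) :
    HasFDerivAt (fun z : E3 × E3 => s z.1 z.2) (pd s x ξ) (x, ξ) :=
  ((hs.1.contDiffAt ((isOpen_wide_prod_compl M).mem_nhds
    (show (x, ξ) ∈ wide M ×ˢ ({0}ᶜ : Set E3) from ⟨hx, hξ⟩))).differentiableAt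
      (by simp)).hasFDerivAt

theorem SmoothAll.hasFDerivAt (hs : SmoothAll M s) (hx : x ∈ wide M) (ξ : E3) :
    HasFDerivAt (fun z : E3 × E3 => s z.1 z.2) (pd s x ξ) (x, ξ) :=
  ((ContDiffOn.contDiffAt hs ((isOpen_wide_prod M).mem_nhds
    (show (x, ξ) ∈ wide M ×ˢ (Set.univ : Set E3) from ⟨hx, trivial⟩))).differentiableAt
      (by simp)).hasFDerivAt

theorem SmoothAll.pd_apply (hs : SmoothAll M s) (v : E3 × E3) :
    SmoothAll M (fun x ξ => pd s x ξ v) :=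
  (ContDiffOn.fderiv_of_isOpen hs (isOpen_wide_prod M) (by simp)).clm_apply contDiffOn_const

theorem WideHom.contDiffOn_pd_apply (hs : WideHom M m s) (v : E3 × E3) :
    ContDiffOn ℝ ∞ (fun z : E3 × E3 => pd s z.1 z.2 v) (wide M ×ˢ {0}ᶜ) :=
  (ContDiffOn.fderiv_of_isOpen hs.1 (isOpen_wide_prod_compl M) (by simp)).clm_apply
    contDiffOn_const

/-- Differentiates `s x (c • ξ) = c ^ m * s x ξ` in all variables at once. Scaling acts only on the
frequency component, so `x` derivatives keep the degree and `ξ` derivatives lower it by one. -/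
theorem WideHom.pd_smul (hs : WideHom M m s) (hx : x ∈ wide M) (hξ : ξ ≠ 0) {c : ℝ} (hc : 0 < c)
    (v : E3 × E3) : pd s x (c • ξ) (v.1, c • v.2) = c ^ m * pd s x ξ v := by
  have hL : HasFDerivAt (fun z : E3 × E3 => (z.1, c • z.2))
      ((ContinuousLinearMap.fst ℝ E3 E3).prod (c • ContinuousLinearMap.snd ℝ E3 E3)) (x, ξ) :=
    hasFDerivAt_fst.prodMk (hasFDerivAt_snd.const_smul c)
  have h1 : HasFDerivAt (fun z : E3 × E3 => s z.1 (c • z.2)) _ (x, ξ) :=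
    HasFDerivAt.comp (g := fun z : E3 × E3 => s z.1 z.2) (x, ξ)
      (hs.hasFDerivAt hx (smul_ne_zero hc.ne' hξ)) hL
  have h2 := (hs.hasFDerivAt hx hξ).const_mul (c ^ m)
  have h3 : (fun z : E3 × E3 => s z.1 (c • z.2)) =ᶠ[nhds (x, ξ)]
      fun z => c ^ m * s z.1 z.2 := by
    filter_upwards [(isOpen_wide_prod_compl M).mem_nhds
      (show (x, ξ) ∈ wide M ×ˢ ({0}ᶜ : Set E3) from ⟨hx, hξ⟩)] with z hz
    exact hs.2 z.1 hz.1 z.2 hz.2 c hc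
  have h4 := h1.unique (h2.congr_of_eventuallyEq h3)
  have h5 := congrArg (fun L : E3 × E3 →L[ℝ] ℝ => L v) h4
  simpa using h5

theorem WideHom.pd_space (hs : WideHom M m s) (e : E3) :
    WideHom M m (fun x ξ => pd s x ξ (e, 0)) :=
  ⟨hs.contDiffOn_pd_apply _, fun x hx ξ hξ c hc => by
    simpa using hs.pd_smul hx hξ hc (e, 0)⟩

theorem WideHom.pd_freq (hs : WideHom M m s) (e : E3) :
    WideHom M (m - 1) (fun x ξ => pd s x ξ (0, e)) :=
  ⟨hs.contDiffOn_pd_apply _, fun x hx ξ hξ c hc => by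
    have h1 := hs.pd_smul hx hξ hc (0, e)
    have h2 : ((0 : E3), c • e) = c • ((0 : E3), e) := by simp
    simp only [h2, map_smul, smul_eq_mul] at h1
    have h3 : pd s x (c • ξ) (0, e) = c⁻¹ * (c * pd s x (c • ξ) (0, e)) := by field_simp
    beta_reduce
    rw [h3, h1, zpow_sub₀ hc.ne', zpow_one]
    field_simp⟩

/-- The Poisson bracket of phase space functions. -/
noncomputable def pb (s t : E3 → E3 → ℝ) (x ξ : E3) : ℝ := poissonForm (pd s x ξ) (pd t x ξ)

theorem WideHom.pb (hs : WideHom M m s) (ht : WideHom M n t) :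
    WideHom M (m + n - 1) (pb s t) := by
  have key (k : Fin 3) := (((hs.pd_freq (ev k)).mul (ht.pd_space (ev k))).cast
    (n := m + n - 1) (by ring)).sub
    (((hs.pd_space (ev k)).mul (ht.pd_freq (ev k))).cast (n := m + n - 1) (by ring))
  exact (((key 0).add (key 1)).add (key 2)).congr fun x _ ξ _ => by
    simp only [KerrTrap.pb, poissonForm, Fin.sum_univ_three]

end SymbolDerivatives

/-! ### Differentials of `r`, `Φ`, `ξ_r`, `λ²` and `sin² θ`. -/

section BasicCovectors

variable {M a : ℝ} {x ξ : E3}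

/-- The differential of `x_k`. -/
noncomputable def cX (k : Fin 3) : E3 × E3 →L[ℝ] ℝ :=
  (EuclideanSpace.proj k : E3 →L[ℝ] ℝ).comp (ContinuousLinearMap.fst ℝ E3 E3)

/-- The differential of `ξ_k`. -/
noncomputable def cΞ (k : Fin 3) : E3 × E3 →L[ℝ] ℝ :=
  (EuclideanSpace.proj k : E3 →L[ℝ] ℝ).comp (ContinuousLinearMap.snd ℝ E3 E3)

theorem hasFDerivAt_cX (k : Fin 3) (z : E3 × E3) :
    HasFDerivAt (fun z : E3 × E3 => z.1 k) (cX k) z := (cX k).hasFDerivAt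

theorem hasFDerivAt_cΞ (k : Fin 3) (z : E3 × E3) :
    HasFDerivAt (fun z : E3 × E3 => z.2 k) (cΞ k) z := (cΞ k).hasFDerivAt

@[simp] theorem cX_fst (j k : Fin 3) : cX j (ev k, 0) = if j = k then 1 else 0 := by
  simp [cX]
@[simp] theorem cX_snd (j k : Fin 3) : cX j (0, ev k) = 0 := by simp [cX]
@[simp] theorem cΞ_fst (j k : Fin 3) : cΞ j (ev k, 0) = 0 := by simp [cΞ]
@[simp] theorem cΞ_snd (j k : Fin 3) : cΞ j (0, ev k) = if j = k then 1 else 0 := by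
  simp [cΞ]

/-- The covector with given components. -/
noncomputable def cov (p q : Fin 3 → ℝ) : E3 × E3 →L[ℝ] ℝ :=
  p 0 • cX 0 + p 1 • cX 1 + p 2 • cX 2 + q 0 • cΞ 0 + q 1 • cΞ 1 + q 2 • cΞ 2

theorem poissonForm_cov (p q p' q' : Fin 3 → ℝ) : poissonForm (cov p q) (cov p' q')
    = q 0 * p' 0 + q 1 * p' 1 + q 2 * p' 2 - p 0 * q' 0 - p 1 * q' 1 - p 2 * q' 2 := by
  simp [poissonForm, cov, Fin.sum_univ_three]
  ring

/-- The derivative exists since `x ≠ 0`; differentiating `‖x‖² = ∑ x_k²` identifies it. -/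
theorem hasFDerivAt_norm_fst (hx : x ≠ 0) : HasFDerivAt (fun z : E3 × E3 => ‖z.1‖)
    (cov (fun k => x k / ‖x‖) 0) (x, ξ) := by
  have hn : ‖x‖ ≠ 0 := norm_ne_zero_iff.2 hx
  have hd : HasFDerivAt (fun z : E3 × E3 => ‖z.1‖)
      (fderiv ℝ (fun z : E3 × E3 => ‖z.1‖) (x, ξ)) (x, ξ) :=
    ((contDiffAt_norm ℝ (n := 1) (x := x) hx).comp (x, ξ) (f := Prod.fst) contDiffAt_fst
      |>.differentiableAt (by simp)).hasFDerivAt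
  have h1 := hd.pow 2
  have h2 := (((hasFDerivAt_cX 0 (x, ξ)).pow 2).add ((hasFDerivAt_cX 1 (x, ξ)).pow 2)).add
    ((hasFDerivAt_cX 2 (x, ξ)).pow 2)
  have h4 := h1.unique (h2.congr_of_eventuallyEq (.of_forall fun z => norm_sq_coord z.1))
  refine hd.congr_fderiv (ContinuousLinearMap.ext fun v => ?_)
  have h5 := congrArg (fun L : E3 × E3 →L[ℝ] ℝ => L v) h4
  simp [cov] at h5 ⊢
  field_simp
  linarith

theorem hasFDerivAt_angPhi (x ξ : E3) : HasFDerivAt (fun z : E3 × E3 => angPhi z.1 z.2)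
    (cov ![ξ 1, -ξ 0, 0] ![-x 1, x 0, 0]) (x, ξ) := by
  have h := ((hasFDerivAt_cX 0 (x, ξ)).mul (hasFDerivAt_cΞ 1 (x, ξ))).sub
    ((hasFDerivAt_cX 1 (x, ξ)).mul (hasFDerivAt_cΞ 0 (x, ξ)))
  refine h.congr_fderiv (ContinuousLinearMap.ext fun v => ?_)
  simp [cov]
  ring

theorem hasFDerivAt_inner (x ξ : E3) : HasFDerivAt (fun z : E3 × E3 => inner ℝ z.1 z.2)
    (cov ξ x) (x, ξ) := by
  have h := (((hasFDerivAt_cX 0 (x, ξ)).mul (hasFDerivAt_cΞ 0 (x, ξ))).add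
    ((hasFDerivAt_cX 1 (x, ξ)).mul (hasFDerivAt_cΞ 1 (x, ξ)))).add
    ((hasFDerivAt_cX 2 (x, ξ)).mul (hasFDerivAt_cΞ 2 (x, ξ)))
  have e : (fun z : E3 × E3 => inner ℝ z.1 z.2)
      = fun z => z.1 0 * z.2 0 + z.1 1 * z.2 1 + z.1 2 * z.2 2 :=
    funext fun z => inner_coord z.1 z.2
  rw [e]
  refine h.congr_fderiv (ContinuousLinearMap.ext fun v => ?_)
  simp [cov]
  ring

theorem hasFDerivAt_xiR (hx : x ≠ 0) : HasFDerivAt (fun z : E3 × E3 => xiR z.1 z.2)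
    (cov (fun k => ξ k / ‖x‖ - inner ℝ x ξ * x k / ‖x‖ ^ 3) (fun k => x k / ‖x‖)) (x, ξ) := by
  have hn : ‖x‖ ≠ 0 := norm_ne_zero_iff.2 hx
  have h := (hasFDerivAt_inner x ξ).mul
    ((hasDerivAt_inv hn).comp_hasFDerivAt (x, ξ) (hasFDerivAt_norm_fst (ξ := ξ) hx))
  simp only [xiR, div_eq_mul_inv (inner ℝ _ _)]
  refine h.congr_fderiv (ContinuousLinearMap.ext fun v => ?_)
  simp [cov]
  field_simp
  ring

theorem hasFDerivAt_lamSq (x ξ : E3) : HasFDerivAt (fun z : E3 × E3 => lamSq z.1 z.2)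
    (cov (fun k => 2 * ‖ξ‖ ^ 2 * x k - 2 * inner ℝ x ξ * ξ k)
      (fun k => 2 * ‖x‖ ^ 2 * ξ k - 2 * inner ℝ x ξ * x k)) (x, ξ) := by
  have hX := (((hasFDerivAt_cX 0 (x, ξ)).pow 2).add ((hasFDerivAt_cX 1 (x, ξ)).pow 2)).add
    ((hasFDerivAt_cX 2 (x, ξ)).pow 2)
  have hΞ := (((hasFDerivAt_cΞ 0 (x, ξ)).pow 2).add ((hasFDerivAt_cΞ 1 (x, ξ)).pow 2)).add
    ((hasFDerivAt_cΞ 2 (x, ξ)).pow 2)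
  have e : (fun z : E3 × E3 => lamSq z.1 z.2)
      = fun z => (z.1 0 ^ 2 + z.1 1 ^ 2 + z.1 2 ^ 2) * (z.2 0 ^ 2 + z.2 1 ^ 2 + z.2 2 ^ 2)
        - inner ℝ z.1 z.2 ^ 2 :=
    funext fun z => by rw [lamSq_eq, norm_sq_coord, norm_sq_coord]
  rw [e]
  refine ((hX.mul hΞ).sub ((hasFDerivAt_inner x ξ).pow 2)).congr_fderiv
    (ContinuousLinearMap.ext fun v => ?_)
  simp [cov, norm_sq_coord]
  ring

theorem hasFDerivAt_sinSq (hx : x ≠ 0) : HasFDerivAt (fun z : E3 × E3 => sinSq z.1)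
    (cov ![2 * x 0 / ‖x‖ ^ 2 - 2 * (x 0 ^ 2 + x 1 ^ 2) * x 0 / ‖x‖ ^ 4,
      2 * x 1 / ‖x‖ ^ 2 - 2 * (x 0 ^ 2 + x 1 ^ 2) * x 1 / ‖x‖ ^ 4,
      -(2 * (x 0 ^ 2 + x 1 ^ 2) * x 2 / ‖x‖ ^ 4)] 0) (x, ξ) := by
  have hn : ‖x‖ ≠ 0 := norm_ne_zero_iff.2 hx
  have h := (((hasFDerivAt_cX 0 (x, ξ)).pow 2).add ((hasFDerivAt_cX 1 (x, ξ)).pow 2)).mul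
    ((hasDerivAt_inv (pow_ne_zero 2 hn)).comp_hasFDerivAt (x, ξ)
      ((hasFDerivAt_norm_fst (ξ := ξ) hx).pow 2))
  simp only [sinSq, div_eq_mul_inv (_ + _)]
  refine h.congr_fderiv (ContinuousLinearMap.ext fun v => ?_)
  simp [cov]
  field_simp
  ring

end BasicCovectors

/-! ### Canonical relations: `r` and `ξ_r` are conjugate, all other brackets needed vanish. -/

section BracketTable

variable {x ξ : E3}

/-- The differential of `r`. -/
noncomputable def dR (x : E3) : E3 × E3 →L[ℝ] ℝ := cov (fun k => x k / ‖x‖) 0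

/-- The differential of `Φ`. -/
noncomputable def dPhi (x ξ : E3) : E3 × E3 →L[ℝ] ℝ := cov ![ξ 1, -ξ 0, 0] ![-x 1, x 0, 0]

/-- The differential of `ξ_r`. -/
noncomputable def dXiR (x ξ : E3) : E3 × E3 →L[ℝ] ℝ :=
  cov (fun k => ξ k / ‖x‖ - inner ℝ x ξ * x k / ‖x‖ ^ 3) (fun k => x k / ‖x‖)

/-- The differential of `λ²`. -/
noncomputable def dLamSq (x ξ : E3) : E3 × E3 →L[ℝ] ℝ :=
  cov (fun k => 2 * ‖ξ‖ ^ 2 * x k - 2 * inner ℝ x ξ * ξ k)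
    (fun k => 2 * ‖x‖ ^ 2 * ξ k - 2 * inner ℝ x ξ * x k)

/-- The differential of `sin² θ`. -/
noncomputable def dSinSq (x : E3) : E3 × E3 →L[ℝ] ℝ :=
  cov ![2 * x 0 / ‖x‖ ^ 2 - 2 * (x 0 ^ 2 + x 1 ^ 2) * x 0 / ‖x‖ ^ 4,
      2 * x 1 / ‖x‖ ^ 2 - 2 * (x 0 ^ 2 + x 1 ^ 2) * x 1 / ‖x‖ ^ 4,
      -(2 * (x 0 ^ 2 + x 1 ^ 2) * x 2 / ‖x‖ ^ 4)] 0

theorem dR_dR (x : E3) : poissonForm (dR x) (dR x) = 0 := poissonForm_self _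

theorem dPhi_dR (x ξ : E3) : poissonForm (dPhi x ξ) (dR x) = 0 := by
  rw [dPhi, dR, poissonForm_cov]
  simp
  ring

theorem dXiR_dR (hx : x ≠ 0) : poissonForm (dXiR x ξ) (dR x) = 1 := by
  have hn : ‖x‖ ≠ 0 := norm_ne_zero_iff.2 hx
  rw [dXiR, dR, poissonForm_cov]
  simp
  field_simp
  linarith [norm_sq_coord x]

theorem dLamSq_dR (x ξ : E3) : poissonForm (dLamSq x ξ) (dR x) = 0 := by
  rcases eq_or_ne x 0 with rfl | hx
  · rw [dLamSq, dR, poissonForm_cov]; simp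
  have hn : ‖x‖ ≠ 0 := norm_ne_zero_iff.2 hx
  rw [dLamSq, dR, poissonForm_cov]
  simp only [Pi.zero_apply, mul_zero, sub_zero]
  field_simp
  rw [norm_sq_coord, inner_coord]
  ring

theorem dSinSq_dR (x : E3) : poissonForm (dSinSq x) (dR x) = 0 := by
  rw [dSinSq, dR, poissonForm_cov]
  simp

theorem dR_dPhi (x ξ : E3) : poissonForm (dR x) (dPhi x ξ) = 0 := by
  rw [dPhi, dR, poissonForm_cov]
  simp
  ring

theorem dXiR_dPhi (hx : x ≠ 0) : poissonForm (dXiR x ξ) (dPhi x ξ) = 0 := by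
  have hn : ‖x‖ ≠ 0 := norm_ne_zero_iff.2 hx
  rw [dXiR, dPhi, poissonForm_cov]
  simp
  field_simp
  ring

theorem dLamSq_dPhi (x ξ : E3) : poissonForm (dLamSq x ξ) (dPhi x ξ) = 0 := by
  rw [dLamSq, dPhi, poissonForm_cov]
  simp
  ring

theorem dSinSq_dPhi (x ξ : E3) : poissonForm (dSinSq x) (dPhi x ξ) = 0 := by
  rw [dSinSq, dPhi, poissonForm_cov]
  simp
  ring

theorem dR_dXiR (hx : x ≠ 0) : poissonForm (dR x) (dXiR x ξ) = -1 := by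
  have hn : ‖x‖ ≠ 0 := norm_ne_zero_iff.2 hx
  rw [dXiR, dR, poissonForm_cov]
  simp
  field_simp
  linarith [norm_sq_coord x]

theorem dPhi_dXiR (hx : x ≠ 0) : poissonForm (dPhi x ξ) (dXiR x ξ) = 0 := by
  have hn : ‖x‖ ≠ 0 := norm_ne_zero_iff.2 hx
  rw [dXiR, dPhi, poissonForm_cov]
  simp
  field_simp
  ring

theorem dLamSq_dXiR (hx : x ≠ 0) : poissonForm (dLamSq x ξ) (dXiR x ξ) = 0 := by
  have hn : ‖x‖ ≠ 0 := norm_ne_zero_iff.2 hx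
  have e1 := norm_sq_coord x
  have e2 := norm_sq_coord ξ
  have e3 := inner_coord x ξ
  rw [dLamSq, dXiR, poissonForm_cov]
  generalize inner ℝ x ξ = w at *
  generalize ‖x‖ = n at *
  generalize ‖ξ‖ = m at *
  field_simp
  subst e3
  rw [e1, e2]
  ring

theorem dSinSq_dXiR (hx : x ≠ 0) : poissonForm (dSinSq x) (dXiR x ξ) = 0 := by
  have hn : ‖x‖ ≠ 0 := norm_ne_zero_iff.2 hx
  have e1 := norm_sq_coord x
  rw [dSinSq, dXiR, poissonForm_cov]
  simp
  field_simp
  rw [e1]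
  ring

end BracketTable

/-! ### Brackets of `p_K` with `r`, `Φ` and `ξ_r` at a root. -/

section KerrBracket

variable {M a : ℝ} {x ξ : E3}

theorem hasDerivAt_kDelta (M a r : ℝ) : HasDerivAt (kDelta M a) (2 * (r - M)) r := by
  have h := (((hasDerivAt_id r).pow 2).sub ((hasDerivAt_id r).const_mul (2 * M))).add_const (a ^ 2)
  exact h.congr_deriv (by simp; ring)

/-- This and the next two derivatives are the source of `R_a`: combined with `τ²`, `τ Φ` and `Φ²`
they add up to `-2 R_a / Δ²`. -/
theorem hasDerivAt_tt_radial {r : ℝ} (hΔ : kDelta M a r ≠ 0) :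
    HasDerivAt (fun r => -(r ^ 2 + a ^ 2) ^ 2 / kDelta M a r)
      (-(2 * (r ^ 2 + a ^ 2) * (r ^ 3 - 3 * M * r ^ 2 + a ^ 2 * r + a ^ 2 * M))
        / kDelta M a r ^ 2) r := by
  refine ((((((hasDerivAt_id r).pow 2).add_const (a ^ 2)).pow 2).neg).div
    (hasDerivAt_kDelta M a r) hΔ).congr_deriv ?_
  congr 1
  simp [kDelta]
  ring

theorem hasDerivAt_tphi_radial {r : ℝ} (hΔ : kDelta M a r ≠ 0) :
    HasDerivAt (fun r => r / kDelta M a r) ((a ^ 2 - r ^ 2) / kDelta M a r ^ 2) r := by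
  refine ((hasDerivAt_id r).div (hasDerivAt_kDelta M a r) hΔ).congr_deriv ?_
  congr 1
  simp [kDelta]
  ring

theorem hasDerivAt_phiphi_radial {r : ℝ} (hΔ : kDelta M a r ≠ 0) :
    HasDerivAt (fun r => a ^ 2 / kDelta M a r) (-(2 * a ^ 2 * (r - M)) / kDelta M a r ^ 2) r := by
  refine ((hasDerivAt_const r (a ^ 2)).div (hasDerivAt_kDelta M a r) hΔ).congr_deriv ?_
  congr 1
  ring

theorem pK_eq_div (h : Small M a) (hx : x ∈ wide M) (τ : ℝ) (ξ : E3) :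
    pK M a x τ ξ = (rhoSq a x)⁻¹ * (-(‖x‖ ^ 2 + a ^ 2) ^ 2 / kDelta M a ‖x‖ * τ ^ 2
      + a ^ 2 * τ ^ 2 * sinSq x - 4 * a * M * τ * (‖x‖ / kDelta M a ‖x‖) * angPhi x ξ
      + kDelta M a ‖x‖ * xiR x ξ ^ 2 + lamSq x ξ - a ^ 2 / kDelta M a ‖x‖ * angPhi x ξ ^ 2) := by
  have h1 := (rhoSq_pos (a := a) h.mass_pos hx).ne'
  have h2 := (kDelta_pos h hx).ne'
  rw [pK, gtt, gtphi, pSpace]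
  field_simp
  ring

/-- The `r` derivative of `ρ² p_K` at fixed `Φ`, `ξ_r`, `λ²`, `θ`. -/
noncomputable def radialDeriv (M a : ℝ) (x : E3) (τ : ℝ) (ξ : E3) : ℝ :=
  2 * (‖x‖ - M) * xiR x ξ ^ 2 - 2 * Ra M a ‖x‖ τ (angPhi x ξ) / kDelta M a ‖x‖ ^ 2

/-- At a zero of `p_K` the derivative of the factor `ρ⁻²` does not contribute, so only the separated
expression `ρ² p_K` is differentiated, in the variables of the bracket table. -/
theorem hasFDerivAt_pK_root (h : Small M a) (hx : x ∈ wide M) {τ : ℝ} (h0 : pK M a x τ ξ = 0) :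
    HasFDerivAt (fun z : E3 × E3 => pK M a z.1 τ z.2) ((rhoSq a x)⁻¹ •
      (radialDeriv M a x τ ξ • dR x
        + (-(4 * a * M * τ * (‖x‖ / kDelta M a ‖x‖)) - 2 * a ^ 2 / kDelta M a ‖x‖ * angPhi x ξ)
          • dPhi x ξ
        + (2 * kDelta M a ‖x‖ * xiR x ξ) • dXiR x ξ + dLamSq x ξ + (a ^ 2 * τ ^ 2) • dSinSq x))
      (x, ξ) := by
  have hM := h.mass_pos
  have hr0 := norm_pos_of_wide hM hx
  have hx0 : x ≠ 0 := norm_pos_iff.1 hr0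
  have hΔ := (kDelta_pos h hx).ne'
  have hρ := (rhoSq_pos (a := a) hM hx).ne'
  have hr : HasFDerivAt (fun z : E3 × E3 => ‖z.1‖) (dR x) (x, ξ) := hasFDerivAt_norm_fst hx0
  have hΦ : HasFDerivAt (fun z : E3 × E3 => angPhi z.1 z.2) (dPhi x ξ) (x, ξ) :=
    hasFDerivAt_angPhi x ξ
  have hX : HasFDerivAt (fun z : E3 × E3 => xiR z.1 z.2) (dXiR x ξ) (x, ξ) :=
    hasFDerivAt_xiR hx0
  have hL : HasFDerivAt (fun z : E3 × E3 => lamSq z.1 z.2) (dLamSq x ξ) (x, ξ) :=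
    hasFDerivAt_lamSq x ξ
  have hS : HasFDerivAt (fun z : E3 × E3 => sinSq z.1) (dSinSq x) (x, ξ) :=
    hasFDerivAt_sinSq hx0
  have hA := (hasDerivAt_tt_radial hΔ).comp_hasFDerivAt (x, ξ) hr
  have hB := (hasDerivAt_tphi_radial hΔ).comp_hasFDerivAt (x, ξ) hr
  have hC := (hasDerivAt_phiphi_radial hΔ).comp_hasFDerivAt (x, ξ) hr
  have hD := (hasDerivAt_kDelta M a ‖x‖).comp_hasFDerivAt (x, ξ) hr
  have hP : HasFDerivAt (fun z : E3 × E3 => -(‖z.1‖ ^ 2 + a ^ 2) ^ 2 / kDelta M a ‖z.1‖ * τ ^ 2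
      + a ^ 2 * τ ^ 2 * sinSq z.1 - 4 * a * M * τ * (‖z.1‖ / kDelta M a ‖z.1‖) * angPhi z.1 z.2
      + kDelta M a ‖z.1‖ * xiR z.1 z.2 ^ 2 + lamSq z.1 z.2
      - a ^ 2 / kDelta M a ‖z.1‖ * angPhi z.1 z.2 ^ 2)
      (radialDeriv M a x τ ξ • dR x
        + (-(4 * a * M * τ * (‖x‖ / kDelta M a ‖x‖)) - 2 * a ^ 2 / kDelta M a ‖x‖ * angPhi x ξ)
          • dPhi x ξ
        + (2 * kDelta M a ‖x‖ * xiR x ξ) • dXiR x ξ + dLamSq x ξ + (a ^ 2 * τ ^ 2) • dSinSq x)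
      (x, ξ) := by
    refine ((((((hA.mul_const (τ ^ 2)).add (hS.const_mul (a ^ 2 * τ ^ 2))).sub
      ((hB.const_mul (4 * a * M * τ)).mul hΦ)).add (hD.mul (hX.pow 2))).add hL).sub
      (hC.mul (hΦ.pow 2))).congr_fderiv (ContinuousLinearMap.ext fun v => ?_)
    simp only [add_apply, sub_apply, smul_apply, smul_eq_mul, Function.comp_apply, radialDeriv, Ra,
      nsmul_eq_mul]
    generalize dR x v = v1
    generalize dPhi x ξ v = v2
    generalize dXiR x ξ v = v3
    generalize dLamSq x ξ v = v4
    generalize dSinSq x v = v5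
    generalize angPhi x ξ = Y
    generalize xiR x ξ = X
    generalize ‖x‖ = r at hΔ ⊢
    generalize kDelta M a r = D at hΔ ⊢
    field_simp
    push_cast
    ring
  have hR : HasFDerivAt (fun z : E3 × E3 => (rhoSq a z.1)⁻¹)
      (pd (fun x _ => (rhoSq a x)⁻¹) x ξ) (x, ξ) :=
    (SmoothAll.of_space ((contDiffOn_rhoSq (a := a) hM).inv fun y hy =>
      (rhoSq_pos (a := a) hM hy).ne')).hasFDerivAt hx ξ
  have hp0 := pK_eq_div h hx τ ξ
  rw [h0] at hp0
  have hP0 := (mul_eq_zero.1 hp0.symm).resolve_left (inv_ne_zero hρ)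
  refine ((hR.mul hP).congr_of_eventuallyEq ?_).congr_fderiv ?_
  · filter_upwards [(isOpen_wide_prod M).mem_nhds
      (show (x, ξ) ∈ wide M ×ˢ (Set.univ : Set E3) from ⟨hx, trivial⟩)] with z hz
    exact pK_eq_div h hz.1 τ z.2
  · simp only [hP0, zero_smul, add_zero]

theorem pK_bracket_r (h : Small M a) (hx : x ∈ wide M) {τ : ℝ} (h0 : pK M a x τ ξ = 0) :
    poissonForm (pd (fun x ξ => pK M a x τ ξ) x ξ) (dR x)
      = 2 * kDelta M a ‖x‖ * xiR x ξ / rhoSq a x := by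
  have hx0 : x ≠ 0 := norm_pos_iff.1 (norm_pos_of_wide h.mass_pos hx)
  rw [pd, (hasFDerivAt_pK_root h hx h0).fderiv]
  simp only [poissonForm_smul_left, poissonForm_add_left, dR_dR, dPhi_dR, dXiR_dR hx0, dLamSq_dR,
    dSinSq_dR]
  ring

theorem pK_bracket_angPhi (h : Small M a) (hx : x ∈ wide M) {τ : ℝ} (h0 : pK M a x τ ξ = 0) :
    poissonForm (pd (fun x ξ => pK M a x τ ξ) x ξ) (dPhi x ξ) = 0 := by
  have hx0 : x ≠ 0 := norm_pos_iff.1 (norm_pos_of_wide h.mass_pos hx)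
  rw [pd, (hasFDerivAt_pK_root h hx h0).fderiv]
  simp only [poissonForm_smul_left, poissonForm_add_left, dR_dPhi, poissonForm_self,
    dXiR_dPhi hx0, dLamSq_dPhi, dSinSq_dPhi]
  ring

theorem pK_bracket_xiR (h : Small M a) (hx : x ∈ wide M) {τ : ℝ} (h0 : pK M a x τ ξ = 0) :
    poissonForm (pd (fun x ξ => pK M a x τ ξ) x ξ) (dXiR x ξ)
      = -radialDeriv M a x τ ξ / rhoSq a x := by
  have hx0 : x ≠ 0 := norm_pos_iff.1 (norm_pos_of_wide h.mass_pos hx)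
  rw [pd, (hasFDerivAt_pK_root h hx h0).fderiv]
  simp only [poissonForm_smul_left, poissonForm_add_left, dR_dXiR hx0, dPhi_dXiR hx0,
    poissonForm_self, dLamSq_dXiR hx0, dSinSq_dXiR hx0]
  ring

end KerrBracket

/-! ### Brackets with `p_K` when `τ` is frozen at a root. -/

section RootBrackets

variable {M a : ℝ} {b : ℝ → ℝ} {x ξ : E3}

theorem poissonForm_neg_left {u v : E3 × E3 →L[ℝ] ℝ} : poissonForm (-u) v = -poissonForm u v := by
  simp only [poissonForm, Fin.sum_univ_three, neg_apply]; ring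

theorem pd_eq {f : E3 → E3 → ℝ} {L : E3 × E3 →L[ℝ] ℝ}
    (h : HasFDerivAt (fun z : E3 × E3 => f z.1 z.2) L (x, ξ)) : pd f x ξ = L := h.fderiv

theorem eventually_wide (hx : x ∈ wide M) (hξ : ξ ≠ 0) :
    ∀ᶠ z : E3 × E3 in nhds (x, ξ), z.1 ∈ wide M ∧ z.2 ≠ 0 :=
  (isOpen_wide_prod_compl M).mem_nhds (show (x, ξ) ∈ wide M ×ˢ ({0}ᶜ : Set E3) from ⟨hx, hξ⟩)

/-- When the number `τ` equals the value of one root, only the differential of that root survives.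
Hence the bracket of `p_K` with that root is zero. -/
theorem pd_pK_of_factor (h : Small M a) (hx : x ∈ wide M) (hξ : ξ ≠ 0) (τ : ℝ) :
    pd (fun y η => pK M a y τ η) x ξ
      = ((τ - tau1 M a x ξ) * (τ - tau2 M a x ξ)) • pd (fun y _ => gtt M a y) x ξ
        - (gtt M a x * (τ - tau2 M a x ξ)) • pd (tau1 M a) x ξ
        - (gtt M a x * (τ - tau1 M a x ξ)) • pd (tau2 M a) x ξ := by
  have h1 := ((wideHom_tau1 h).hasFDerivAt hx hξ).const_sub τ
  have h2 := ((wideHom_tau2 h).hasFDerivAt hx hξ).const_sub τ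
  have hg := (wideHom_gtt h).hasFDerivAt hx hξ
  refine pd_eq ((((hg.mul h1).mul h2).congr_of_eventuallyEq ?_).congr_fderiv
    (ContinuousLinearMap.ext fun v => ?_))
  · filter_upwards [eventually_wide hx hξ] with z hz
    exact pK_eq_factor h hz.1 hz.2 τ
  · simp
    ring

theorem pK_bracket_tau1 (h : Small M a) (hx : x ∈ wide M) (hξ : ξ ≠ 0) :
    poissonForm (pd (fun y η => pK M a y (tau1 M a x ξ) η) x ξ) (pd (tau1 M a) x ξ) = 0 := by
  rw [pd_pK_of_factor h hx hξ, sub_self, zero_mul, mul_zero, zero_smul, zero_smul, zero_sub,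
    sub_zero, poissonForm_neg_left, poissonForm_smul_left, poissonForm_self, mul_zero, neg_zero]

theorem pK_bracket_tau2 (h : Small M a) (hx : x ∈ wide M) (hξ : ξ ≠ 0) :
    poissonForm (pd (fun y η => pK M a y (tau2 M a x ξ) η) x ξ) (pd (tau2 M a) x ξ) = 0 := by
  rw [pd_pK_of_factor h hx hξ, sub_self, mul_zero, mul_zero, zero_smul, zero_smul, zero_sub,
    neg_zero, zero_sub, poissonForm_neg_left, poissonForm_smul_left, poissonForm_self, mul_zero, neg_zero]

theorem hasFDerivAt_sub_rTrap (h : Small M a) (hx : x ∈ wide M) {t : E3 → E3 → ℝ}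
    {T : E3 × E3 →L[ℝ] ℝ} (ht : HasFDerivAt (fun z : E3 × E3 => t z.1 z.2) T (x, ξ))
    (h0 : t x ξ ≠ 0) (hd : angPhi x ξ / t x ξ ∈ trapDom M) :
    HasFDerivAt (fun z : E3 × E3 => ‖z.1‖ - rTrap M a (angPhi z.1 z.2 / t z.1 z.2))
      (dR x - trapSlope M a (angPhi x ξ / t x ξ) (angPhi x ξ / t x ξ) •
        ((t x ξ)⁻¹ • dPhi x ξ - (angPhi x ξ / t x ξ ^ 2) • T)) (x, ξ) := by
  have hx0 : x ≠ 0 := norm_pos_iff.1 (norm_pos_of_wide h.mass_pos hx)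
  have hr : HasFDerivAt (fun z : E3 × E3 => ‖z.1‖) (dR x) (x, ξ) := hasFDerivAt_norm_fst hx0
  have hΦ : HasFDerivAt (fun z : E3 × E3 => angPhi z.1 z.2) (dPhi x ξ) (x, ξ) :=
    hasFDerivAt_angPhi x ξ
  have hw : HasFDerivAt (fun z : E3 × E3 => angPhi z.1 z.2 / t z.1 z.2)
      ((t x ξ)⁻¹ • dPhi x ξ - (angPhi x ξ / t x ξ ^ 2) • T) (x, ξ) := by
    have := hΦ.mul ((hasDerivAt_inv h0).comp_hasFDerivAt (x, ξ) ht)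
    simp only [div_eq_mul_inv (angPhi _ _) (t _ _)]
    refine this.congr_fderiv (ContinuousLinearMap.ext fun v => ?_)
    simp
    ring
  exact hr.sub (HasDerivAt.comp_hasFDerivAt (h₂ := rTrap M a) (x, ξ) (hasDerivAt_rTrap h hd) hw)

/-- `r_a(Φ/t)` is a function of `Φ` and `t`, both of which commute with `p_K` at the point, so only
`{p_K, r}` remains. -/
theorem pK_bracket_sub_rTrap (h : Small M a) (hx : x ∈ wide M) {t : E3 → E3 → ℝ} {τ : ℝ}
    {T : E3 × E3 →L[ℝ] ℝ} (ht : HasFDerivAt (fun z : E3 × E3 => t z.1 z.2) T (x, ξ))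
    (h0 : t x ξ ≠ 0) (hd : angPhi x ξ / t x ξ ∈ trapDom M) (hp : pK M a x τ ξ = 0)
    (hT : poissonForm (pd (fun y η => pK M a y τ η) x ξ) T = 0) :
    poissonForm (pd (fun y η => pK M a y τ η) x ξ)
      (pd (fun y η => ‖y‖ - rTrap M a (angPhi y η / t y η)) x ξ)
      = 2 * kDelta M a ‖x‖ * xiR x ξ / rhoSq a x := by
  rw [pd_eq (f := fun y η => ‖y‖ - rTrap M a (angPhi y η / t y η))
    (hasFDerivAt_sub_rTrap h hx ht h0 hd), poissonForm_sub_right, poissonForm_smul_right,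
    poissonForm_sub_right, poissonForm_smul_right, poissonForm_smul_right, hT,
    pK_bracket_angPhi h hx hp, pK_bracket_r h hx hp]
  ring

theorem pK_bracket_rho1 (h : Small M a) (hx : x ∈ wide M) (hξ : ξ ≠ 0) :
    poissonForm (pd (fun y η => pK M a y (tau1 M a x ξ) η) x ξ) (pd (rho1 M a) x ξ)
      = 2 * kDelta M a ‖x‖ * xiR x ξ / rhoSq a x :=
  pK_bracket_sub_rTrap h hx ((wideHom_tau1 h).hasFDerivAt hx hξ) (tau1_pos h hx hξ).ne'
    (div_tau1_mem h hx hξ) (pK_tau1 h hx hξ) (pK_bracket_tau1 h hx hξ)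

theorem pK_bracket_rho2 (h : Small M a) (hx : x ∈ wide M) (hξ : ξ ≠ 0) :
    poissonForm (pd (fun y η => pK M a y (tau2 M a x ξ) η) x ξ) (pd (rho2 M a) x ξ)
      = 2 * kDelta M a ‖x‖ * xiR x ξ / rhoSq a x :=
  pK_bracket_sub_rTrap h hx ((wideHom_tau2 h).hasFDerivAt hx hξ) (tau2_neg h hx hξ).ne
    (div_tau2_mem h hx hξ) (pK_tau2 h hx hξ) (pK_bracket_tau2 h hx hξ)

/-- The derivative of `r⁻¹ b(r)`. -/
noncomputable def bSlope (b : ℝ → ℝ) (r : ℝ) : ℝ := deriv (fun r => b r / r) r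

theorem hasDerivAt_div_radius (hM : 0 < M) (hb : ContDiffOn ℝ ∞ b (Set.Ioi (2 * M))) {r : ℝ}
    (hr : 2 * M < r) : HasDerivAt (fun r => b r / r) (bSlope b r) r := by
  have h1 : DifferentiableAt ℝ b r :=
    (hb.contDiffAt (Ioi_mem_nhds hr)).differentiableAt (by simp)
  exact (h1.div differentiableAt_id (by simp; linarith)).hasDerivAt

theorem contDiffOn_bSlope (hM : 0 < M) (hb : ContDiffOn ℝ ∞ b (Set.Ioi (2 * M))) :
    ContDiffOn ℝ ∞ (bSlope b) (Set.Ioi (2 * M)) := by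
  have h1 : ContDiffOn ℝ ∞ (fun r => b r / r) (Set.Ioi (2 * M)) :=
    hb.div contDiffOn_id fun r hr => by
      have : 2 * M < r := hr
      simp; linarith
  exact h1.deriv_of_isOpen isOpen_Ioi (by simp)

theorem two_mul_lt_norm (hM : 0 < M) (hx : x ∈ wide M) : 2 * M < ‖x‖ := by
  linarith [(wide_bounds hx).1]

theorem hasFDerivAt_quot (h : Small M a) (hb : ContDiffOn ℝ ∞ b (Set.Ioi (2 * M)))
    (hx : x ∈ wide M) (hξ : ξ ≠ 0) (τ : ℝ) :
    HasFDerivAt (fun z : E3 × E3 => quot0 M a b z.1 z.2 + quot1 M a b z.1 z.2 * τ)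
      (pd (quot0 M a b) x ξ + τ • pd (quot1 M a b) x ξ) (x, ξ) :=
  (((wideHom_quot0 h hb).hasFDerivAt hx hξ).add
    (((wideHom_quot1 h hb).hasFDerivAt hx hξ).mul_const τ))

theorem pd_quot (h : Small M a) (hb : ContDiffOn ℝ ∞ b (Set.Ioi (2 * M)))
    (hx : x ∈ wide M) (hξ : ξ ≠ 0) (τ : ℝ) :
    pd (quot0 M a b) x ξ + τ • pd (quot1 M a b) x ξ
      = ((rho1 M a x ξ * (τ - tau2 M a x ξ) - rho2 M a x ξ * (τ - tau1 M a x ξ))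
          * (tau1 M a x ξ - tau2 M a x ξ)⁻¹ * bSlope b ‖x‖) • dR x
        + (b ‖x‖ / ‖x‖ * (tau1 M a x ξ - tau2 M a x ξ)⁻¹) •
          ((τ - tau2 M a x ξ) • pd (rho1 M a) x ξ - rho1 M a x ξ • pd (tau2 M a) x ξ
            - (τ - tau1 M a x ξ) • pd (rho2 M a) x ξ + rho2 M a x ξ • pd (tau1 M a) x ξ)
        - (b ‖x‖ / ‖x‖ * (rho1 M a x ξ * (τ - tau2 M a x ξ) - rho2 M a x ξ * (τ - tau1 M a x ξ))
            * (tau1 M a x ξ - tau2 M a x ξ)⁻¹ ^ 2) •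
          (pd (tau1 M a) x ξ - pd (tau2 M a) x ξ) := by
  have hx0 : x ≠ 0 := norm_pos_iff.1 (norm_pos_of_wide h.mass_pos hx)
  have hr : HasFDerivAt (fun z : E3 × E3 => ‖z.1‖) (dR x) (x, ξ) := hasFDerivAt_norm_fst hx0
  have hB := HasDerivAt.comp_hasFDerivAt (h₂ := fun r => b r / r) (x, ξ)
    (hasDerivAt_div_radius h.mass_pos hb (two_mul_lt_norm h.mass_pos hx)) hr
  have h1 := (wideHom_tau1 h).hasFDerivAt hx hξ
  have h2 := (wideHom_tau2 h).hasFDerivAt hx hξ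
  have r1 := (wideHom_rho1 h).hasFDerivAt hx hξ
  have r2 := (wideHom_rho2 h).hasFDerivAt hx hξ
  have hI := (hasDerivAt_inv (tau_sub_pos h hx hξ).ne').comp_hasFDerivAt (x, ξ) (h1.sub h2)
  have hQ := (hB.mul ((r1.mul (h2.const_sub τ)).sub (r2.mul (h1.const_sub τ)))).mul hI
  refine (hasFDerivAt_quot h hb hx hξ τ).unique ((hQ.congr_of_eventuallyEq
    (.of_forall fun z => quot_eq M a b z.1 z.2 τ)).congr_fderiv
    (ContinuousLinearMap.ext fun v => ?_))
  simp only [add_apply, sub_apply, smul_apply, neg_apply, smul_eq_mul, Function.comp_apply,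
    Pi.sub_apply, Pi.mul_apply, ← inv_pow]
  generalize (tau1 M a x ξ - tau2 M a x ξ)⁻¹ = I
  ring

/-- With `τ` frozen at `τ̃₁`, the differential of the interpolant is that of `r⁻¹ b ϱ̃₁` minus a
multiple of that of `τ̃₁`, and the latter is annihilated. -/
theorem pK_bracket_quot1 (h : Small M a) (hb : ContDiffOn ℝ ∞ b (Set.Ioi (2 * M)))
    (hx : x ∈ wide M) (hξ : ξ ≠ 0) :
    poissonForm (pd (fun y η => pK M a y (tau1 M a x ξ) η) x ξ)
      (pd (quot0 M a b) x ξ + tau1 M a x ξ • pd (quot1 M a b) x ξ)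
      = (rho1 M a x ξ * bSlope b ‖x‖ + b ‖x‖ / ‖x‖)
        * (2 * kDelta M a ‖x‖ * xiR x ξ / rhoSq a x) := by
  have hD := (tau_sub_pos h hx hξ).ne'
  have e : pd (quot0 M a b) x ξ + tau1 M a x ξ • pd (quot1 M a b) x ξ
      = (rho1 M a x ξ * bSlope b ‖x‖) • dR x + (b ‖x‖ / ‖x‖) • pd (rho1 M a) x ξ
        - (b ‖x‖ / ‖x‖ * (rho1 M a x ξ - rho2 M a x ξ) * (tau1 M a x ξ - tau2 M a x ξ)⁻¹)
          • pd (tau1 M a) x ξ := by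
    rw [pd_quot h hb hx hξ]
    refine ContinuousLinearMap.ext fun v => ?_
    simp only [add_apply, sub_apply, smul_apply, smul_eq_mul]
    field_simp
    ring
  rw [e, poissonForm_sub_right, poissonForm_add_right, poissonForm_smul_right,
    poissonForm_smul_right, poissonForm_smul_right, pK_bracket_rho1 h hx hξ,
    pK_bracket_tau1 h hx hξ, pK_bracket_r h hx (pK_tau1 h hx hξ)]
  ring

theorem pK_bracket_quot2 (h : Small M a) (hb : ContDiffOn ℝ ∞ b (Set.Ioi (2 * M)))
    (hx : x ∈ wide M) (hξ : ξ ≠ 0) :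
    poissonForm (pd (fun y η => pK M a y (tau2 M a x ξ) η) x ξ)
      (pd (quot0 M a b) x ξ + tau2 M a x ξ • pd (quot1 M a b) x ξ)
      = (rho2 M a x ξ * bSlope b ‖x‖ + b ‖x‖ / ‖x‖)
        * (2 * kDelta M a ‖x‖ * xiR x ξ / rhoSq a x) := by
  have hD := (tau_sub_pos h hx hξ).ne'
  have e : pd (quot0 M a b) x ξ + tau2 M a x ξ • pd (quot1 M a b) x ξ
      = (rho2 M a x ξ * bSlope b ‖x‖) • dR x + (b ‖x‖ / ‖x‖) • pd (rho2 M a) x ξ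
        - (b ‖x‖ / ‖x‖ * (rho1 M a x ξ - rho2 M a x ξ) * (tau1 M a x ξ - tau2 M a x ξ)⁻¹)
          • pd (tau2 M a) x ξ := by
    rw [pd_quot h hb hx hξ]
    refine ContinuousLinearMap.ext fun v => ?_
    simp only [add_apply, sub_apply, smul_apply, smul_eq_mul]
    field_simp
    ring
  rw [e, poissonForm_sub_right, poissonForm_add_right, poissonForm_smul_right,
    poissonForm_smul_right, poissonForm_smul_right, pK_bracket_rho2 h hx hξ,
    pK_bracket_tau2 h hx hξ, pK_bracket_r h hx (pK_tau2 h hx hξ)]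
  ring

end RootBrackets

/-! ### The bracket `{p_K, σ̃_K}` as a cubic in `τ`. -/

section BracketPolynomial

variable {M a : ℝ} {b : ℝ → ℝ} {x ξ : E3}

/-- Twice `g^{tφ} Φ`, the coefficient of `τ` in `p_K`. -/
noncomputable def pLin (M a : ℝ) (x ξ : E3) : ℝ := 2 * (gtphi M a x * angPhi x ξ)

theorem wideHom_pLin' (h : Small M a) : WideHom M 1 (pLin M a) :=
  ((WideHom.const 2).mul (wideHom_pLin h)).cast (by norm_num)

theorem hasFDerivAt_pK (h : Small M a) (hx : x ∈ wide M) (hξ : ξ ≠ 0) (τ : ℝ) :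
    HasFDerivAt (fun z : E3 × E3 => pK M a z.1 τ z.2)
      (τ ^ 2 • pd (fun y _ => gtt M a y) x ξ + τ • pd (pLin M a) x ξ + pd (pSpace M a) x ξ)
      (x, ξ) := by
  have := ((((wideHom_gtt h).hasFDerivAt hx hξ).mul_const (τ ^ 2)).add
    (((wideHom_pLin' h).hasFDerivAt hx hξ).mul_const τ)).add
    ((wideHom_pSpace h).hasFDerivAt hx hξ)
  refine this.congr_of_eventuallyEq (.of_forall fun z => ?_)
  simp only [pK, pLin, Pi.add_apply]
  ring

/-- The coefficients of `{p_K, ξ_r}` in `τ`. -/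
noncomputable def brK (M a : ℝ) : Fin 3 → E3 → E3 → ℝ :=
  ![pb (pSpace M a) xiR, pb (pLin M a) xiR, pb (fun y _ => gtt M a y) xiR]

/-- The coefficients of `{p_K, σ̃_K / ξ_r}` in `τ`. -/
noncomputable def brL (M a : ℝ) (b : ℝ → ℝ) : Fin 4 → E3 → E3 → ℝ :=
  ![pb (pSpace M a) (quot0 M a b),
    fun x ξ => pb (pLin M a) (quot0 M a b) x ξ + pb (pSpace M a) (quot1 M a b) x ξ,
    fun x ξ => pb (fun y _ => gtt M a y) (quot0 M a b) x ξ + pb (pLin M a) (quot1 M a b) x ξ,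
    pb (fun y _ => gtt M a y) (quot1 M a b)]

/-- `{p_K, ξ_r}`. -/
noncomputable def polyK (M a : ℝ) (x : E3) (τ : ℝ) (ξ : E3) : ℝ :=
  brK M a 2 x ξ * τ ^ 2 + brK M a 1 x ξ * τ + brK M a 0 x ξ

/-- `{p_K, σ̃_K / ξ_r}`. -/
noncomputable def polyL (M a : ℝ) (b : ℝ → ℝ) (x : E3) (τ : ℝ) (ξ : E3) : ℝ :=
  brL M a b 3 x ξ * τ ^ 3 + brL M a b 2 x ξ * τ ^ 2 + brL M a b 1 x ξ * τ + brL M a b 0 x ξ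

theorem polyK_eq (h : Small M a) (hx : x ∈ wide M) (hξ : ξ ≠ 0) (τ : ℝ) :
    polyK M a x τ ξ = poissonForm (pd (fun y η => pK M a y τ η) x ξ) (pd xiR x ξ) := by
  rw [pd_eq (hasFDerivAt_pK h hx hξ τ)]
  simp only [polyK, brK, Matrix.cons_val, pb, poissonForm_add_left, poissonForm_smul_left]
  ring

theorem polyL_eq (h : Small M a) (hx : x ∈ wide M) (hξ : ξ ≠ 0) (τ : ℝ) :
    polyL M a b x τ ξ = poissonForm (pd (fun y η => pK M a y τ η) x ξ)
      (pd (quot0 M a b) x ξ + τ • pd (quot1 M a b) x ξ) := by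
  rw [pd_eq (hasFDerivAt_pK h hx hξ τ)]
  simp only [polyL, brL, Matrix.cons_val, pb, poissonForm_add_left, poissonForm_smul_left,
    poissonForm_add_right, poissonForm_smul_right]
  ring

/-- The bracket `{p_K, σ̃_K}` as a polynomial in `τ`. -/
theorem poisson_mult (h : Small M a) (hb : ContDiffOn ℝ ∞ b (Set.Ioi (2 * M)))
    (hx : x ∈ wide M) (hξ : ξ ≠ 0) (τ : ℝ) :
    poisson (pK M a) (multSymbol M b (mult1 M a b) (mult0 M a b)) x τ ξ
      = (quot0 M a b x ξ + quot1 M a b x ξ * τ) * polyK M a x τ ξ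
        + xiR x ξ * polyL M a b x τ ξ := by
  have hp := hasFDerivAt_pK h hx hξ τ
  have hs := ((wideHom_xiR h.mass_pos).hasFDerivAt hx hξ).mul (hasFDerivAt_quot h hb hx hξ τ)
  rw [poisson_eq hp (hs.congr_of_eventuallyEq (.of_forall fun z => multSymbol_mult M a b z.1 τ z.2)),
    polyK_eq h hx hξ, polyL_eq h hx hξ, pd_eq (f := fun y η => pK M a y τ η) hp,
    poissonForm_add_right, poissonForm_smul_right,
    poissonForm_smul_right]
  ring

theorem polyK_root (h : Small M a) (hx : x ∈ wide M) (hξ : ξ ≠ 0) {τ : ℝ}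
    (h0 : pK M a x τ ξ = 0) :
    polyK M a x τ ξ = -radialDeriv M a x τ ξ / rhoSq a x := by
  have hx0 : x ≠ 0 := norm_pos_iff.1 (norm_pos_of_wide h.mass_pos hx)
  rw [polyK_eq h hx hξ, pd_eq (hasFDerivAt_xiR hx0)]
  exact pK_bracket_xiR h hx h0

theorem polyL_tau1 (h : Small M a) (hb : ContDiffOn ℝ ∞ b (Set.Ioi (2 * M)))
    (hx : x ∈ wide M) (hξ : ξ ≠ 0) : polyL M a b x (tau1 M a x ξ) ξ
      = (rho1 M a x ξ * bSlope b ‖x‖ + b ‖x‖ / ‖x‖)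
        * (2 * kDelta M a ‖x‖ * xiR x ξ / rhoSq a x) := by
  rw [polyL_eq h hx hξ, pK_bracket_quot1 h hb hx hξ]

theorem polyL_tau2 (h : Small M a) (hb : ContDiffOn ℝ ∞ b (Set.Ioi (2 * M)))
    (hx : x ∈ wide M) (hξ : ξ ≠ 0) : polyL M a b x (tau2 M a x ξ) ξ
      = (rho2 M a x ξ * bSlope b ‖x‖ + b ‖x‖ / ‖x‖)
        * (2 * kDelta M a ‖x‖ * xiR x ξ / rhoSq a x) := by
  rw [polyL_eq h hx hξ, pK_bracket_quot2 h hb hx hξ]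

theorem wideHom_brK (h : Small M a) (j : Fin 3) : WideHom M (2 - (j : ℕ)) (brK M a j) := by
  have hX := wideHom_xiR h.mass_pos
  fin_cases j
  · exact ((wideHom_pSpace h).pb hX).cast (by norm_num)
  · exact ((wideHom_pLin' h).pb hX).cast (by norm_num)
  · exact ((wideHom_gtt h).pb hX).cast (by norm_num)

theorem wideHom_brL (h : Small M a) (hb : ContDiffOn ℝ ∞ b (Set.Ioi (2 * M))) (j : Fin 4) :
    WideHom M (1 - (j : ℕ)) (brL M a b j) := by
  have h0 := wideHom_quot0 h hb
  have h1 := wideHom_quot1 h hb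
  fin_cases j
  · exact ((wideHom_pSpace h).pb h0).cast (by norm_num)
  · exact (((wideHom_pLin' h).pb h0).cast (by norm_num)).add
      (((wideHom_pSpace h).pb h1).cast (by norm_num))
  · exact (((wideHom_gtt h).pb h0).cast (by norm_num)).add
      (((wideHom_pLin' h).pb h1).cast (by norm_num))
  · exact ((wideHom_gtt h).pb h1).cast (by norm_num)

end BracketPolynomial

/-! ### Cubics with two known roots. -/

theorem cubic_factor {n₃ n₂ n₁ n₀ t₁ t₂ : ℝ} (h : t₁ - t₂ ≠ 0)
    (h1 : n₃ * t₁ ^ 3 + n₂ * t₁ ^ 2 + n₁ * t₁ + n₀ = 0)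
    (h2 : n₃ * t₂ ^ 3 + n₂ * t₂ ^ 2 + n₁ * t₂ + n₀ = 0) (τ : ℝ) :
    n₃ * τ ^ 3 + n₂ * τ ^ 2 + n₁ * τ + n₀
      = (τ - t₁) * (τ - t₂) * (n₂ + n₃ * (t₁ + t₂) + n₃ * τ) := by
  refine mul_left_cancel₀ h ?_
  linear_combination (τ - t₂) * h1 - (τ - t₁) * h2

/-- The derivative at a known root gives the value there of the affine cofactor; this is how `ẽ_K`
is evaluated on the characteristic set. -/
theorem cubic_deriv_root {n₃ n₂ n₁ n₀ t₁ t₂ : ℝ} (h : t₁ - t₂ ≠ 0)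
    (h1 : n₃ * t₁ ^ 3 + n₂ * t₁ ^ 2 + n₁ * t₁ + n₀ = 0)
    (h2 : n₃ * t₂ ^ 3 + n₂ * t₂ ^ 2 + n₁ * t₂ + n₀ = 0) :
    3 * n₃ * t₁ ^ 2 + 2 * n₂ * t₁ + n₁ = (t₁ - t₂) * (n₂ + n₃ * (t₁ + t₂) + n₃ * t₁) := by
  refine mul_left_cancel₀ h ?_
  linear_combination h1 - h2

/-! ### The coefficients `α`, `β` and the sum of squares. -/

section Correction

variable {M a C δ₁ : ℝ} {b ν : ℝ → ℝ} {x ξ : E3}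

/-- `α₁ / ϱ̃₁`. -/
noncomputable def alphaQuot1 (M a : ℝ) (b : ℝ → ℝ) (x ξ : E3) : ℝ :=
  2 * |tau1 M a x ξ| * (tau1 M a x ξ - tau2 M a x ξ)⁻¹
    * alphaK M a b ‖x‖ (tau1 M a x ξ) (angPhi x ξ)

/-- `α₂ / ϱ̃₂`. -/
noncomputable def alphaQuot2 (M a : ℝ) (b : ℝ → ℝ) (x ξ : E3) : ℝ :=
  2 * |tau2 M a x ξ| * (tau1 M a x ξ - tau2 M a x ξ)⁻¹
    * alphaK M a b ‖x‖ (tau2 M a x ξ) (angPhi x ξ)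

theorem alpha1_eq (M a : ℝ) (b : ℝ → ℝ) (x ξ : E3) :
    alpha1 M a b x ξ = alphaQuot1 M a b x ξ * rho1 M a x ξ := by
  rw [alpha1, alphaQuot1, div_eq_mul_inv]

theorem alpha2_eq (M a : ℝ) (b : ℝ → ℝ) (x ξ : E3) :
    alpha2 M a b x ξ = alphaQuot2 M a b x ξ * rho2 M a x ξ := by
  rw [alpha2, alphaQuot2, div_eq_mul_inv]

/-- `R̂_a` on the first sheet of the characteristic set. -/
noncomputable def hat1 (M a : ℝ) (x ξ : E3) : ℝ := RHat M a ‖x‖ (angPhi x ξ / tau1 M a x ξ)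

/-- `R̂_a` on the second sheet of the characteristic set. -/
noncomputable def hat2 (M a : ℝ) (x ξ : E3) : ℝ := RHat M a ‖x‖ (angPhi x ξ / tau2 M a x ξ)

theorem hat1_pos (h : Small M a) (hx : x ∈ wide M) (hξ : ξ ≠ 0) : 0 < hat1 M a x ξ :=
  RHat_pos h (wide_window hx) (div_tau1_mem h hx hξ)

theorem hat2_pos (h : Small M a) (hx : x ∈ wide M) (hξ : ξ ≠ 0) : 0 < hat2 M a x ξ :=
  RHat_pos h (wide_window hx) (div_tau2_mem h hx hξ)

theorem wideHom_RHat (h : Small M a) {s : E3 → E3 → ℝ} (hs : WideHom M 0 s)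
    (hd : ∀ x ∈ wide M, ∀ ξ ≠ 0, s x ξ ∈ trapDom M) :
    WideHom M 0 (fun x ξ => RHat M a ‖x‖ (s x ξ)) := by
  have h1 := hs.1
  have h2 := (hs.comp₀ (contDiffOn_rTrap h) hd).1
  have h3 := (wideHom_norm h.mass_pos).1
  refine ⟨?_, fun x hx ξ hξ c hc => ?_⟩
  · simp only [RHat_eq]
    unfold RaSlope
    fun_prop
  · have := hs.2 x hx ξ hξ c hc
    rw [zpow_zero, one_mul] at this ⊢
    beta_reduce
    rw [this]

theorem wideHom_hat1 (h : Small M a) : WideHom M 0 (hat1 M a) :=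
  wideHom_RHat h (wideHom_div_tau1 h) fun _ hx _ hξ => div_tau1_mem h hx hξ

theorem wideHom_hat2 (h : Small M a) : WideHom M 0 (hat2 M a) :=
  wideHom_RHat h (wideHom_div_tau2 h) fun _ hx _ hξ => div_tau2_mem h hx hξ

theorem alphaK_arg_pos (h : Small M a) (hpos : ∀ r, 2 * M < r → 0 < b r) (hx : x ∈ wide M)
    {R : ℝ} (hR : 0 < R) : 0 < b ‖x‖ / ‖x‖ * R / kDelta M a ‖x‖ ^ 2 := by
  have h1 := hpos _ (two_mul_lt_norm h.mass_pos hx)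
  have h2 := norm_pos_of_wide h.mass_pos hx
  have h3 := kDelta_pos h hx
  positivity

theorem wideHom_inv_kDelta_sq (h : Small M a) :
    WideHom M 0 (fun x _ => (kDelta M a ‖x‖ ^ 2)⁻¹) :=
  WideHom.of_space (((contDiffOn_kDelta (a := a) h.mass_pos).pow 2).inv fun _ hx =>
    (pow_pos (kDelta_pos h hx) 2).ne')

theorem wideHom_alphaK_arg (h : Small M a) (hb : ContDiffOn ℝ ∞ b (Set.Ioi (2 * M)))
    {R : E3 → E3 → ℝ} (hR : WideHom M 0 R) :
    WideHom M 0 (fun x ξ => b ‖x‖ / ‖x‖ * R x ξ / kDelta M a ‖x‖ ^ 2) :=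
  ((wideHom_div_norm h.mass_pos hb).mul hR).mul (wideHom_inv_kDelta_sq h)

/-- Once the factor `ϱ̃₁` is removed, what stands under the root is strictly positive, and `|τ̃₁| =
τ̃₁`; both square root and absolute value are therefore smooth. -/
theorem wideHom_alphaQuot1 (h : Small M a) (hb : ContDiffOn ℝ ∞ b (Set.Ioi (2 * M)))
    (hpos : ∀ r, 2 * M < r → 0 < b r) : WideHom M 0 (alphaQuot1 M a b) := by
  have h1 := (wideHom_alphaK_arg h hb (wideHom_hat1 h)).sqrt (n := 0)
    (fun x hx ξ hξ => alphaK_arg_pos h hpos hx (hat1_pos h hx hξ)) (by norm_num)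
  refine (((((WideHom.const 2).mul (wideHom_tau1 h)).mul (wideHom_inv_tau_sub h)).mul h1).cast
    (n := 0) (by norm_num)).congr fun x hx ξ hξ => ?_
  rw [alphaQuot1, abs_of_pos (tau1_pos h hx hξ)]
  rfl

theorem wideHom_alphaQuot2 (h : Small M a) (hb : ContDiffOn ℝ ∞ b (Set.Ioi (2 * M)))
    (hpos : ∀ r, 2 * M < r → 0 < b r) : WideHom M 0 (alphaQuot2 M a b) := by
  have h1 := (wideHom_alphaK_arg h hb (wideHom_hat2 h)).sqrt (n := 0)
    (fun x hx ξ hξ => alphaK_arg_pos h hpos hx (hat2_pos h hx hξ)) (by norm_num)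
  refine (((((WideHom.const 2).mul (wideHom_tau2 h).neg).mul (wideHom_inv_tau_sub h)).mul h1).cast
    (n := 0) (by norm_num)).congr fun x hx ξ hξ => ?_
  rw [alphaQuot2, abs_of_neg (tau2_neg h hx hξ)]
  rfl

theorem alphaQuot1_sq (h : Small M a) (hpos : ∀ r, 2 * M < r → 0 < b r) (hx : x ∈ wide M)
    (hξ : ξ ≠ 0) : alphaQuot1 M a b x ξ ^ 2 * (tau1 M a x ξ - tau2 M a x ξ) ^ 2
      = 4 * tau1 M a x ξ ^ 2 * (b ‖x‖ / ‖x‖ * hat1 M a x ξ / kDelta M a ‖x‖ ^ 2) := by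
  have hD := (tau_sub_pos h hx hξ).ne'
  have h1 : alphaK M a b ‖x‖ (tau1 M a x ξ) (angPhi x ξ) ^ 2
      = b ‖x‖ / ‖x‖ * hat1 M a x ξ / kDelta M a ‖x‖ ^ 2 :=
    Real.sq_sqrt (alphaK_arg_pos h hpos hx (hat1_pos h hx hξ)).le
  rw [← h1, alphaQuot1, mul_pow, mul_pow, mul_pow, sq_abs, inv_pow]
  field_simp
  ring

theorem alphaQuot2_sq (h : Small M a) (hpos : ∀ r, 2 * M < r → 0 < b r) (hx : x ∈ wide M)
    (hξ : ξ ≠ 0) : alphaQuot2 M a b x ξ ^ 2 * (tau1 M a x ξ - tau2 M a x ξ) ^ 2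
      = 4 * tau2 M a x ξ ^ 2 * (b ‖x‖ / ‖x‖ * hat2 M a x ξ / kDelta M a ‖x‖ ^ 2) := by
  have hD := (tau_sub_pos h hx hξ).ne'
  have h1 : alphaK M a b ‖x‖ (tau2 M a x ξ) (angPhi x ξ) ^ 2
      = b ‖x‖ / ‖x‖ * hat2 M a x ξ / kDelta M a ‖x‖ ^ 2 :=
    Real.sq_sqrt (alphaK_arg_pos h hpos hx (hat2_pos h hx hξ)).le
  rw [← h1, alphaQuot2, mul_pow, mul_pow, mul_pow, sq_abs, inv_pow]
  field_simp
  ring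

theorem betaSq_eq (hM : 0 < M) (hb : ContDiffOn ℝ ∞ b (Set.Ioi (2 * M))) {r : ℝ}
    (hr : 2 * M < r) (τ Φ : ℝ) : betaSq M a b r τ Φ
      = kDelta M a r * ((r - rTrap M a (Φ / τ)) * bSlope b r + b r / r)
        - (r - M) * (b r / r) * (r - rTrap M a (Φ / τ)) := by
  have h := (hasDerivAt_div_radius hM hb hr).mul
    ((hasDerivAt_id r).sub_const (rTrap M a (Φ / τ)))
  have h' : deriv (fun r' => b r' / r' * (r' - rTrap M a (Φ / τ))) r = _ := h.deriv
  rw [betaSq, h', id]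
  ring

/-- `β₁²`. -/
noncomputable def betaSq1 (M a : ℝ) (b : ℝ → ℝ) (x ξ : E3) : ℝ :=
  betaSq M a b ‖x‖ (tau1 M a x ξ) (angPhi x ξ)

/-- `β₂²`. -/
noncomputable def betaSq2 (M a : ℝ) (b : ℝ → ℝ) (x ξ : E3) : ℝ :=
  betaSq M a b ‖x‖ (tau2 M a x ξ) (angPhi x ξ)

theorem betaSq1_eq (hM : 0 < M) (hb : ContDiffOn ℝ ∞ b (Set.Ioi (2 * M))) (hx : x ∈ wide M) :
    betaSq1 M a b x ξ = kDelta M a ‖x‖ * (rho1 M a x ξ * bSlope b ‖x‖ + b ‖x‖ / ‖x‖)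
        - (‖x‖ - M) * (b ‖x‖ / ‖x‖) * rho1 M a x ξ :=
  betaSq_eq hM hb (two_mul_lt_norm hM hx) _ _

theorem betaSq2_eq (hM : 0 < M) (hb : ContDiffOn ℝ ∞ b (Set.Ioi (2 * M))) (hx : x ∈ wide M) :
    betaSq2 M a b x ξ = kDelta M a ‖x‖ * (rho2 M a x ξ * bSlope b ‖x‖ + b ‖x‖ / ‖x‖)
        - (‖x‖ - M) * (b ‖x‖ / ‖x‖) * rho2 M a x ξ :=
  betaSq_eq hM hb (two_mul_lt_norm hM hx) _ _

theorem wideHom_beta_expr (h : Small M a) (hb : ContDiffOn ℝ ∞ b (Set.Ioi (2 * M)))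
    {s : E3 → E3 → ℝ} (hs : WideHom M 0 s) :
    WideHom M 0 (fun x ξ => kDelta M a ‖x‖ * (s x ξ * bSlope b ‖x‖ + b ‖x‖ / ‖x‖)
        - (‖x‖ - M) * (b ‖x‖ / ‖x‖) * s x ξ) := by
  have hM := h.mass_pos
  have h1 := WideHom.of_space (contDiffOn_kDelta (a := a) hM)
  have h2 := WideHom.of_space (contDiffOn_radial hM (contDiffOn_bSlope hM hb))
  have h3 := wideHom_div_norm hM hb
  have h4 := (wideHom_norm hM).sub (WideHom.const M)
  exact ((h1.mul ((hs.mul h2).add h3)).sub ((h4.mul h3).mul hs))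

theorem wideHom_betaSq1 (h : Small M a) (hb : ContDiffOn ℝ ∞ b (Set.Ioi (2 * M))) :
    WideHom M 0 (betaSq1 M a b) :=
  (wideHom_beta_expr h hb (wideHom_rho1 h)).congr fun _ hx _ _ => betaSq1_eq h.mass_pos hb hx

theorem wideHom_betaSq2 (h : Small M a) (hb : ContDiffOn ℝ ∞ b (Set.Ioi (2 * M))) :
    WideHom M 0 (betaSq2 M a b) :=
  (wideHom_beta_expr h hb (wideHom_rho2 h)).congr fun _ hx _ _ => betaSq2_eq h.mass_pos hb hx

/-- The sum of the eight squares. -/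
theorem sum_muSq (hM : 0 < M) (hx : x ∈ wide M) (hξ : ξ ≠ 0) (τ : ℝ) :
    ∑ j, muSq M a C b ν x τ ξ j
      = 1 / 4 * (alpha1 M a b x ξ ^ 2 * (τ - tau2 M a x ξ) ^ 2
          + alpha2 M a b x ξ ^ 2 * (τ - tau1 M a x ξ) ^ 2)
        + 1 / 2 * (1 - 2 * ν ‖x‖) * (alpha1 M a b x ξ * alpha2 M a b x ξ)
          * ((τ - tau2 M a x ξ) * (τ - tau1 M a x ξ))
        + xiR x ξ ^ 2 * (1 / 2 * (betaSq1 M a b x ξ + betaSq2 M a b x ξ - C * a)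
          + 1 / 2 * ((C * a - betaSq2 M a b x ξ + betaSq1 M a b x ξ) * (τ - tau2 M a x ξ) ^ 2
            + (C * a - betaSq1 M a b x ξ + betaSq2 M a b x ξ) * (τ - tau1 M a x ξ) ^ 2)
            * (tau1 M a x ξ - tau2 M a x ξ)⁻¹ ^ 2) := by
  have hr := norm_pos_of_wide hM hx
  have hw := two_mul_lt_norm hM hx
  have hc : 0 < ‖x‖ ^ 2 - 2 * ‖x‖ * M := by nlinarith
  have hden := (radial_form_pos hM hx hξ hc).ne'
  have hl : lamSq x ξ = lam 0 x ξ ^ 2 + lam 1 x ξ ^ 2 + lam 2 x ξ ^ 2 := by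
    rw [lamSq, Fin.sum_univ_three]
  simp only [Fin.sum_univ_eight, muSq, Matrix.cons_val]
  change _ + 1 / 2 * (betaSq1 M a b x ξ + betaSq2 M a b x ξ - C * a) * xiR x ξ ^ 2 + _ + _ + _ + _
    + (C * a - betaSq2 M a b x ξ + betaSq1 M a b x ξ) * _ / _ * _
    + (C * a - betaSq1 M a b x ξ + betaSq2 M a b x ξ) * _ / _ * _ = _
  -- The angular weights and the radial weight sum to one, so `μ₃², …, μ₆²` add up to a single
  -- square.
  have key : ∀ q : ℝ, lam 0 x ξ ^ 2 / (lamSq x ξ + (‖x‖ ^ 2 - 2 * ‖x‖ * M) * xiR x ξ ^ 2) * q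
      + lam 1 x ξ ^ 2 / (lamSq x ξ + (‖x‖ ^ 2 - 2 * ‖x‖ * M) * xiR x ξ ^ 2) * q
      + lam 2 x ξ ^ 2 / (lamSq x ξ + (‖x‖ ^ 2 - 2 * ‖x‖ * M) * xiR x ξ ^ 2) * q
      + (‖x‖ ^ 2 - 2 * ‖x‖ * M) * xiR x ξ ^ 2
        / (lamSq x ξ + (‖x‖ ^ 2 - 2 * ‖x‖ * M) * xiR x ξ ^ 2) * q = q := by
    intro q
    rw [← add_mul, ← add_mul, ← add_mul, ← add_div, ← add_div, ← add_div, ← hl, div_self hden,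
      one_mul]
  have k := key (ν ‖x‖ / 4 * (alpha1 M a b x ξ * (τ - tau2 M a x ξ)
    - alpha2 M a b x ξ * (τ - tau1 M a x ξ)) ^ 2)
  simp only [← mul_assoc] at k
  generalize (tau1 M a x ξ - tau2 M a x ξ) = D
  simp only [div_eq_mul_inv, mul_inv, inv_pow] at k ⊢
  linear_combination k

end Correction

/-! ### Division by `p_K`: existence and uniqueness of the correction. -/

section Quotient

variable {M a C δ₁ : ℝ} {b ν : ℝ → ℝ} {x ξ : E3}

/-- The coefficients in `τ` of `μ₁² + ⋯ + μ₈²`. -/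
noncomputable def muCoeff (M a C : ℝ) (b ν : ℝ → ℝ) : Fin 3 → E3 → E3 → ℝ :=
  ![fun x ξ => 1 / 4 * (alpha1 M a b x ξ ^ 2 * tau2 M a x ξ ^ 2
        + alpha2 M a b x ξ ^ 2 * tau1 M a x ξ ^ 2)
      + 1 / 2 * (1 - 2 * ν ‖x‖) * (alpha1 M a b x ξ * alpha2 M a b x ξ)
        * (tau2 M a x ξ * tau1 M a x ξ)
      + xiR x ξ ^ 2 * (1 / 2 * (betaSq1 M a b x ξ + betaSq2 M a b x ξ - C * a)
        + 1 / 2 * ((C * a - betaSq2 M a b x ξ + betaSq1 M a b x ξ) * tau2 M a x ξ ^ 2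
          + (C * a - betaSq1 M a b x ξ + betaSq2 M a b x ξ) * tau1 M a x ξ ^ 2)
          * (tau1 M a x ξ - tau2 M a x ξ)⁻¹ ^ 2),
    fun x ξ => -(1 / 2 * (alpha1 M a b x ξ ^ 2 * tau2 M a x ξ
        + alpha2 M a b x ξ ^ 2 * tau1 M a x ξ))
      - 1 / 2 * (1 - 2 * ν ‖x‖) * (alpha1 M a b x ξ * alpha2 M a b x ξ)
        * (tau2 M a x ξ + tau1 M a x ξ)
      - xiR x ξ ^ 2 * ((C * a - betaSq2 M a b x ξ + betaSq1 M a b x ξ) * tau2 M a x ξ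
          + (C * a - betaSq1 M a b x ξ + betaSq2 M a b x ξ) * tau1 M a x ξ)
          * (tau1 M a x ξ - tau2 M a x ξ)⁻¹ ^ 2,
    fun x ξ => 1 / 4 * (alpha1 M a b x ξ ^ 2 + alpha2 M a b x ξ ^ 2)
      + 1 / 2 * (1 - 2 * ν ‖x‖) * (alpha1 M a b x ξ * alpha2 M a b x ξ)
      + C * a * (xiR x ξ * (tau1 M a x ξ - tau2 M a x ξ)⁻¹) ^ 2]

theorem sum_muSq_eq_coeff (hM : 0 < M) (hx : x ∈ wide M) (hξ : ξ ≠ 0) (τ : ℝ) :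
    ∑ j, muSq M a C b ν x τ ξ j = muCoeff M a C b ν 2 x ξ * τ ^ 2
      + muCoeff M a C b ν 1 x ξ * τ + muCoeff M a C b ν 0 x ξ := by
  rw [sum_muSq hM hx hξ]
  simp only [muCoeff, Matrix.cons_val]
  generalize (tau1 M a x ξ - tau2 M a x ξ)⁻¹ = I
  ring

/-- The coefficients in `τ` of `ρ⁻² (μ₁² + ⋯ + μ₈²) - {p_K, σ̃_K} / 2`. -/
noncomputable def numCoeff (M a C : ℝ) (b ν : ℝ → ℝ) : Fin 4 → E3 → E3 → ℝ :=
  ![fun x ξ => muCoeff M a C b ν 0 x ξ * (rhoSq a x)⁻¹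
      - 1 / 2 * (quot0 M a b x ξ * brK M a 0 x ξ + xiR x ξ * brL M a b 0 x ξ),
    fun x ξ => muCoeff M a C b ν 1 x ξ * (rhoSq a x)⁻¹
      - 1 / 2 * (quot0 M a b x ξ * brK M a 1 x ξ + quot1 M a b x ξ * brK M a 0 x ξ
        + xiR x ξ * brL M a b 1 x ξ),
    fun x ξ => muCoeff M a C b ν 2 x ξ * (rhoSq a x)⁻¹
      - 1 / 2 * (quot0 M a b x ξ * brK M a 2 x ξ + quot1 M a b x ξ * brK M a 1 x ξ
        + xiR x ξ * brL M a b 2 x ξ),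
    fun x ξ => -(1 / 2) * (quot1 M a b x ξ * brK M a 2 x ξ + xiR x ξ * brL M a b 3 x ξ)]

/-- `ρ⁻² (μ₁² + ⋯ + μ₈²) - {p_K, σ̃_K} / 2`. -/
noncomputable def num (M a C : ℝ) (b ν : ℝ → ℝ) (x : E3) (τ : ℝ) (ξ : E3) : ℝ :=
  numCoeff M a C b ν 3 x ξ * τ ^ 3 + numCoeff M a C b ν 2 x ξ * τ ^ 2
    + numCoeff M a C b ν 1 x ξ * τ + numCoeff M a C b ν 0 x ξ

theorem num_eq (hM : 0 < M) (hx : x ∈ wide M) (hξ : ξ ≠ 0) (τ : ℝ) :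
    num M a C b ν x τ ξ = (∑ j, muSq M a C b ν x τ ξ j) * (rhoSq a x)⁻¹
      - 1 / 2 * ((quot0 M a b x ξ + quot1 M a b x ξ * τ) * polyK M a x τ ξ
        + xiR x ξ * polyL M a b x τ ξ) := by
  rw [sum_muSq_eq_coeff hM hx hξ]
  simp only [num, numCoeff, polyK, polyL, Matrix.cons_val]
  ring

/-- At `τ = τ̃₁` the squares reduce to `α₁² (τ̃₁ - τ̃₂)² / 4 + β₁² ξ_r²`; the constant `C` and `β₂²`
cancel. Half of `ρ² {p_K, σ̃_K}` is the same quantity: the `R_a` term gives the first summand and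
the `ξ_r²` terms combine to `β₁²`. -/
theorem num_tau1 (h : Small M a) (hb : ContDiffOn ℝ ∞ b (Set.Ioi (2 * M)))
    (hpos : ∀ r, 2 * M < r → 0 < b r) (hx : x ∈ wide M) (hξ : ξ ≠ 0) :
    num M a C b ν x (tau1 M a x ξ) ξ = 0 := by
  have hM := h.mass_pos
  have hΔ := (kDelta_pos h hx).ne'
  have hρ := (rhoSq_pos (a := a) hM hx).ne'
  have hD := (tau_sub_pos h hx hξ).ne'
  have hR : Ra M a ‖x‖ (tau1 M a x ξ) (angPhi x ξ)
      = tau1 M a x ξ ^ 2 * hat1 M a x ξ * rho1 M a x ξ :=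
    Ra_eq_RHat h (tau1_pos h hx hξ).ne' (div_tau1_mem h hx hξ)
  have hα := alphaQuot1_sq h hpos hx hξ
  rw [num_eq hM hx hξ, sum_muSq hM hx hξ, quot_tau1 h hx hξ, polyK_root h hx hξ (pK_tau1 h hx hξ),
    polyL_tau1 h hb hx hξ, radialDeriv, hR, alpha1_eq, betaSq1_eq hM hb hx]
  generalize hat1 M a x ξ = R at *
  generalize alphaQuot1 M a b x ξ = A at *
  generalize betaSq2 M a b x ξ = B2
  generalize kDelta M a ‖x‖ = Δ at *
  generalize rhoSq a x = ρ at *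
  generalize bSlope b ‖x‖ = b'
  generalize b ‖x‖ / ‖x‖ = B at *
  generalize xiR x ξ = X
  generalize rho1 M a x ξ = r1
  generalize tau1 M a x ξ = t1 at *
  generalize tau2 M a x ξ = t2 at *
  rw [sub_self]
  field_simp at hα ⊢
  -- The rest is algebra; the defining relation of `α` is the only further input.
  linear_combination 2 * (t1 - t2) ^ 2 * r1 ^ 2 * hα

theorem num_tau2 (h : Small M a) (hb : ContDiffOn ℝ ∞ b (Set.Ioi (2 * M)))
    (hpos : ∀ r, 2 * M < r → 0 < b r) (hx : x ∈ wide M) (hξ : ξ ≠ 0) :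
    num M a C b ν x (tau2 M a x ξ) ξ = 0 := by
  have hM := h.mass_pos
  have hΔ := (kDelta_pos h hx).ne'
  have hρ := (rhoSq_pos (a := a) hM hx).ne'
  have hD := (tau_sub_pos h hx hξ).ne'
  have hR : Ra M a ‖x‖ (tau2 M a x ξ) (angPhi x ξ)
      = tau2 M a x ξ ^ 2 * hat2 M a x ξ * rho2 M a x ξ :=
    Ra_eq_RHat h (tau2_neg h hx hξ).ne (div_tau2_mem h hx hξ)
  have hα := alphaQuot2_sq h hpos hx hξ
  rw [num_eq hM hx hξ, sum_muSq hM hx hξ, quot_tau2 h hx hξ, polyK_root h hx hξ (pK_tau2 h hx hξ),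
    polyL_tau2 h hb hx hξ, radialDeriv, hR, alpha2_eq, betaSq2_eq hM hb hx]
  generalize hat2 M a x ξ = R at *
  generalize alphaQuot2 M a b x ξ = A at *
  generalize betaSq1 M a b x ξ = B1
  generalize kDelta M a ‖x‖ = Δ at *
  generalize rhoSq a x = ρ at *
  generalize bSlope b ‖x‖ = b'
  generalize b ‖x‖ / ‖x‖ = B at *
  generalize xiR x ξ = X
  generalize rho2 M a x ξ = r2
  generalize tau1 M a x ξ = t1 at *
  generalize tau2 M a x ξ = t2 at *
  rw [sub_self]
  field_simp at hα ⊢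
  linear_combination 2 * (t1 - t2) ^ 2 * r2 ^ 2 * hα

/-- The symbol `ẽ₋₁`. -/
noncomputable def corr1 (M a C : ℝ) (b ν : ℝ → ℝ) (x ξ : E3) : ℝ :=
  numCoeff M a C b ν 3 x ξ * (gtt M a x)⁻¹

/-- The symbol `q_S + ẽ₀`. -/
noncomputable def corrSum (M a C : ℝ) (b ν : ℝ → ℝ) (x ξ : E3) : ℝ :=
  (numCoeff M a C b ν 2 x ξ + numCoeff M a C b ν 3 x ξ * (tau1 M a x ξ + tau2 M a x ξ))
    * (gtt M a x)⁻¹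

/-- The symbol `ẽ₀`. -/
noncomputable def corr0 (M a C δ₁ : ℝ) (b ν : ℝ → ℝ) (x ξ : E3) : ℝ :=
  corrSum M a C b ν x ξ - qS M δ₁ b ‖x‖

theorem corrSymbol_corr (M a C δ₁ : ℝ) (b ν : ℝ → ℝ) (x : E3) (τ : ℝ) (ξ : E3) :
    corrSymbol M δ₁ b (corr0 M a C δ₁ b ν) (corr1 M a C b ν) x τ ξ
      = corrSum M a C b ν x ξ + corr1 M a C b ν x ξ * τ := by
  rw [corrSymbol, corr0]; ring

theorem num_eq_mul (h : Small M a) (hb : ContDiffOn ℝ ∞ b (Set.Ioi (2 * M)))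
    (hpos : ∀ r, 2 * M < r → 0 < b r) (hx : x ∈ wide M) (hξ : ξ ≠ 0) (τ : ℝ) :
    num M a C b ν x τ ξ
      = pK M a x τ ξ * (corrSum M a C b ν x ξ + corr1 M a C b ν x ξ * τ) := by
  have hg := (gtt_neg h hx).ne
  rw [num, cubic_factor (tau_sub_pos h hx hξ).ne' (num_tau1 h hb hpos hx hξ)
    (num_tau2 h hb hpos hx hξ) τ, pK_eq_factor h hx hξ, corrSum, corr1]
  field_simp

theorem kerr_identity (h : Small M a) (hb : ContDiffOn ℝ ∞ b (Set.Ioi (2 * M)))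
    (hpos : ∀ r, 2 * M < r → 0 < b r) (hx : x ∈ wide M) (hξ : ξ ≠ 0) (τ : ℝ) :
    rhoSq a x * (1 / 2 * poisson (pK M a) (multSymbol M b (mult1 M a b) (mult0 M a b)) x τ ξ
        + pK M a x τ ξ * (corrSum M a C b ν x ξ + corr1 M a C b ν x ξ * τ))
      = ∑ j, muSq M a C b ν x τ ξ j := by
  have hρ := (rhoSq_pos (a := a) h.mass_pos hx).ne'
  rw [← num_eq_mul h hb hpos hx hξ, num_eq h.mass_pos hx hξ, poisson_mult h hb hx hξ]
  field_simp
  ring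

section Smooth

theorem wideHom_inv_rhoSq (hM : 0 < M) : WideHom M 0 (fun x _ => (rhoSq a x)⁻¹) :=
  WideHom.of_space ((contDiffOn_rhoSq hM).inv fun _ hx => (rhoSq_pos hM hx).ne')

theorem wideHom_inv_gtt (h : Small M a) : WideHom M 0 (fun x _ => (gtt M a x)⁻¹) :=
  WideHom.of_space ((contDiffOn_gtt h).inv fun _ hx => (gtt_neg h hx).ne)

theorem wideHom_alpha1 (h : Small M a) (hb : ContDiffOn ℝ ∞ b (Set.Ioi (2 * M)))
    (hpos : ∀ r, 2 * M < r → 0 < b r) : WideHom M 0 (alpha1 M a b) :=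
  ((wideHom_alphaQuot1 h hb hpos).mul (wideHom_rho1 h)).congr fun _ _ _ _ => alpha1_eq M a b _ _

theorem wideHom_alpha2 (h : Small M a) (hb : ContDiffOn ℝ ∞ b (Set.Ioi (2 * M)))
    (hpos : ∀ r, 2 * M < r → 0 < b r) : WideHom M 0 (alpha2 M a b) :=
  ((wideHom_alphaQuot2 h hb hpos).mul (wideHom_rho2 h)).congr fun _ _ _ _ => alpha2_eq M a b _ _

theorem wideHom_nu (hM : 0 < M) (hν : ContDiffOn ℝ ∞ ν (Set.Ioi (2 * M))) :
    WideHom M 0 (fun x _ => 1 / 2 * (1 - 2 * ν ‖x‖)) :=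
  (WideHom.const (1 / 2)).mul ((WideHom.const 1).sub ((WideHom.const 2).mul
    (WideHom.of_space (contDiffOn_radial hM hν))))

theorem wideHom_muCoeff_two (h : Small M a) (hb : ContDiffOn ℝ ∞ b (Set.Ioi (2 * M)))
    (hpos : ∀ r, 2 * M < r → 0 < b r) (hν : ContDiffOn ℝ ∞ ν (Set.Ioi (2 * M))) :
    WideHom M 0 (muCoeff M a C b ν 2) := by
  have a1 := wideHom_alpha1 h hb hpos
  have a2 := wideHom_alpha2 h hb hpos
  have h1 := (WideHom.const (1 / 4)).mul (((a1.pow 2).cast (n := 0) (by norm_num)).add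
    ((a2.pow 2).cast (by norm_num)))
  have h2 := (wideHom_nu h.mass_pos hν).mul (a1.mul a2)
  have h3 := (WideHom.const (C * a)).mul
    (((((wideHom_xiR h.mass_pos).mul (wideHom_inv_tau_sub h))).pow 2).cast (n := 0) (by norm_num))
  exact (h1.add h2).add h3

theorem wideHom_numCoeff_three (h : Small M a) (hb : ContDiffOn ℝ ∞ b (Set.Ioi (2 * M))) :
    WideHom M (-1) (numCoeff M a C b ν 3) :=
  ((WideHom.const (-(1 / 2))).mul ((((wideHom_quot1 h hb).mul (wideHom_brK h 2)).cast (n := -1)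
    (by norm_num)).add (((wideHom_xiR h.mass_pos).mul (wideHom_brL h hb 3)).cast
      (by norm_num)))).cast (by norm_num)

theorem wideHom_numCoeff_two (h : Small M a) (hb : ContDiffOn ℝ ∞ b (Set.Ioi (2 * M)))
    (hpos : ∀ r, 2 * M < r → 0 < b r) (hν : ContDiffOn ℝ ∞ ν (Set.Ioi (2 * M))) :
    WideHom M 0 (numCoeff M a C b ν 2) :=
  ((wideHom_muCoeff_two h hb hpos hν).mul (wideHom_inv_rhoSq h.mass_pos)).sub
    ((WideHom.const (1 / 2)).mul (((((wideHom_quot0 h hb).mul (wideHom_brK h 2)).cast (n := 0)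
      (by norm_num)).add (((wideHom_quot1 h hb).mul (wideHom_brK h 1)).cast (by norm_num))).add
      (((wideHom_xiR h.mass_pos).mul (wideHom_brL h hb 2)).cast (by norm_num))))

theorem wideHom_corr1 (h : Small M a) (hb : ContDiffOn ℝ ∞ b (Set.Ioi (2 * M))) :
    WideHom M (-1) (corr1 M a C b ν) :=
  ((wideHom_numCoeff_three h hb).mul (wideHom_inv_gtt h)).cast (by norm_num)

theorem wideHom_corrSum (h : Small M a) (hb : ContDiffOn ℝ ∞ b (Set.Ioi (2 * M)))
    (hpos : ∀ r, 2 * M < r → 0 < b r) (hν : ContDiffOn ℝ ∞ ν (Set.Ioi (2 * M))) :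
    WideHom M 0 (corrSum M a C b ν) :=
  ((wideHom_numCoeff_two h hb hpos hν).add (((wideHom_numCoeff_three h hb).mul
    ((wideHom_tau1 h).add (wideHom_tau2 h))).cast (by norm_num))).mul (wideHom_inv_gtt h)

theorem contDiffOn_qS (hM : 0 < M) (hb : ContDiffOn ℝ ∞ b (Set.Ioi (2 * M))) :
    ContDiffOn ℝ ∞ (qS M δ₁ b) (Set.Ioi (2 * M)) := by
  have h0 : ∀ r ∈ Set.Ioi (2 * M), r ^ 4 ≠ 0 := fun r hr => by
    have : 2 * M < r := hr
    have : 0 < r := by linarith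
    positivity
  have h1 : ∀ r ∈ Set.Ioi (2 * M), r ^ 2 * (r - 2 * M) ≠ 0 := fun r hr => by
    have h2 : 2 * M < r := hr
    have : 0 < r := by linarith
    have : 0 < r - 2 * M := by linarith
    positivity
  unfold qS
  exact ((ContDiffOn.div (by fun_prop) (by fun_prop) h0).neg).sub
    ((ContDiffOn.div (by fun_prop) (by fun_prop) h1).mul hb)

theorem wideHom_corr0 (h : Small M a) (hb : ContDiffOn ℝ ∞ b (Set.Ioi (2 * M)))
    (hpos : ∀ r, 2 * M < r → 0 < b r) (hν : ContDiffOn ℝ ∞ ν (Set.Ioi (2 * M))) :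
    WideHom M 0 (corr0 M a C δ₁ b ν) :=
  (wideHom_corrSum h hb hpos hν).sub
    (WideHom.of_space (contDiffOn_radial h.mass_pos (contDiffOn_qS h.mass_pos hb)))

end Smooth

theorem isKerrCorrection_corr (h : Small M a) (hb : ContDiffOn ℝ ∞ b (Set.Ioi (2 * M)))
    (hpos : ∀ r, 2 * M < r → 0 < b r) (hν : ContDiffOn ℝ ∞ ν (Set.Ioi (2 * M))) :
    IsKerrCorrection M a C δ₁ b ν (mult1 M a b) (mult0 M a b) (corr0 M a C δ₁ b ν)
      (corr1 M a C b ν) := by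
  refine ⟨(wideHom_corr0 h hb hpos hν).isHomSymbol h.mass_pos,
    (wideHom_corr1 h hb).isHomSymbol h.mass_pos, fun x hx τ ξ hξ => ?_⟩
  rw [corrSymbol_corr]
  exact kerr_identity h hb hpos (shell_subset_wide h.mass_pos hx) hξ τ

theorem poisson_congr {p s t : E3 → ℝ → E3 → ℝ} {τ : ℝ}
    (h : ∀ᶠ z : E3 × E3 in nhds (x, ξ), s z.1 τ z.2 = t z.1 τ z.2) :
    poisson p s x τ ξ = poisson p t x τ ξ := by
  have h1 : (fun y => s y τ ξ) =ᶠ[nhds x] fun y => t y τ ξ :=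
    (Continuous.tendsto (f := fun y : E3 => (y, ξ)) (by fun_prop) x).eventually h
  have h2 : (fun η => s x τ η) =ᶠ[nhds ξ] fun η => t x τ η :=
    (Continuous.tendsto (f := fun η : E3 => (x, η)) (by fun_prop) ξ).eventually h
  simp only [poisson, dX, dXi, h1.fderiv_eq, h2.fderiv_eq]

/-- The correction symbols are determined by their implicit definition. -/
theorem IsKerrCorrection.eq (h : Small M a) (hb : ContDiffOn ℝ ∞ b (Set.Ioi (2 * M)))
    (hpos : ∀ r, 2 * M < r → 0 < b r) {s₁ s₀ e₀ e₁ : E3 → E3 → ℝ}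
    (hs : IsKerrMultiplier M a b s₁ s₀) (he : IsKerrCorrection M a C δ₁ b ν s₁ s₀ e₀ e₁)
    (hx : x ∈ shell M) (hξ : ξ ≠ 0) :
    e₀ x ξ = corr0 M a C δ₁ b ν x ξ ∧ e₁ x ξ = corr1 M a C b ν x ξ := by
  have hxw := shell_subset_wide h.mass_pos hx
  have hρ := (rhoSq_pos (a := a) h.mass_pos hxw).ne'
  have hD := tau_sub_pos h hxw hξ
  -- Beyond the larger root `p_K` is nonzero and can be cancelled. Two such values of `τ` determine
  -- an affine function.
  have key : ∀ τ, tau1 M a x ξ < τ → e₀ x ξ + e₁ x ξ * τ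
      = corr0 M a C δ₁ b ν x ξ + corr1 M a C b ν x ξ * τ := by
    intro τ hτ
    have hp : pK M a x τ ξ ≠ 0 := by
      rw [pK_eq_factor h hxw hξ]
      exact mul_ne_zero (mul_ne_zero (gtt_neg h hxw).ne (by linarith)) (by linarith)
    have k1 := he.2.2 x hx τ ξ hξ
    have k2 := kerr_identity (C := C) (ν := ν) h hb hpos hxw hξ τ
    -- Equality with the explicit symbols is known over the shell and off `ξ = 0`. This set is open,
    -- which suffices for the derivatives at the point.
    have k3 : poisson (pK M a) (multSymbol M b s₁ s₀) x τ ξ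
        = poisson (pK M a) (multSymbol M b (mult1 M a b) (mult0 M a b)) x τ ξ := by
      apply poisson_congr
      filter_upwards [((isOpen_shell M).prod isOpen_compl_singleton).mem_nhds
        (show (x, ξ) ∈ shell M ×ˢ ({0}ᶜ : Set E3) from ⟨hx, hξ⟩)] with z hz
      obtain ⟨q1, q2⟩ := hs.eq h hz.1 hz.2
      rw [multSymbol, multSymbol, q1, q2]
    rw [← k1, k3] at k2
    have k4 := mul_left_cancel₀ hp (add_left_cancel (mul_left_cancel₀ hρ k2))
    rw [← corrSymbol_corr (δ₁ := δ₁), corrSymbol, corrSymbol] at k4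
    linarith
  have k1 := key (tau1 M a x ξ + 1) (by linarith)
  have k2 := key (tau1 M a x ξ + 2) (by linarith)
  have k3 : e₁ x ξ = corr1 M a C b ν x ξ := by linarith
  rw [k3] at k1
  exact ⟨by linarith, k3⟩

end Quotient

/-! ### Vanishing of the correction symbol on the trapped set. -/

section CorrectionDecomposition

variable {M a C : ℝ} {b ν : ℝ → ℝ} {x ξ : E3}

/-- The `τ` derivative of `{p_K, σ̃_K / ξ_r}`. -/
noncomputable def polyLDeriv (M a : ℝ) (b : ℝ → ℝ) (x : E3) (τ : ℝ) (ξ : E3) : ℝ :=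
  3 * brL M a b 3 x ξ * τ ^ 2 + 2 * brL M a b 2 x ξ * τ + brL M a b 1 x ξ

/-- The `τ` derivative of `{p_K, ξ_r}`. -/
noncomputable def polyKDeriv (M a : ℝ) (x : E3) (τ : ℝ) (ξ : E3) : ℝ :=
  2 * brK M a 2 x ξ * τ + brK M a 1 x ξ

/-- The `τ` derivative of `num`. -/
noncomputable def numDeriv (M a C : ℝ) (b ν : ℝ → ℝ) (x : E3) (τ : ℝ) (ξ : E3) : ℝ :=
  3 * numCoeff M a C b ν 3 x ξ * τ ^ 2 + 2 * numCoeff M a C b ν 2 x ξ * τ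
    + numCoeff M a C b ν 1 x ξ

theorem numDeriv_eq (M a C : ℝ) (b ν : ℝ → ℝ) (x : E3) (τ : ℝ) (ξ : E3) :
    numDeriv M a C b ν x τ ξ
      = (2 * muCoeff M a C b ν 2 x ξ * τ + muCoeff M a C b ν 1 x ξ) * (rhoSq a x)⁻¹
        - 1 / 2 * (quot1 M a b x ξ * polyK M a x τ ξ
          + (quot0 M a b x ξ + quot1 M a b x ξ * τ) * polyKDeriv M a x τ ξ
          + xiR x ξ * polyLDeriv M a b x τ ξ) := by
  simp only [numDeriv, numCoeff, polyK, polyKDeriv, polyLDeriv, Matrix.cons_val]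
  ring

/-- The coefficient of `ϱ̃₁` in the `τ` derivative of `num` at `τ̃₁`. -/
noncomputable def corrA1 (M a : ℝ) (b ν : ℝ → ℝ) (x ξ : E3) : ℝ :=
  (tau1 M a x ξ - tau2 M a x ξ) * (1 / 2 * alpha1 M a b x ξ
      + 1 / 2 * (1 - 2 * ν ‖x‖) * alpha2 M a b x ξ) * alphaQuot1 M a b x ξ * (rhoSq a x)⁻¹
    - 1 / 2 * (2 * (quot1 M a b x ξ * tau1 M a x ξ ^ 2 * hat1 M a x ξ * (kDelta M a ‖x‖ ^ 2)⁻¹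
        * (rhoSq a x)⁻¹)
      + b ‖x‖ / ‖x‖ * polyKDeriv M a x (tau1 M a x ξ) ξ)

/-- The coefficient of `ϱ̃₂` in the `τ` derivative of `num` at `τ̃₂`. -/
noncomputable def corrA2 (M a : ℝ) (b ν : ℝ → ℝ) (x ξ : E3) : ℝ :=
  -((tau1 M a x ξ - tau2 M a x ξ) * (1 / 2 * alpha2 M a b x ξ
      + 1 / 2 * (1 - 2 * ν ‖x‖) * alpha1 M a b x ξ) * alphaQuot2 M a b x ξ * (rhoSq a x)⁻¹)
    - 1 / 2 * (2 * (quot1 M a b x ξ * tau2 M a x ξ ^ 2 * hat2 M a x ξ * (kDelta M a ‖x‖ ^ 2)⁻¹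
        * (rhoSq a x)⁻¹)
      + b ‖x‖ / ‖x‖ * polyKDeriv M a x (tau2 M a x ξ) ξ)

/-- The coefficient of `ξ_r` in the `τ` derivative of `num` at `τ̃₁`. -/
noncomputable def corrB1 (M a C : ℝ) (b : ℝ → ℝ) (x ξ : E3) : ℝ :=
  xiR x ξ * (tau1 M a x ξ - tau2 M a x ξ)⁻¹ * (C * a - betaSq2 M a b x ξ + betaSq1 M a b x ξ)
      * (rhoSq a x)⁻¹
    - 1 / 2 * (polyLDeriv M a b x (tau1 M a x ξ) ξ
      - 2 * ((‖x‖ - M) * (quot1 M a b x ξ * xiR x ξ) * (rhoSq a x)⁻¹))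

/-- The coefficient of `ξ_r` in the `τ` derivative of `num` at `τ̃₂`. -/
noncomputable def corrB2 (M a C : ℝ) (b : ℝ → ℝ) (x ξ : E3) : ℝ :=
  -(xiR x ξ * (tau1 M a x ξ - tau2 M a x ξ)⁻¹ * (C * a - betaSq1 M a b x ξ + betaSq2 M a b x ξ)
      * (rhoSq a x)⁻¹)
    - 1 / 2 * (polyLDeriv M a b x (tau2 M a x ξ) ξ
      - 2 * ((‖x‖ - M) * (quot1 M a b x ξ * xiR x ξ) * (rhoSq a x)⁻¹))

/-- After one `τ` derivative each term still has a vanishing factor: the squares leave `α₁ =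
(α₁/ϱ̃₁) ϱ̃₁` or `ξ_r²`, the interpolant equals `r⁻¹ b ϱ̃₁`, and `{p_K, ξ_r}` is a combination of
`ξ_r²` and `R_a`, which is divisible by `ϱ̃₁`. -/
theorem numDeriv_tau1 (h : Small M a) (hx : x ∈ wide M) (hξ : ξ ≠ 0) :
    numDeriv M a C b ν x (tau1 M a x ξ) ξ
      = corrA1 M a b ν x ξ * rho1 M a x ξ + corrB1 M a C b x ξ * xiR x ξ := by
  have hD := (tau_sub_pos h hx hξ).ne'
  have hR : Ra M a ‖x‖ (tau1 M a x ξ) (angPhi x ξ)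
      = tau1 M a x ξ ^ 2 * hat1 M a x ξ * rho1 M a x ξ :=
    Ra_eq_RHat h (tau1_pos h hx hξ).ne' (div_tau1_mem h hx hξ)
  have hI : (tau1 M a x ξ - tau2 M a x ξ) * (tau1 M a x ξ - tau2 M a x ξ)⁻¹ = 1 :=
    mul_inv_cancel₀ hD
  rw [numDeriv_eq, quot_tau1 h hx hξ, polyK_root h hx hξ (pK_tau1 h hx hξ), radialDeriv, hR]
  simp only [muCoeff, Matrix.cons_val, corrA1, corrB1, alpha1_eq M a b x ξ]
  generalize (tau1 M a x ξ - tau2 M a x ξ)⁻¹ = I at *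
  simp only [div_eq_mul_inv _ (rhoSq a x), div_eq_mul_inv _ (kDelta M a ‖x‖ ^ 2)]
  linear_combination xiR x ξ ^ 2 * I * (C * a - betaSq2 M a b x ξ + betaSq1 M a b x ξ)
    * (rhoSq a x)⁻¹ * hI

theorem numDeriv_tau2 (h : Small M a) (hx : x ∈ wide M) (hξ : ξ ≠ 0) :
    numDeriv M a C b ν x (tau2 M a x ξ) ξ
      = corrA2 M a b ν x ξ * rho2 M a x ξ + corrB2 M a C b x ξ * xiR x ξ := by
  have hD := (tau_sub_pos h hx hξ).ne'
  have hR : Ra M a ‖x‖ (tau2 M a x ξ) (angPhi x ξ)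
      = tau2 M a x ξ ^ 2 * hat2 M a x ξ * rho2 M a x ξ :=
    Ra_eq_RHat h (tau2_neg h hx hξ).ne (div_tau2_mem h hx hξ)
  have hI : (tau1 M a x ξ - tau2 M a x ξ) * (tau1 M a x ξ - tau2 M a x ξ)⁻¹ = 1 :=
    mul_inv_cancel₀ hD
  rw [numDeriv_eq, quot_tau2 h hx hξ, polyK_root h hx hξ (pK_tau2 h hx hξ), radialDeriv, hR]
  simp only [muCoeff, Matrix.cons_val, corrA2, corrB2, alpha2_eq M a b x ξ]
  generalize (tau1 M a x ξ - tau2 M a x ξ)⁻¹ = I at *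
  simp only [div_eq_mul_inv _ (rhoSq a x), div_eq_mul_inv _ (kDelta M a ‖x‖ ^ 2)]
  linear_combination -(xiR x ξ ^ 2 * I * (C * a - betaSq1 M a b x ξ + betaSq2 M a b x ξ)
    * (rhoSq a x)⁻¹) * hI

/-- The common denominator of the coefficients of `ẽ_K`. -/
noncomputable def corrDen (M a : ℝ) (x ξ : E3) : ℝ :=
  (gtt M a x)⁻¹ * (tau1 M a x ξ - tau2 M a x ξ)⁻¹ ^ 2

/-- `ẽ_K` vanishes on the trapped set. -/
theorem corr_decomposition (h : Small M a) (hb : ContDiffOn ℝ ∞ b (Set.Ioi (2 * M)))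
    (hpos : ∀ r, 2 * M < r → 0 < b r) (hx : x ∈ wide M) (hξ : ξ ≠ 0) (τ : ℝ) :
    corrSum M a C b ν x ξ + corr1 M a C b ν x ξ * τ
      = corrA1 M a b ν x ξ * corrDen M a x ξ * (rho1 M a x ξ * (τ - tau2 M a x ξ))
        + corrA2 M a b ν x ξ * corrDen M a x ξ * (rho2 M a x ξ * (τ - tau1 M a x ξ))
        + (-(corrB1 M a C b x ξ * tau2 M a x ξ + corrB2 M a C b x ξ * tau1 M a x ξ)
            * corrDen M a x ξ
          + (corrB1 M a C b x ξ + corrB2 M a C b x ξ) * corrDen M a x ξ * τ) * xiR x ξ := by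
  have hD := (tau_sub_pos h hx hξ).ne'
  -- `cubic_deriv_root` is applied a second time with the roots exchanged.
  have hD' : tau2 M a x ξ - tau1 M a x ξ ≠ 0 := fun h0 => hD (by linarith)
  have hg := (gtt_neg h hx).ne
  have z1 := num_tau1 (C := C) (ν := ν) h hb hpos hx hξ
  have z2 := num_tau2 (C := C) (ν := ν) h hb hpos hx hξ
  have d1 := cubic_deriv_root hD z1 z2
  have d2 := cubic_deriv_root hD' z2 z1
  have e1 := numDeriv_tau1 (C := C) (b := b) (ν := ν) h hx hξ
  have e2 := numDeriv_tau2 (C := C) (b := b) (ν := ν) h hx hξ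
  rw [numDeriv, d1] at e1
  rw [numDeriv, d2] at e2
  rw [corrSum, corr1, corrDen]
  generalize numCoeff M a C b ν 3 x ξ = n3 at *
  generalize numCoeff M a C b ν 2 x ξ = n2 at *
  generalize tau1 M a x ξ = t1 at *
  generalize tau2 M a x ξ = t2 at *
  field_simp
  -- Lagrange interpolation from the two roots. One power of `(τ̃₁ - τ̃₂)⁻¹` comes from
  -- interpolating and one from the `τ` derivative of `p_K`; exchanging the roots supplies the sign
  -- of the second term.
  linear_combination (τ - t2) * e1 + (τ - t1) * e2

section Smooth

theorem wideHom_polyKDeriv (h : Small M a) {t : E3 → E3 → ℝ} (ht : WideHom M 1 t) :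
    WideHom M 1 (fun x ξ => polyKDeriv M a x (t x ξ) ξ) :=
  ((((WideHom.const 2).mul (wideHom_brK h 2)).mul ht).cast (n := 1) (by norm_num)).add
    ((wideHom_brK h 1).cast (by norm_num))

theorem wideHom_polyLDeriv (h : Small M a) (hb : ContDiffOn ℝ ∞ b (Set.Ioi (2 * M)))
    {t : E3 → E3 → ℝ} (ht : WideHom M 1 t) :
    WideHom M 0 (fun x ξ => polyLDeriv M a b x (t x ξ) ξ) :=
  ((((((WideHom.const 3).mul (wideHom_brL h hb 3)).mul (ht.pow 2)).cast (n := 0)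
    (by norm_num)).add ((((WideHom.const 2).mul (wideHom_brL h hb 2)).mul ht).cast
    (by norm_num))).add ((wideHom_brL h hb 1).cast (by norm_num)))

theorem wideHom_corrA_tail (h : Small M a) (hb : ContDiffOn ℝ ∞ b (Set.Ioi (2 * M)))
    {t R : E3 → E3 → ℝ} (ht : WideHom M 1 t) (hR : WideHom M 0 R) :
    WideHom M 1 (fun x ξ => 1 / 2 * (2 * (quot1 M a b x ξ * t x ξ ^ 2 * R x ξ
        * (kDelta M a ‖x‖ ^ 2)⁻¹ * (rhoSq a x)⁻¹)
      + b ‖x‖ / ‖x‖ * polyKDeriv M a x (t x ξ) ξ)) := by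
  have h1 := ((((wideHom_quot1 h hb).mul (ht.pow 2)).mul hR).mul (wideHom_inv_kDelta_sq h)).mul
    (wideHom_inv_rhoSq (a := a) h.mass_pos)
  have h2 := ((WideHom.const 2).mul h1).cast (n := 1) (by norm_num)
  have h3 := ((wideHom_div_norm h.mass_pos hb).mul (wideHom_polyKDeriv h ht)).cast (n := 1)
    (by norm_num)
  exact ((WideHom.const (1 / 2)).mul (h2.add h3)).cast (by norm_num)

theorem wideHom_corrB_tail (h : Small M a) (hb : ContDiffOn ℝ ∞ b (Set.Ioi (2 * M)))
    {t : E3 → E3 → ℝ} (ht : WideHom M 1 t) :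
    WideHom M 0 (fun x ξ => 1 / 2 * (polyLDeriv M a b x (t x ξ) ξ
      - 2 * ((‖x‖ - M) * (quot1 M a b x ξ * xiR x ξ) * (rhoSq a x)⁻¹))) := by
  have h1 := ((wideHom_quot1 h hb).mul (wideHom_xiR h.mass_pos)).cast (n := 0) (by norm_num)
  have h2 := (((wideHom_norm h.mass_pos).sub (WideHom.const M)).mul h1).mul
    (wideHom_inv_rhoSq (a := a) h.mass_pos)
  exact (WideHom.const (1 / 2)).mul ((wideHom_polyLDeriv h hb ht).sub ((WideHom.const 2).mul h2))

theorem wideHom_corrB1 (h : Small M a) (hb : ContDiffOn ℝ ∞ b (Set.Ioi (2 * M)))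
    : WideHom M 0 (corrB1 M a C b) := by
  have h1 := ((wideHom_xiR h.mass_pos).mul (wideHom_inv_tau_sub h)).cast (n := 0) (by norm_num)
  have h2 := ((WideHom.const (C * a)).sub (wideHom_betaSq2 h hb)).add (wideHom_betaSq1 h hb)
  exact ((h1.mul h2).mul (wideHom_inv_rhoSq (a := a) h.mass_pos)).sub
    (wideHom_corrB_tail h hb (wideHom_tau1 h))

theorem wideHom_corrB2 (h : Small M a) (hb : ContDiffOn ℝ ∞ b (Set.Ioi (2 * M)))
    : WideHom M 0 (corrB2 M a C b) := by
  have h1 := ((wideHom_xiR h.mass_pos).mul (wideHom_inv_tau_sub h)).cast (n := 0) (by norm_num)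
  have h2 := ((WideHom.const (C * a)).sub (wideHom_betaSq1 h hb)).add (wideHom_betaSq2 h hb)
  exact ((h1.mul h2).mul (wideHom_inv_rhoSq (a := a) h.mass_pos)).neg.sub
    (wideHom_corrB_tail h hb (wideHom_tau2 h))

theorem wideHom_corrDen (h : Small M a) : WideHom M (-2) (corrDen M a) :=
  ((wideHom_inv_gtt h).mul ((wideHom_inv_tau_sub h).pow 2)).cast (by norm_num)

theorem wideHom_corrA1 (h : Small M a) (hb : ContDiffOn ℝ ∞ b (Set.Ioi (2 * M)))
    (hpos : ∀ r, 2 * M < r → 0 < b r) (hν : ContDiffOn ℝ ∞ ν (Set.Ioi (2 * M)))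
    : WideHom M 1 (corrA1 M a b ν) := by
  have h1 := (((WideHom.const (1 / 2)).mul (wideHom_alpha1 h hb hpos)).add
    ((wideHom_nu h.mass_pos hν).mul (wideHom_alpha2 h hb hpos)))
  have h2 := (((wideHom_tau_sub h).mul h1).mul (wideHom_alphaQuot1 h hb hpos)).mul
    (wideHom_inv_rhoSq (a := a) h.mass_pos)
  exact (h2.cast (by norm_num)).sub (wideHom_corrA_tail h hb (wideHom_tau1 h) (wideHom_hat1 h))

theorem wideHom_corrA2 (h : Small M a) (hb : ContDiffOn ℝ ∞ b (Set.Ioi (2 * M)))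
    (hpos : ∀ r, 2 * M < r → 0 < b r) (hν : ContDiffOn ℝ ∞ ν (Set.Ioi (2 * M)))
    : WideHom M 1 (corrA2 M a b ν) := by
  have h1 := (((WideHom.const (1 / 2)).mul (wideHom_alpha2 h hb hpos)).add
    ((wideHom_nu h.mass_pos hν).mul (wideHom_alpha1 h hb hpos)))
  have h2 := (((wideHom_tau_sub h).mul h1).mul (wideHom_alphaQuot2 h hb hpos)).mul
    (wideHom_inv_rhoSq (a := a) h.mass_pos)
  exact (h2.cast (by norm_num)).neg.sub
    (wideHom_corrA_tail h hb (wideHom_tau2 h) (wideHom_hat2 h))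

end Smooth

end CorrectionDecomposition

/-! ### From homogeneous identities to decompositions with smoothing remainder. -/

section Truncation

variable {M a : ℝ} {χ χ' : ℝ → ℝ} {m m₁ m₂ m₃ m₄ : ℤ} {u v c₁ c₂ c₃ c₄ : E3 → E3 → ℝ}

theorem IsFreqCutoff.apply_zero (hχ : IsFreqCutoff χ) : χ 0 = 0 := by
  obtain ⟨-, -, c, hc, h0⟩ := hχ
  exact h0 0 hc.le

theorem IsFreqCutoff.trunc_eq (hχ : IsFreqCutoff χ) {ξ : E3} (hξ : 1 < ‖ξ‖) (s : E3 → E3 → ℝ)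
    (x : E3) : trunc χ s x ξ = s x ξ := by
  rw [trunc, hχ.2.1 _ hξ.le, one_mul]

/-- A decomposition valid at frequencies above `1` has a smoothing remainder after truncation. -/
theorem isSmoothingTau_remainder (h : Small M a) (hχ : IsFreqCutoff χ) (hχ' : IsFreqCutoff χ')
    (hu : SmoothAll M u) (hv : SmoothAll M v) (h₁ : WideHom M m₁ c₁) (h₂ : WideHom M m₂ c₂)
    (h₃ : WideHom M m₃ c₃) (h₄ : WideHom M m₄ c₄)
    (e : ∀ x ∈ wide M, ∀ ξ : E3, 1 < ‖ξ‖ → ∀ τ : ℝ, u x ξ + τ * v x ξ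
      = c₁ x ξ * (rho1 M a x ξ * (τ - tau2 M a x ξ)) + c₂ x ξ * (rho2 M a x ξ * (τ - tau1 M a x ξ))
        + (c₃ x ξ + c₄ x ξ * τ) * xiR x ξ) :
    IsSmoothingTau M (fun x τ ξ => u x ξ + τ * v x ξ
      - (trunc χ c₁ x ξ * vanish1 M a χ χ' x τ ξ + trunc χ c₂ x ξ * vanish2 M a χ χ' x τ ξ
        + (trunc χ c₃ x ξ + trunc χ c₄ x ξ * τ) * xiR x ξ)) := by
  have hM := h.mass_pos
  have t₁ := h₁.smoothAll_trunc hχ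
  have t₂ := h₂.smoothAll_trunc hχ
  have t₃ := h₃.smoothAll_trunc hχ
  have t₄ := h₄.smoothAll_trunc hχ
  have p₁ := (wideHom_rho1 h).smoothAll_trunc hχ'
  have p₂ := (wideHom_rho2 h).smoothAll_trunc hχ'
  have q₁ := (wideHom_tau1 h).smoothAll_trunc hχ
  have q₂ := (wideHom_tau2 h).smoothAll_trunc hχ
  have hr := smoothAll_xiR hM
  refine ⟨fun x ξ => u x ξ + trunc χ c₁ x ξ * (trunc χ' (rho1 M a) x ξ * trunc χ (tau2 M a) x ξ)
      + trunc χ c₂ x ξ * (trunc χ' (rho2 M a) x ξ * trunc χ (tau1 M a) x ξ)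
      - trunc χ c₃ x ξ * xiR x ξ,
    fun x ξ => v x ξ - trunc χ c₁ x ξ * trunc χ' (rho1 M a) x ξ
      - trunc χ c₂ x ξ * trunc χ' (rho2 M a) x ξ - trunc χ c₄ x ξ * xiR x ξ,
    SmoothAll.isSmoothing hM (((hu.add (t₁.mul (p₁.mul q₂))).add (t₂.mul (p₂.mul q₁))).sub
      (t₃.mul hr)) fun x hx ξ hξ => ?_,
    SmoothAll.isSmoothing hM (((hv.sub (t₁.mul p₁)).sub (t₂.mul p₂)).sub (t₄.mul hr))
      fun x hx ξ hξ => ?_, fun x τ ξ => ?_⟩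
  -- The value at `τ = 0` isolates the part without `τ`; in the next case the difference of the
  -- values at `1` and `0` isolates its coefficient.
  · simp only [hχ.trunc_eq hξ, hχ'.trunc_eq hξ]
    linear_combination e x hx ξ hξ 0
  · simp only [hχ.trunc_eq hξ, hχ'.trunc_eq hξ]
    linear_combination e x hx ξ hξ 1 - e x hx ξ hξ 0
  · simp only [vanish1, vanish2]
    ring

/-- The coefficients are the truncated homogeneous ones, and the remainder is defined as the
difference; only its smoothing property needs the identity at `|ξ| > 1`. -/
theorem Decomposes.of_wideHom (h : Small M a) (hχ : IsFreqCutoff χ) (hχ' : IsFreqCutoff χ')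
    (hu : SmoothAll M u) (hv : SmoothAll M v) (h₁ : WideHom M m c₁) (h₂ : WideHom M m c₂)
    (h₃ : WideHom M m c₃) (h₄ : WideHom M (m - 1) c₄)
    (e : ∀ x ∈ wide M, ∀ ξ : E3, 1 < ‖ξ‖ → ∀ τ : ℝ, u x ξ + τ * v x ξ
      = c₁ x ξ * (rho1 M a x ξ * (τ - tau2 M a x ξ)) + c₂ x ξ * (rho2 M a x ξ * (τ - tau1 M a x ξ))
        + (c₃ x ξ + c₄ x ξ * τ) * xiR x ξ)
    {f : E3 → ℝ → E3 → ℝ} (hf : ∀ x ∈ shell M, ∀ τ ξ, f x τ ξ = u x ξ + τ * v x ξ) :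
    Decomposes M a χ χ' m f :=
  ⟨_, _, _, _, _, (h₁.evHom_trunc hχ).isSymbol h.mass_pos, (h₂.evHom_trunc hχ).isSymbol h.mass_pos,
    (h₃.evHom_trunc hχ).isSymbol h.mass_pos, (h₄.evHom_trunc hχ).isSymbol h.mass_pos,
    isSmoothingTau_remainder h hχ hχ' hu hv h₁ h₂ h₃ h₄ e,
    fun x hx τ ξ => by rw [hf x hx]; ring⟩

theorem DecomposesStrict.of_wideHom (h : Small M a) (hχ : IsFreqCutoff χ) (hχ' : IsFreqCutoff χ')
    (hu : SmoothAll M u) (hv : SmoothAll M v) (h₁ : WideHom M m c₁) (h₂ : WideHom M m c₂)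
    (h₃ : WideHom M m c₃)
    (e : ∀ x ∈ wide M, ∀ ξ : E3, 1 < ‖ξ‖ → ∀ τ : ℝ, u x ξ + τ * v x ξ
      = c₁ x ξ * (rho1 M a x ξ * (τ - tau2 M a x ξ)) + c₂ x ξ * (rho2 M a x ξ * (τ - tau1 M a x ξ))
        + c₃ x ξ * xiR x ξ)
    {f : E3 → ℝ → E3 → ℝ} (hf : ∀ x ∈ shell M, ∀ τ ξ, f x τ ξ = u x ξ + τ * v x ξ) :
    DecomposesStrict M a χ χ' m f :=
  ⟨_, _, _, _, (h₁.evHom_trunc hχ).isSymbol h.mass_pos, (h₂.evHom_trunc hχ).isSymbol h.mass_pos,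
    (h₃.evHom_trunc hχ).isSymbol h.mass_pos,
    isSmoothingTau_remainder h hχ hχ' hu hv h₁ h₂ h₃ (WideHom.const 0)
      (fun x hx ξ hξ τ => by rw [e x hx ξ hξ τ]; ring),
    fun x hx τ ξ => by
      rw [hf x hx]
      simp only [trunc]
      ring⟩

end Truncation

/-! ### Decompositions of `s_K`, its derivatives and `e_K`. -/

section TruncatedMultiplier

variable {M a : ℝ} {b χ χ' : ℝ → ℝ} {s₁ s₀ : E3 → E3 → ℝ} {x ξ : E3}

/-- The part of `s_K` without `τ`. -/
noncomputable def truncMult1 (M a : ℝ) (b χ : ℝ → ℝ) (x ξ : E3) : ℝ :=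
  b ‖x‖ * (1 - 3 * M / ‖x‖) * xiR x ξ + trunc (fun y => χ y ^ 2) (mult1 M a b) x ξ

/-- The coefficient of `τ` in `s_K`. -/
noncomputable def truncMult0 (M a : ℝ) (b χ : ℝ → ℝ) : E3 → E3 → ℝ :=
  trunc (fun y => χ y ^ 2) (mult0 M a b)

theorem smoothAll_truncMult1 (h : Small M a) (hb : ContDiffOn ℝ ∞ b (Set.Ioi (2 * M)))
    (hχ : IsFreqCutoff χ) : SmoothAll M (truncMult1 M a b χ) :=
  ((SmoothAll.of_space (contDiffOn_radialPart h.mass_pos hb)).mul (smoothAll_xiR h.mass_pos)).add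
    ((wideHom_mult1 h hb).smoothAll_trunc hχ.sq)

theorem smoothAll_truncMult0 (h : Small M a) (hb : ContDiffOn ℝ ∞ b (Set.Ioi (2 * M)))
    (hχ : IsFreqCutoff χ) : SmoothAll M (truncMult0 M a b χ) :=
  (wideHom_mult0 h hb).smoothAll_trunc hχ.sq

theorem truncMult_eq (hχ : IsFreqCutoff χ) (hξ : 1 < ‖ξ‖) (x : E3) (τ : ℝ) :
    truncMult1 M a b χ x ξ + τ * truncMult0 M a b χ x ξ
      = xiR x ξ * (quot0 M a b x ξ + quot1 M a b x ξ * τ) := by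
  rw [truncMult1, truncMult0, hχ.sq.trunc_eq hξ, hχ.sq.trunc_eq hξ, ← multSymbol_mult, multSymbol]
  ring

theorem sK_eq (h : Small M a) (hχ : IsFreqCutoff χ) (hs : IsKerrMultiplier M a b s₁ s₀)
    (hx : x ∈ shell M) (τ : ℝ) (ξ : E3) :
    sK M b χ s₁ s₀ x τ ξ = truncMult1 M a b χ x ξ + τ * truncMult0 M a b χ x ξ := by
  rw [sK, multSymbol, truncMult1, truncMult0]
  rcases eq_or_ne ξ 0 with rfl | hξ
  -- At `ξ = 0` the implicit symbols are unconstrained, but `χ 0 = 0` removes them.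
  · simp [trunc, hχ.apply_zero]
  · simp only [trunc, (hs.eq h hx hξ).1, (hs.eq h hx hξ).2]
    ring

/-- The interpolation formula times `ξ_r` already has this form: the coefficients are `±ξ_r r⁻¹ b /
(τ̃₁ - τ̃₂)`, of degree zero, and the separate `ξ_r` term is zero. -/
theorem decomposesStrict_sK (h : Small M a) (hb : ContDiffOn ℝ ∞ b (Set.Ioi (2 * M)))
    (hχ : IsFreqCutoff χ) (hχ' : IsFreqCutoff χ') (hs : IsKerrMultiplier M a b s₁ s₀) :
    DecomposesStrict M a χ χ' 0 (sK M b χ s₁ s₀) := by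
  have hc := (((wideHom_xiR h.mass_pos).mul (wideHom_div_norm h.mass_pos hb)).mul
    (wideHom_inv_tau_sub h)).cast (n := 0) (by norm_num)
  refine DecomposesStrict.of_wideHom h hχ hχ' (smoothAll_truncMult1 h hb hχ)
    (smoothAll_truncMult0 h hb hχ) hc hc.neg (WideHom.const 0) (fun x _ ξ hξ τ => ?_)
    fun x hx τ ξ => sK_eq h hχ hs hx τ ξ
  rw [truncMult_eq hχ hξ, quot_eq]
  ring

theorem hasFDerivAt_sK (h : Small M a) (hb : ContDiffOn ℝ ∞ b (Set.Ioi (2 * M)))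
    (hχ : IsFreqCutoff χ) (hs : IsKerrMultiplier M a b s₁ s₀) (hx : x ∈ shell M) (τ : ℝ) (ξ : E3) :
    HasFDerivAt (fun z : E3 × E3 => sK M b χ s₁ s₀ z.1 τ z.2)
      (pd (truncMult1 M a b χ) x ξ + τ • pd (truncMult0 M a b χ) x ξ) (x, ξ) := by
  have hxw := shell_subset_wide h.mass_pos hx
  refine (((smoothAll_truncMult1 h hb hχ).hasFDerivAt hxw ξ).add
    (((smoothAll_truncMult0 h hb hχ).hasFDerivAt hxw ξ).const_mul τ)).congr_of_eventuallyEq ?_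
  filter_upwards [((isOpen_shell M).prod isOpen_univ).mem_nhds
    (show (x, ξ) ∈ shell M ×ˢ (Set.univ : Set E3) from ⟨hx, trivial⟩)] with z hz
  exact sK_eq h hχ hs hz.1 τ z.2

/-- The truncation is invisible on the open set `|ξ| > 1`, so this is the Leibniz rule for `ξ_r Q`:
the first summand carries the `ϱ̃ᵢ`, the second the factor `ξ_r`. -/
theorem pd_truncMult (h : Small M a) (hb : ContDiffOn ℝ ∞ b (Set.Ioi (2 * M)))
    (hχ : IsFreqCutoff χ) (hx : x ∈ wide M) (hξ : 1 < ‖ξ‖) (τ : ℝ) (e : E3 × E3) :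
    pd (truncMult1 M a b χ) x ξ e + τ * pd (truncMult0 M a b χ) x ξ e
      = (quot0 M a b x ξ + quot1 M a b x ξ * τ) * pd xiR x ξ e
        + (pd (quot0 M a b) x ξ e + pd (quot1 M a b) x ξ e * τ) * xiR x ξ := by
  have hξ0 : ξ ≠ 0 := norm_pos_iff.1 (by linarith)
  have h1 := ((smoothAll_truncMult1 h hb hχ).hasFDerivAt hx ξ).add
    (((smoothAll_truncMult0 h hb hχ).hasFDerivAt hx ξ).const_mul τ)
  have h2 := ((wideHom_xiR h.mass_pos).hasFDerivAt hx hξ0).mul (hasFDerivAt_quot h hb hx hξ0 τ)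
  have ho : IsOpen {z : E3 × E3 | 1 < ‖z.2‖} := isOpen_lt continuous_const (by fun_prop)
  have h3 := h1.unique (h2.congr_of_eventuallyEq (by
    filter_upwards [ho.mem_nhds (show (x, ξ) ∈ {z : E3 × E3 | 1 < ‖z.2‖} from hξ)] with z hz
    exact truncMult_eq hχ hz z.1 τ))
  have h4 := DFunLike.congr_fun h3 e
  simp only [add_apply, smul_apply, smul_eq_mul] at h4
  linear_combination h4

/-- The common argument for `∂_x s_K` and `∂_ξ s_K`: `e` is a coordinate direction, along which
derivatives lower the degree by `d`. -/
theorem decomposes_pd_sK (h : Small M a) (hb : ContDiffOn ℝ ∞ b (Set.Ioi (2 * M)))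
    (hχ : IsFreqCutoff χ) (hχ' : IsFreqCutoff χ') {d : ℤ} {e : E3 × E3}
    (he : ∀ {m : ℤ} {s : E3 → E3 → ℝ}, WideHom M m s →
      WideHom M (m - d) (fun x ξ => pd s x ξ e))
    {f : E3 → ℝ → E3 → ℝ} (hf : ∀ x ∈ shell M, ∀ τ ξ,
      f x τ ξ = pd (truncMult1 M a b χ) x ξ e + τ * pd (truncMult0 M a b χ) x ξ e) :
    Decomposes M a χ χ' (-d) f := by
  have hc := (((he (wideHom_xiR h.mass_pos)).mul (wideHom_div_norm h.mass_pos hb)).mul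
    (wideHom_inv_tau_sub h)).cast (n := -d) (by ring)
  refine Decomposes.of_wideHom h hχ hχ' ((smoothAll_truncMult1 h hb hχ).pd_apply e)
    ((smoothAll_truncMult0 h hb hχ).pd_apply e) hc hc.neg
    ((he (wideHom_quot0 h hb)).cast (by ring)) ((he (wideHom_quot1 h hb)).cast (by ring))
    (fun x hx ξ hξ τ => ?_) hf
  rw [pd_truncMult h hb hχ hx hξ, quot_eq]
  ring

theorem decomposes_dX_sK (h : Small M a) (hb : ContDiffOn ℝ ∞ b (Set.Ioi (2 * M)))
    (hχ : IsFreqCutoff χ) (hχ' : IsFreqCutoff χ') (hs : IsKerrMultiplier M a b s₁ s₀)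
    (k : Fin 3) : Decomposes M a χ χ' 0 (dX k (sK M b χ s₁ s₀)) := by
  have := decomposes_pd_sK h hb hχ hχ' (d := 0) (e := (ev k, 0)) (f := dX k (sK M b χ s₁ s₀))
    (fun hs => (hs.pd_space (ev k)).cast (by ring))
    fun x hx τ ξ => dX_eq (hasFDerivAt_sK h hb hχ hs hx τ ξ) k
  simpa using this

theorem decomposes_dXi_sK (h : Small M a) (hb : ContDiffOn ℝ ∞ b (Set.Ioi (2 * M)))
    (hχ : IsFreqCutoff χ) (hχ' : IsFreqCutoff χ') (hs : IsKerrMultiplier M a b s₁ s₀)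
    (k : Fin 3) : Decomposes M a χ χ' (-1) (dXi k (sK M b χ s₁ s₀)) :=
  decomposes_pd_sK h hb hχ hχ' (d := 1) (e := (0, ev k)) (fun hs => hs.pd_freq (ev k))
    fun _ hx τ ξ => dXi_eq (hasFDerivAt_sK h hb hχ hs hx τ ξ) k

end TruncatedMultiplier

/-- The untruncated `q_S` and the truncated `ẽ₀` add up to `corrSum` for `|ξ| > 1`, where
`corr_decomposition` applies. The degrees match because `corrA1`, `corrA2` have degree `1`,
`corrB1`, `corrB2` degree `0` and `corrDen` degree `-2`. -/
theorem decomposes_eK {M a C δ₁ : ℝ} {b ν χ χ' : ℝ → ℝ} {s₁ s₀ e₀ e₁ : E3 → E3 → ℝ}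
    (h : Small M a) (hb : ContDiffOn ℝ ∞ b (Set.Ioi (2 * M)))
    (hpos : ∀ r, 2 * M < r → 0 < b r) (hν : ContDiffOn ℝ ∞ ν (Set.Ioi (2 * M)))
    (hχ : IsFreqCutoff χ) (hχ' : IsFreqCutoff χ') (hs : IsKerrMultiplier M a b s₁ s₀)
    (he : IsKerrCorrection M a C δ₁ b ν s₁ s₀ e₀ e₁) :
    Decomposes M a χ χ' (-1) (eK M δ₁ b χ e₀ e₁) := by
  have hB1 := wideHom_corrB1 (C := C) h hb
  have hB2 := wideHom_corrB2 (C := C) h hb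
  have hD := wideHom_corrDen h
  refine Decomposes.of_wideHom h hχ hχ'
    (u := fun x ξ => qS M δ₁ b ‖x‖ + trunc (fun y => χ y ^ 2) (corr0 M a C δ₁ b ν) x ξ)
    (v := trunc (fun y => χ y ^ 2) (corr1 M a C b ν))
    ((SmoothAll.of_space (contDiffOn_radial h.mass_pos (contDiffOn_qS h.mass_pos hb))).add
      ((wideHom_corr0 h hb hpos hν).smoothAll_trunc hχ.sq))
    ((wideHom_corr1 h hb).smoothAll_trunc hχ.sq)
    (((wideHom_corrA1 h hb hpos hν).mul hD).cast (by norm_num))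
    (((wideHom_corrA2 h hb hpos hν).mul hD).cast (by norm_num))
    (((((hB1.mul (wideHom_tau2 h)).add (hB2.mul (wideHom_tau1 h))).neg).mul hD).cast (by norm_num))
    (((hB1.add hB2).mul hD).cast (by norm_num))
    (fun x hx ξ hξ τ => ?_) fun x hx τ ξ => ?_
  · have hξ0 : ξ ≠ 0 := norm_pos_iff.1 (by linarith)
    rw [hχ.sq.trunc_eq hξ, hχ.sq.trunc_eq hξ, ← corr_decomposition h hb hpos hx hξ0, corr0]
    ring
  · rw [eK, corrSymbol]
    rcases eq_or_ne ξ 0 with rfl | hξ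
    · simp [trunc, hχ.apply_zero]
    · obtain ⟨h0, h1⟩ := he.eq h hb hpos hs hx hξ
      simp only [trunc, h0, h1]
      ring

end KerrTrap

theorem lemma2p5 (M : ℝ) (hM : 0 < M) :
    ∃ a₀ : ℝ, 0 < a₀ ∧ ∀ a : ℝ, 0 < a → a < a₀ →
      ∀ (b ν : ℝ → ℝ) (δ₁ C : ℝ),
        ContDiffOn ℝ ∞ b (Set.Ioi (2 * M)) → (∀ r, 2 * M < r → 0 < b r) →
        ContDiffOn ℝ ∞ ν (Set.Ioi (2 * M)) →
        (∀ r, |r - 3 * M| < M / 3 → 0 < ν r ∧ ν r < 1) →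
        -- the implicitly defined symbols exist
        (∃ s₁ s₀ e₀ e₁ : KerrTrap.E3 → KerrTrap.E3 → ℝ,
          KerrTrap.IsKerrMultiplier M a b s₁ s₀ ∧
          KerrTrap.IsKerrCorrection M a C δ₁ b ν s₁ s₀ e₀ e₁) ∧
        -- and they vanish on the trapped set
        ∀ s₁ s₀ e₀ e₁ : KerrTrap.E3 → KerrTrap.E3 → ℝ,
          KerrTrap.IsKerrMultiplier M a b s₁ s₀ →
          KerrTrap.IsKerrCorrection M a C δ₁ b ν s₁ s₀ e₀ e₁ →
          ∀ χ χ' : ℝ → ℝ, KerrTrap.IsFreqCutoff χ → KerrTrap.IsFreqCutoff χ' →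
            KerrTrap.DecomposesStrict M a χ χ' 0 (KerrTrap.sK M b χ s₁ s₀) ∧
            (∀ k : Fin 3,
              KerrTrap.Decomposes M a χ χ' 0 (KerrTrap.dX k (KerrTrap.sK M b χ s₁ s₀))) ∧
            (∀ k : Fin 3,
              KerrTrap.Decomposes M a χ χ' (-1) (KerrTrap.dXi k (KerrTrap.sK M b χ s₁ s₀))) ∧
            KerrTrap.Decomposes M a χ χ' (-1) (KerrTrap.eK M δ₁ b χ e₀ e₁) := by
  -- The threshold is the one in `Small`, under which all the numerical estimates above were made.
  refine ⟨M / 1000, by positivity, fun a ha haM b ν δ₁ C hb hpos hν _ => ?_⟩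
  have h : KerrTrap.Small M a := ⟨hM, ha, haM⟩
  refine ⟨⟨_, _, _, _, KerrTrap.isKerrMultiplier_mult h hb,
    KerrTrap.isKerrCorrection_corr h hb hpos hν⟩, fun s₁ s₀ e₀ e₁ hs he χ χ' hχ hχ' =>
    ⟨KerrTrap.decomposesStrict_sK h hb hχ hχ' hs, KerrTrap.decomposes_dX_sK h hb hχ hχ' hs,
      KerrTrap.decomposes_dXi_sK h hb hχ hχ' hs, KerrTrap.decomposes_eK h hb hpos hν hχ hχ' hs he⟩⟩
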